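/- Work over $\mathbb C$. Let $V$ be a finite-dimensional vector space, let $\mathbb PV$ be the projective space of one-dimensional subspaces of $V^\ast$, and let $X\subseteq\mathbb PV$ be a nondegenerate projective variety (irreducible, reduced, with linear span $\mathbb PV$) of dimension $n$ with smooth locus $\operatorname{Sm}X$ and affine cone $\widehat X\subseteq V^\ast$. For $k\ge 0$ and $z\in\operatorname{Sm}X$ the $k$-osculating space $\mathbb T^k_zX\subseteq\mathbb PV$ is the linear subspace spanned by the partial derivatives $\partial^\alpha\phi(0)\in V^\ast$, $|\alpha|\le k$, where $\phi:(\mathbb C^n,0)\to(\widehat X,\widehat z)$, with $0\ne\widehat z\in V^\ast$ over $z$, is a holomorphic lifting of a local parametrization of $X$ at $z$. For $q\ge 1$ let $$\sigma_q\tau^kX=\overline{\bigcup\,\langle\mathbb T^k_{z_1}X,\ldots,\mathbb T^k_{z_q}X\rangle}\subseteq\mathbb PV$$ (Zariski closure), where the union is over the $(z_1,\ldots,z_q)\in(\operatorname{Sm}X)^q$ at which the dimension of the linear span $\langle\mathbb T^k_{z_1}X,\ldots,\mathbb T^k_{z_q}X\rangle$ attains its maximum. Let $I(\sigma_q\tau^kX)_{q+1}\subseteq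 S^{q+1}V$ be the space of forms of degree $q+1$ vanishing on $\sigma_q\tau^kX$. Let $\emptyset\ne U\subseteq\operatorname{Sm}X$ be any Zariski open subset of $X$ such that $\dim\mathbb T^k_zX$ equals its maximum over $\operatorname{Sm}X$ for every $z\in U$; put $L=\mathcal O_X(1)|_U$, and regard $S^{q+1}V$, as the space of symmetric tensors in $V^{\otimes(q+1)}$, as a subspace of $H^0(U^{q+1},L^{\boxtimes(q+1)})$. Let $\Delta^{q+1}\subset U^{q+1}$ be the big diagonal, the set of $(z_0,\ldots,z_q)$ with $z_i=z_j$ for some $i<j$, and let $\mathcal I^{(\ell)}_{\Delta^{q+1}/U^{q+1}}$ be the $\ell$-th symbolic power of its radical ideal sheaf, i.e. the ideal sheaf of the functions vanishing to order at least $\ell$ along $\Delta^{q+1}$. Then for all integers $q\ge 1$ and $k\ge 0$ $$I(\sigma_q\tau^kX)_{q+1}=S^{q+1}V\cap H^0\!\left(U^{q+1},\,L^{\boxtimes(q+1)}\otimes\mathcal I^{(2k+2)}_{\Delta^{q+1}/U^{q+1}}\right)$$ in $H^0(U^{q+1},L^{\boxtimes(q+1)})$. -/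

import Mathlib

open scoped LinearAlgebra.Projectivization Topology

namespace OscSec

/-- The vector space `V* = ℂ^(N+1)`; its linear coordinates form a basis of `V`. -/
abbrev Vec (N : ℕ) : Type := Fin (N + 1) → ℂ

/-- The projective space `ℙV` of one-dimensional subspaces of `V* = ℂ^(N+1)`. -/
abbrev PSpace (N : ℕ) : Type := ℙ ℂ (Vec N)

/-- The symmetric algebra of `V`: polynomials in the homogeneous coordinates of `ℙV`. -/
abbrev Forms (N : ℕ) : Type := MvPolynomial (Fin (N + 1)) ℂ

variable {N : ℕ}

/-- The affine cone over `X`, that is, the union of the lines that are the points of `X`. -/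
def cone (X : Set (PSpace N)) : Set (Vec N) :=
  {v | ∃ z ∈ X, v ∈ z.submodule}

/-- The homogeneous ideal `I(X)` of `X ⊆ ℙV`: the polynomials vanishing on the affine cone. -/
noncomputable def homIdeal (X : Set (PSpace N)) : Ideal (Forms N) :=
  MvPolynomial.vanishingIdeal ℂ (cone X)

/-- The degree `d` part `I(X)_d ⊆ S^d V`, as a subspace of the polynomial ring. -/
noncomputable def homIdealPart (X : Set (PSpace N)) (d : ℕ) : Submodule ℂ (Forms N) :=
  MvPolynomial.homogeneousSubmodule (Fin (N + 1)) ℂ d ⊓ (homIdeal X).restrictScalars ℂ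

/-- The Zariski closure of a subset of `ℙV`. -/
def zariskiClosure (Y : Set (PSpace N)) : Set (PSpace N) :=
  {z | ∀ F ∈ homIdeal Y, ∀ v ∈ z.submodule, MvPolynomial.eval v F = 0}

/-- Zariski closed subsets of `ℙV`. -/
def IsZariskiClosed (Y : Set (PSpace N)) : Prop :=
  zariskiClosure Y = Y

/-- Projective varieties (irreducible and reduced): closed subsets with prime homogeneous ideal. -/
def IsProjectiveVariety (X : Set (PSpace N)) : Prop :=
  IsZariskiClosed X ∧ (homIdeal X).IsPrime

/-- `X ⊆ ℙV` is nondegenerate if its linear span is all of `ℙV`. -/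
def IsNondegenerate (X : Set (PSpace N)) : Prop :=
  Submodule.span ℂ (cone X) = ⊤

/-- The dimension of a (nonempty closed) `X ⊆ ℙV`: the Krull dimension of its homogeneous
coordinate ring, minus one. -/
noncomputable def projDim (X : Set (PSpace N)) : ℕ :=
  ((ringKrullDim (Forms N ⧸ homIdeal X)).unbotD 0).toNat - 1

/-- The Zariski tangent space of the affine cone over `X` at a vector `v`. -/
noncomputable def coneTangentSpace (X : Set (PSpace N)) (v : Vec N) : Submodule ℂ (Vec N) where
  carrier := {w | ∀ F ∈ homIdeal X,
    ∑ i, w i * MvPolynomial.eval v (MvPolynomial.pderiv i F) = 0}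
  zero_mem' := by
    intro F _
    simp
  add_mem' := by
    intro a b ha hb F hF
    simp [add_mul, Finset.sum_add_distrib, ha F hF, hb F hF]
  smul_mem' := by
    intro c a ha F hF
    simp [mul_assoc, ← Finset.mul_sum, ha F hF]

/-- The smooth locus `Sm X` of a projective variety (Jacobian criterion: the tangent space has
the dimension of the variety, here for the affine cones). -/
def smoothLocus (X : Set (PSpace N)) : Set (PSpace N) :=
  {z | z ∈ X ∧ Module.finrank ℂ (coneTangentSpace X z.rep) = projDim X + 1}

/-- `φ : (ℂ^n, 0) → (cone X, ẑ)`, with `n = dim X`, is a holomorphic lifting of a local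
parametrization of `X` at `z`: composed with the projection to `ℙV` it is an immersion at `0`
(hence injective near `0`) into `X` that maps `0` to `z`, and every neighbourhood of `0` is mapped
onto a neighbourhood of `z` in `X` (in the Euclidean topology). -/
structure IsLocalLift (X : Set (PSpace N)) (z : PSpace N)
    (φ : (Fin (projDim X) → ℂ) → Vec N) : Prop where
  analyticAt : AnalyticAt ℂ φ 0
  base_ne_zero : φ 0 ≠ 0
  base_mem : φ 0 ∈ z.submodule
  mem_cone : ∀ᶠ t in 𝓝 0, φ t ∈ cone X
  immersion : ∀ w, fderiv ℂ φ 0 w ∈ Submodule.span ℂ {φ 0} → w = 0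
  onto : ∀ W ∈ 𝓝 (0 : Fin (projDim X) → ℂ),
    ∀ᶠ v in 𝓝[cone X] (φ 0), ∃ t ∈ W, ∃ c : ℂ, v = c • φ t

/-- The span of all partial derivatives of `φ` at `0` of order at most `k`. -/
noncomputable def jetSpan {n : ℕ} (φ : (Fin n → ℂ) → Vec N) (k : ℕ) : Submodule ℂ (Vec N) :=
  Submodule.span ℂ {w | ∃ m ≤ k, ∃ j : Fin m → Fin n,
    w = iteratedFDeriv ℂ m φ 0 (fun i => Pi.single (j i) 1)}

/-- The linear subspace of `V*` whose projectivization is the `k`-osculating space of `X` at a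
smooth point `z`. The span `jetSpan φ k` does not depend on the choice of the lifting `φ`, so the
supremum below is the common value. -/
noncomputable def oscSpace (X : Set (PSpace N)) (k : ℕ) (z : PSpace N) : Submodule ℂ (Vec N) :=
  ⨆ (φ : (Fin (projDim X) → ℂ) → Vec N) (_ : IsLocalLift X z φ), jetSpan φ k

/-- The linear span of the `k`-osculating spaces of `X` at the points `z 0, …, z (q - 1)`. -/
noncomputable def oscJoin (X : Set (PSpace N)) {q : ℕ} (k : ℕ) (z : Fin q → PSpace N) :
    Submodule ℂ (Vec N) :=
  ⨆ i, oscSpace X k (z i)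

/-- The `q`-tuples of smooth points of `X` at which the dimension of the span of the
`k`-osculating spaces attains its maximum. -/
def maximalTuples (X : Set (PSpace N)) (q k : ℕ) : Set (Fin q → PSpace N) :=
  {z | (∀ i, z i ∈ smoothLocus X) ∧
    ∀ y : Fin q → PSpace N, (∀ i, y i ∈ smoothLocus X) →
      Module.finrank ℂ (oscJoin X k y) ≤ Module.finrank ℂ (oscJoin X k z)}

/-- The `q`-secant variety `σ_q τ^k X` to the `k`-osculating variety to `X`. -/
def secOsc (X : Set (PSpace N)) (q k : ℕ) : Set (PSpace N) :=
  zariskiClosure {p | ∃ z ∈ maximalTuples X q k, p.submodule ≤ oscJoin X k z}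

/-- Nonempty (hence dense, when `X` is a variety) Zariski open subsets `U` of `X` contained in the
smooth locus at all of whose points the `k`-osculating space has the maximal dimension. -/
structure IsOscMaximalOpen (X : Set (PSpace N)) (k : ℕ) (U : Set (PSpace N)) : Prop where
  nonempty : U.Nonempty
  isOpen : ∃ A : Set (PSpace N), IsZariskiClosed A ∧ U = X \ A
  subset_smooth : U ⊆ smoothLocus X
  maximal : ∀ z ∈ U, ∀ y ∈ smoothLocus X,
    Module.finrank ℂ (oscSpace X k y) ≤ Module.finrank ℂ (oscSpace X k z)

/-! ### Symbolic powers and germs of functions on subsets of affine space -/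

/-- The `ℓ`-th symbolic power of a radical ideal `I`: the elements that lie in `I ^ ℓ` after
localizing at each minimal prime of `I`. -/
def symbolicPower {R : Type*} [CommRing R] (I : Ideal R) (ℓ : ℕ) : Ideal R where
  carrier := {r | ∀ P ∈ I.minimalPrimes, ∃ s, s ∉ P ∧ s * r ∈ I ^ ℓ}
  zero_mem' := by
    intro P hP
    exact ⟨1, (Ideal.ne_top_iff_one P).1 hP.1.1.ne_top, by simp⟩
  add_mem' := by
    intro a b ha hb P hP
    obtain ⟨s, hs, hsa⟩ := ha P hP
    obtain ⟨t, ht, htb⟩ := hb P hP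
    refine ⟨s * t, fun h => (hP.1.1.mem_or_mem h).elim hs ht, ?_⟩
    have h1 : t * (s * a) + s * (t * b) ∈ I ^ ℓ :=
      add_mem (Ideal.mul_mem_left _ _ hsa) (Ideal.mul_mem_left _ _ htb)
    have h2 : s * t * (a + b) = t * (s * a) + s * (t * b) := by ring
    rw [h2]
    exact h1
  smul_mem' := by
    intro c a ha P hP
    obtain ⟨s, hs, hsa⟩ := ha P hP
    refine ⟨s, hs, ?_⟩
    have h2 : s * (c • a) = c * (s * a) := by
      rw [smul_eq_mul]
      ring
    rw [h2]
    exact Ideal.mul_mem_left _ _ hsa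

variable {σ : Type}

/-- Polynomial functions on a subset `Y` of the affine space `ℂ^σ`. -/
abbrev CoordRing (Y : Set (σ → ℂ)) : Type :=
  MvPolynomial σ ℂ ⧸ MvPolynomial.vanishingIdeal ℂ Y

/-- Evaluation of polynomial functions on `Y` at a point `p` of `Y`. -/
noncomputable def evalAt (Y : Set (σ → ℂ)) (p : Y) : CoordRing Y →+* ℂ :=
  Ideal.Quotient.lift _ (MvPolynomial.aeval (R := ℂ) (p : σ → ℂ)).toRingHom
    (fun _ hF => hF p p.2)

/-- The maximal ideal of the polynomial functions on `Y` vanishing at `p`. -/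
noncomputable def idealAt (Y : Set (σ → ℂ)) (p : Y) : Ideal (CoordRing Y) :=
  RingHom.ker (evalAt Y p)

instance idealAt_isPrime (Y : Set (σ → ℂ)) (p : Y) : (idealAt Y p).IsPrime :=
  RingHom.ker_isPrime _

/-- The local ring at `p` of a locally closed subset `Y` of affine space, as a reduced algebraic
set. -/
abbrev LocalRingAt (Y : Set (σ → ℂ)) (p : Y) : Type :=
  Localization.AtPrime (idealAt Y p)

/-- The germ at `p` of the function on `Y` given by a polynomial. -/
noncomputable def germAt (Y : Set (σ → ℂ)) (p : Y) : MvPolynomial σ ℂ →+* LocalRingAt Y p :=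
  (algebraMap (CoordRing Y) (LocalRingAt Y p)).comp (Ideal.Quotient.mk _)

/-- The stalk at `p` of the ideal sheaf of a closed subset `Z` of `Y`. -/
noncomputable def idealStalk (Y Z : Set (σ → ℂ)) (p : Y) : Ideal (LocalRingAt Y p) :=
  (MvPolynomial.vanishingIdeal ℂ Z).map (germAt Y p)

/-! ### Forms as sections of the box product on `U^(q+1)` -/

/-- The symmetric tensor of a form `F ∈ S^d V` (its complete polarization, that is, the symmetric
multilinear form whose restriction to the diagonal is `F`), as a polynomial in `d` groups of
homogeneous coordinates, linear in each of them. -/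
noncomputable def polarization (d : ℕ) (F : Forms N) :
    MvPolynomial (Fin d × Fin (N + 1)) ℂ :=
  MvPolynomial.C ((d.factorial : ℂ)⁻¹) *
    ∑ j : Fin d → Fin (N + 1),
      MvPolynomial.C (MvPolynomial.constantCoeff
        ((List.ofFn j).foldr (fun m G => MvPolynomial.pderiv m G) F)) *
      ∏ i, MvPolynomial.X (i, j i)

/-- The affine chart of `U^d` on which the `j i`-th homogeneous coordinate of the `i`-th point is
nonzero for every `i`; this coordinate is normalized to be `1`. -/
def boxChart (U : Set (PSpace N)) {d : ℕ} (j : Fin d → Fin (N + 1)) :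
    Set (Fin d × Fin (N + 1) → ℂ) :=
  {x | ∀ i, x (i, j i) = 1 ∧ (fun m => x (i, m)) ∈ cone U}

/-- The part in the chart `boxChart U j` of the big diagonal in `U^d`: two of the `d` points of
`ℙV` coincide. -/
def bigDiagonal (U : Set (PSpace N)) {d : ℕ} (j : Fin d → Fin (N + 1)) :
    Set (Fin d × Fin (N + 1) → ℂ) :=
  {x | x ∈ boxChart U j ∧ ∃ a b, a ≠ b ∧
    Submodule.span ℂ {fun m => x (a, m)} = Submodule.span ℂ {fun m => x (b, m)}}

/-- The form `F ∈ S^d V`, viewed as a global section of `L ⊠ ⋯ ⊠ L` on `U^d` with `L = 𝒪(1)|_U`,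
is a section of the subsheaf obtained by tensoring with the `ℓ`-th symbolic power of the ideal
sheaf of the big diagonal. This is tested on germs at all points of `U^d`. On the chart
`boxChart U j`, where the `j i`-th coordinate of the `i`-th point is `1`, the product of these
coordinates is a frame of `L ⊠ ⋯ ⊠ L`, and the section divided by this frame is the polarization
of `F`. -/
def VanishesAlongDiagonal (U : Set (PSpace N)) (d ℓ : ℕ) (F : Forms N) : Prop :=
  ∀ (j : Fin d → Fin (N + 1)) (p : boxChart U j),
    germAt (boxChart U j) p (polarization d F) ∈
      symbolicPower (idealStalk (boxChart U j) (bigDiagonal U j) p) ℓ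

end OscSec

namespace OscSec

open MvPolynomial

/-! ### Commutative algebra: difference quotients, leading forms, Jacobian criterion, dimension. -/

section Algebra

/-! Let `P` be the symmetric multilinear form of `F`, which has degree `q + 1`. Then `F` vanishes on
a linear space `W` exactly when `P` vanishes on all tuples from `W`. Let `W` be the span of `q`
osculating spaces. By multilinearity it suffices to test tuples whose entries lie in the single
osculating spaces, and among `q + 1` entries two must lie in the same one. So `F` vanishes on the
secant variety as soon as `P` vanishes whenever two of its arguments lie in a common osculating
space (`IsPairIsotropic`, `mem_homIdeal_secOsc_of_isPairIsotropic`). Conversely, tuples near a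
maximal tuple are maximal by semicontinuity. If `F` vanishes on the secant variety, put two
arguments in one osculating space and the others at points of the remaining local parametrizations.
Such points span `V*` by nondegeneracy, so isotropy follows along some local parametrization
(`exists_isPairIsotropic_jetSpan`).

Fix all arguments but two and let `B` be the resulting symmetric bilinear form. Isotropy of the
`k`-jets of a parametrization `φ` under `B` is equivalent to `B (φ s) (φ t)` vanishing to order `2k
+ 2` on `s = t`. If it does, mixed derivatives of orders at most `k` in `s` and in `t` have total
order at most `2k` and vanish (`apply_iterDir_eq_zero_of_isBigO`). In the other direction, along a
curve `γ` one differentiates `B(γ⁽ⁱ⁾, γ⁽ʲ⁾) = 0` repeatedly. Orders up to `2k` cause no difficulty,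
and symmetry of `B` gives one more, since `B(γ⁽ᵏ⁺¹⁾, γ⁽ᵏ⁾) + B(γ⁽ᵏ⁾, γ⁽ᵏ⁺¹⁾) = 0` is twice a single
term (`isBigO_pairing_curve`).

What remains is to compare analytic vanishing with symbolic powers. In each chart the big diagonal
is a finite union of pieces `x_a = x_b` with prime ideals, and generically on a piece its ideal is
generated by `dim X` functions modulo the equations of the chart. A function outside the symbolic
power then has a leading form of too low degree with a coefficient not vanishing on the piece
(`exists_mul_mem_pow_sup`). That coefficient can be tested at a generic point, and the generic point
may be taken in any prescribed analytic neighbourhood, since local parametrizations are Zariski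
dense (`IsLocalLift.mem_homIdeal_of_forall`, `exists_generic_on_pairDiagonal`). The same density
closes the circle: isotropy along one parametrization gives vanishing along the whole diagonal over
`U`, and this gives isotropy at every smooth point. Parametrizations of smooth points come from the
inverse function theorem together with a comparison of dimensions (`exists_chart`). -/

theorem exists_difference_quotients {σ R : Type*} [Fintype σ] [CommRing R] [Algebra ℂ R]
    (F : MvPolynomial σ ℂ) (x y : σ → R) :
    ∃ A : σ → R, aeval x F - aeval y F = ∑ m, A m * (x m - y m) ∧
      ∀ m, A m - aeval y (pderiv m F) ∈ Ideal.span (Set.range fun m => x m - y m) := by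
  classical
  induction F using MvPolynomial.induction_on with
  | C a => exact ⟨0, by simp, by simp⟩
  | add p q hp hq =>
    obtain ⟨A, hA, hA'⟩ := hp
    obtain ⟨B, hB, hB'⟩ := hq
    refine ⟨A + B, ?_, fun m => ?_⟩
    · simp only [map_add, Pi.add_apply, add_mul, Finset.sum_add_distrib, ← hA, ← hB]
      ring
    · have := add_mem (hA' m) (hB' m)
      convert! this using 1
      simp only [map_add, Pi.add_apply]
      ring
  | mul_X p i hp =>
    obtain ⟨A, hA, hA'⟩ := hp
    refine ⟨fun m => A m * x i + if m = i then aeval y p else 0, ?_, fun m => ?_⟩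
    · have : ∑ m, (A m * x i + if m = i then aeval y p else 0) * (x m - y m)
          = (∑ m, A m * (x m - y m)) * x i + aeval y p * (x i - y i) := by
        simp only [add_mul, Finset.sum_add_distrib, Finset.sum_mul, ite_mul, zero_mul,
          Finset.sum_ite_eq', Finset.mem_univ, if_true]
        congr 1
        exact Finset.sum_congr rfl fun m _ => by ring
      rw [this, ← hA]
      simp only [map_mul, aeval_X]
      ring
    · have h1 : (A m - aeval y (pderiv m p)) * x i + aeval y (pderiv m p) * (x i - y i) ∈
          Ideal.span (Set.range fun m => x m - y m) :=
        add_mem (Ideal.mul_mem_right _ _ (hA' m))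
          (Ideal.mul_mem_left _ _ (Ideal.subset_span ⟨i, rfl⟩))
      convert! h1 using 1
      by_cases h : m = i
      · subst h
        simp only [pderiv_mul, pderiv_X_self, map_add, map_mul, aeval_X, if_true, map_one]
        ring
      · simp only [pderiv_mul, pderiv_X_of_ne (Ne.symm h), map_add, map_mul, aeval_X, if_neg h,
          map_zero]
        ring

/-- Cramer's rule modulo `I`: multiply `M δ` by the adjugate of `M`. -/
theorem det_mul_mem {ι R : Type*} [Fintype ι] [DecidableEq ι] [CommRing R] (M : Matrix ι ι R)
    (I : Ideal R) (δ : ι → R) (h : ∀ i, ∑ m, M i m * δ m ∈ I) (m : ι) : M.det * δ m ∈ I := by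
  have h1 : M.adjugate.mulVec (M.mulVec δ) m = M.det * δ m := by
    rw [Matrix.mulVec_mulVec, Matrix.adjugate_mul, Matrix.smul_mulVec, Matrix.one_mulVec]
    rfl
  rw [← h1]
  exact Ideal.sum_mem _ fun i _ => Ideal.mul_mem_left _ _ (h i)

/-- Induction on the order of vanishing. Write a multiple of `G` as a form of degree `r` in
generators `f` of `P`, which generate it up to the factor `s₀` and modulo `I₀`. If the coefficients
of this leading form lie in `P`, they are themselves combinations of the `f`, and the order rises to
`r + 1`. Membership in a power of `P` after localization thus reduces to the vanishing of leading
coefficients along `P`, which can be checked analytically. -/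
theorem exists_mul_mem_pow_sup {R : Type*} [CommRing R] {n : ℕ} (P I₀ : Ideal R) [P.IsPrime]
    (f : Fin n → R) (hf : ∀ i, f i ∈ P) (s₀ : R) (hs₀ : s₀ ∉ P)
    (h₀ : ∀ x ∈ P, s₀ * x ∈ Ideal.span (Set.range f) ⊔ I₀) (G : R) (ℓ : ℕ)
    (H : ∀ r < ℓ, ∀ s ∉ P, ∀ p : MvPolynomial (Fin n) R, p.IsHomogeneous r →
      s * G - MvPolynomial.eval f p ∈ I₀ → ∀ m, p.coeff m ∈ P) :
    ∃ s ∉ P, s * G ∈ P ^ ℓ ⊔ I₀ := by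
  have key : ∀ r ≤ ℓ, ∃ s ∉ P, s * G ∈ Ideal.span (Set.range f) ^ r ⊔ I₀ := by
    intro r
    induction r with
    | zero => exact fun _ => ⟨1, (Ideal.ne_top_iff_one P).1 Ideal.IsPrime.ne_top', by simp⟩
    | succ r ih =>
      intro hr
      obtain ⟨s, hs, hsG⟩ := ih (by omega)
      obtain ⟨a, ha, b, hb, hab⟩ := Submodule.mem_sup.1 hsG
      obtain ⟨p, hp, hpa⟩ := (Ideal.mem_span_pow_iff_exists_isHomogeneous _ _).1 ha
      have hc := H r (by omega) s hs p hp (by rw [hpa, ← hab]; simpa using hb)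
      -- The extra factor `s₀` moves the coefficients, already in `P`, into `(f) + I₀`.
      refine ⟨s₀ * s, fun h => (Ideal.IsPrime.mem_or_mem ‹_› h).elim hs₀ hs, ?_⟩
      have : s₀ * s * G = s₀ * a + s₀ * b := by rw [mul_assoc, ← hab]; ring
      rw [this]
      refine add_mem ?_ (Ideal.mem_sup_right (Ideal.mul_mem_left _ _ hb))
      rw [← hpa, MvPolynomial.eval_eq', Finset.mul_sum]
      refine Ideal.sum_mem _ fun d hd => ?_
      rw [← mul_assoc]
      have h1 := h₀ _ (hc d)
      have h2 : ∏ i, f i ^ d i ∈ Ideal.span (Set.range f) ^ r := by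
        rw [Ideal.mem_span_pow_iff_exists_isHomogeneous]
        refine ⟨MvPolynomial.monomial d 1, MvPolynomial.isHomogeneous_monomial _ ?_, ?_⟩
        · have := hp (MvPolynomial.mem_support_iff.1 hd)
          rwa [Finsupp.degree_eq_weight_one]
        · simp [MvPolynomial.eval_monomial, Finsupp.prod_fintype]
      have h3 := Ideal.mul_mem_mul h1 h2
      rw [Ideal.sup_mul, ← pow_succ'] at h3
      have hle : Ideal.span (Set.range f) ^ (r + 1) ⊔ I₀ * Ideal.span (Set.range f) ^ r ≤
          Ideal.span (Set.range f) ^ (r + 1) ⊔ I₀ := sup_le_sup le_rfl Ideal.mul_le_left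
      exact hle h3
  obtain ⟨s, hs, h⟩ := key ℓ le_rfl
  have hsp : Ideal.span (Set.range f) ≤ P := by
    rw [Ideal.span_le]
    rintro _ ⟨i, rfl⟩
    exact hf i
  have hle : Ideal.span (Set.range f) ^ ℓ ⊔ I₀ ≤ P ^ ℓ ⊔ I₀ :=
    sup_le_sup (Ideal.pow_right_mono hsp ℓ) le_rfl
  exact ⟨s, hs, hle h⟩

theorem derivation_aeval {σ K M A : Type*} [Fintype σ] [CommRing A] [Algebra ℂ A] [CommRing K]
    [Algebra ℂ K] [Algebra A K] [IsScalarTower ℂ A K] [AddCommGroup M] [Module K M] [Module A M]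
    [IsScalarTower A K M] (d : Derivation A K M) (y : σ → K) (p : MvPolynomial σ ℂ) :
    d (aeval y p) = ∑ m, aeval y (pderiv m p) • d (y m) := by
  classical
  induction p using MvPolynomial.induction_on with
  | C a => simp [IsScalarTower.algebraMap_apply ℂ A K]
  | add p q hp hq => simp [hp, hq, add_smul, Finset.sum_add_distrib]
  | mul_X p i hp =>
    have h1 : ∀ m, aeval y (pderiv m (p * X i)) • d (y m) =
        y i • (aeval y (pderiv m p) • d (y m)) + if m = i then aeval y p • d (y i) else 0 := by
      intro m
      by_cases h : m = i
      · subst h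
        simp only [pderiv_mul, pderiv_X_self, map_add, map_mul, aeval_X, mul_one,
          if_true, add_smul, smul_smul, mul_comm]
      · simp only [pderiv_mul, pderiv_X_of_ne (Ne.symm h), map_mul, aeval_X,
          mul_zero, if_neg h, smul_smul, mul_comm, add_zero]
    simp only [h1, Finset.sum_add_distrib, Finset.sum_ite_eq', Finset.mem_univ, if_true,
      ← Finset.smul_sum, ← hp]
    rw [map_mul, aeval_X, Derivation.leibniz, add_comm]

theorem derivation_eq_zero_of_isUnit_det {σ K M A : Type*} [Fintype σ] [DecidableEq σ]
    [CommRing A] [Algebra ℂ A] [Field K]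
    [Algebra ℂ K] [Algebra A K] [IsScalarTower ℂ A K] [AddCommGroup M] [Module K M] [Module A M]
    [IsScalarTower A K M] (d : Derivation A K M) (y : σ → K) (Q : σ → MvPolynomial σ ℂ)
    (hQ : ∀ i, d (aeval y (Q i)) = 0)
    (hdet : aeval y (Matrix.det (Matrix.of fun i m => pderiv m (Q i))) ≠ 0) (m : σ) :
    d (y m) = 0 := by
  set J : Matrix σ σ K := Matrix.of fun i m => aeval y (pderiv m (Q i)) with hJ
  have hd : J.det ≠ 0 := by
    rw [AlgHom.map_det] at hdet
    exact hdet
  have h1 : J.det • d (y m) = 0 := by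
    have h2 : ∀ i, ∑ m, J i m • d (y m) = 0 := fun i => by
      rw [← hQ i, derivation_aeval]
      rfl
    have h3 : ∑ i, J.adjugate m i • ∑ l, J i l • d (y l) = J.det • d (y m) := by
      simp only [Finset.smul_sum, smul_smul]
      rw [Finset.sum_comm]
      simp only [← Finset.sum_smul]
      have : ∀ l, ∑ i, J.adjugate m i * J i l = if m = l then J.det else 0 := fun l => by
        rw [← Matrix.mul_apply, Matrix.adjugate_mul]
        simp [Matrix.one_apply]
      simp [this]
    rw [← h3]
    simp [h2]
  exact (smul_eq_zero.1 h1).resolve_left hd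

/-- A nonvanishing Jacobian kills the Kähler differentials of the fraction field `K` over the
fraction field `k₀` of the subalgebra generated by the `x`. Hence `K` is formally unramified and
essentially of finite type over `k₀`, so separable algebraic. -/
theorem isAlgebraic_of_jacobian {σ κ D : Type} [Fintype σ] [DecidableEq σ] [CommRing D] [IsDomain D]
    [Algebra ℂ D] (y : σ → D) (hy : Algebra.adjoin ℂ (Set.range y) = ⊤)
    (Q : σ → MvPolynomial σ ℂ) (x : κ → D)
    (hQ : ∀ i, aeval y (Q i) = 0 ∨ aeval y (Q i) ∈ Set.range x)
    (hdet : aeval y (Matrix.det (Matrix.of fun i m => pderiv m (Q i))) ≠ 0) :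
    Algebra.IsAlgebraic (Algebra.adjoin ℂ (Set.range x)) D := by
  let K := FractionRing D
  let S := Algebra.adjoin ℂ (Set.range x)
  have hSD : Function.Injective (algebraMap S D) := Subtype.val_injective
  have : Module.IsTorsionFree S D := by
    rw [Module.isTorsionFree_iff_algebraMap_injective]; exact hSD
  have : FaithfulSMul S K := by
    rw [faithfulSMul_iff_algebraMap_injective, IsScalarTower.algebraMap_eq S D K]
    exact (IsFractionRing.injective D K).comp hSD
  let k₀ := FractionRing S
  let : Algebra k₀ K := FractionRing.liftAlgebra S K
  have : IsScalarTower S k₀ K := inferInstance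
  have : IsScalarTower ℂ k₀ K := IsScalarTower.of_algebraMap_eq fun c => by
    rw [IsScalarTower.algebraMap_apply ℂ S k₀, ← IsScalarTower.algebraMap_apply S k₀ K,
      ← IsScalarTower.algebraMap_apply ℂ S K]
  have hft : Algebra.FiniteType ℂ D := ⟨by
    rw [← hy]; exact ⟨(Set.finite_range y).toFinset, by simp⟩⟩
  have : Algebra.EssFiniteType D K := Algebra.EssFiniteType.of_isLocalization _ (nonZeroDivisors D)
  have : Algebra.EssFiniteType ℂ K := Algebra.EssFiniteType.comp ℂ D K
  have : Algebra.EssFiniteType k₀ K := Algebra.EssFiniteType.of_comp ℂ k₀ K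
  have haev : ∀ p : MvPolynomial σ ℂ,
      aeval (fun i => algebraMap D K (y i)) p = algebraMap D K (aeval y p) := fun p => by
    rw [← MvPolynomial.aeval_algebraMap_apply]; rfl
  have hD : ∀ z : D, ∃ p : MvPolynomial σ ℂ, aeval y p = z := by
    intro z
    have : z ∈ Algebra.adjoin ℂ (Set.range y) := hy ▸ Algebra.mem_top
    rwa [Algebra.adjoin_range_eq_range_aeval] at this
  -- Each `Q i` evaluates to zero or to an element of `k₀`, so its differential vanishes. Inverting
  -- the Jacobian matrix gives `d (y m) = 0` for the generators `y m`.
  have hunr : Algebra.FormallyUnramified k₀ K := by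
    refine ⟨?_⟩
    have hz : ∀ z : K, KaehlerDifferential.D k₀ K z = 0 := by
      have hy0 := derivation_eq_zero_of_isUnit_det (KaehlerDifferential.D k₀ K)
        (fun i => algebraMap D K (y i)) Q
        (fun i => by
          rw [haev]
          rcases hQ i with h | ⟨j, h⟩
          · simp [h]
          · rw [← h]
            have hm : x j ∈ S := Algebra.subset_adjoin ⟨j, rfl⟩
            have : algebraMap D K (x j) = algebraMap k₀ K (algebraMap S k₀ ⟨_, hm⟩) := by
              rw [← IsScalarTower.algebraMap_apply S k₀ K, IsScalarTower.algebraMap_apply S D K]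
              rfl
            rw [this, Derivation.map_algebraMap])
        (by
          rw [haev]
          exact fun h => hdet ((IsFractionRing.injective D K) (h.trans (map_zero _).symm)))
      have hD0 : ∀ z : D, KaehlerDifferential.D k₀ K (algebraMap D K z) = 0 := by
        intro z
        obtain ⟨p, rfl⟩ := hD z
        rw [← haev, derivation_aeval]
        simp [hy0]
      intro z
      obtain ⟨a, b, hb, rfl⟩ := IsFractionRing.div_surjective (A := D) z
      have hb0 : algebraMap D K b ≠ 0 := by
        intro h
        exact nonZeroDivisors.ne_zero hb ((IsFractionRing.injective D K) (h.trans (map_zero _).symm))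
      have h1 : algebraMap D K b • KaehlerDifferential.D k₀ K (algebraMap D K a / algebraMap D K b)
          = 0 := by
        have := (KaehlerDifferential.D k₀ K).leibniz (algebraMap D K b)
          (algebraMap D K a / algebraMap D K b)
        rw [mul_div_cancel₀ _ hb0, hD0, hD0, smul_zero, add_zero] at this
        exact this.symm
      exact (smul_eq_zero.1 h1).resolve_left hb0
    refine subsingleton_of_forall_eq 0 fun w => ?_
    have hw : w ∈ Submodule.span K (Set.range (KaehlerDifferential.D k₀ K)) := by
      rw [KaehlerDifferential.span_range_derivation]; trivial
    have : Set.range (KaehlerDifferential.D k₀ K) ⊆ {0} := by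
      rintro _ ⟨z, rfl⟩
      exact hz z
    have h2 := Submodule.span_mono this hw
    simpa using h2
  have hsep := Algebra.FormallyUnramified.isSeparable k₀ K
  have halg : Algebra.IsAlgebraic k₀ K := Algebra.IsSeparable.isAlgebraic k₀ K
  have h1 : Algebra.IsAlgebraic S K :=
    (IsFractionRing.comap_isAlgebraic_iff (A := S) (K := k₀) (C := K)).2 halg
  exact ⟨fun z => (isAlgebraic_algebraMap_iff (IsFractionRing.injective D K)).1
    (h1.isAlgebraic (algebraMap D K z))⟩

/-- Noether normalization: `D` is integral over a polynomial ring in `s` variables, so chains of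
primes contract strictly and the dimension is at most `s`, while the variables stay algebraically
independent in `D`. -/
theorem ringKrullDim_le_trdeg (D : Type) [CommRing D] [IsDomain D] [Algebra ℂ D]
    [Algebra.FiniteType ℂ D] (n : ℕ) (h : (n : WithBot ℕ∞) ≤ ringKrullDim D) :
    (n : Cardinal) ≤ Algebra.trdeg ℂ D := by
  obtain ⟨s, g, hg, hint⟩ := exists_integral_inj_algHom_of_fg ℂ D
  let := g.toRingHom.toAlgebra
  have : Algebra.IsIntegral (MvPolynomial (Fin s) ℂ) D := ⟨hint⟩
  have h1 : ringKrullDim D ≤ ringKrullDim (MvPolynomial (Fin s) ℂ) := by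
    refine Order.krullDim_le_of_strictMono
      (fun p => PrimeSpectrum.comap (algebraMap (MvPolynomial (Fin s) ℂ) D) p) fun p q hpq => ?_
    exact Ideal.IsIntegral.comap_lt_comap (R := MvPolynomial (Fin s) ℂ) hpq
  rw [MvPolynomial.ringKrullDim_of_isNoetherianRing, ringKrullDim_eq_zero_of_field] at h1
  have h2 : n ≤ s := by
    have := h.trans h1
    simp only [zero_add, Nat.card_eq_fintype_card, Fintype.card_fin] at this
    exact_mod_cast this
  have h3 : AlgebraicIndependent ℂ (fun i => g (X i) : Fin s → D) := by
    have := (MvPolynomial.algebraicIndependent_X (Fin s) ℂ).map' hg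
    exact this
  have := h3.lift_cardinalMk_le_trdeg
  simp only [Cardinal.mk_fin, Cardinal.lift_id] at this
  exact le_trans (by exact_mod_cast h2) this

end Algebra

/-! ### Symbolic powers of an intersection of primes in a local ring. -/

section Symbolic

/-- Hypotheses `h₁`–`h₃` say what is needed about `φ` being the map from `R` to the localization of
`R ⧸ I₀` at `m`. A minimal prime over the extended intersection contracts to a prime containing the
product of the `P i`, hence containing one of them, and minimality forces equality. A component may
be empty in the chart, which is why `P i = ⊤` is allowed. -/
theorem exists_eq_map_of_mem_minimalPrimes {R S ι : Type*} [CommRing R] [CommRing S] [Fintype ι]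
    (φ : R →+* S) (m I₀ : Ideal R) [m.IsPrime]
    (h₁ : ∀ (a : Ideal R) (x : R), φ x ∈ a.map φ → ∃ t ∉ m, t * x ∈ a ⊔ I₀)
    (h₂ : ∀ s : S, ∃ s₁ s₂ : R, s₂ ∉ m ∧ s * φ s₂ = φ s₁)
    (h₃ : ∀ t ∉ m, IsUnit (φ t))
    (P : ι → Ideal R) (hP : ∀ i, P i ≠ ⊤ → (P i).IsPrime) (hIP : ∀ i, I₀ ≤ P i)
    (p : Ideal S) (hp : p ∈ ((⨅ i, P i).map φ).minimalPrimes) :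
    ∃ i, (P i).IsPrime ∧ P i ≤ m ∧ p.comap φ = P i ∧
      ∀ c, P c ≤ P i → P c = P i := by
  have hpp : p.IsPrime := hp.1.1
  have hpm : p.comap φ ≤ m := by
    intro x hx
    by_contra h
    exact hpp.ne_top (Ideal.eq_top_of_isUnit_mem _ hx (h₃ x h))
  have hB : ⨅ i, P i ≤ p.comap φ := Ideal.map_le_iff_le_comap.1 hp.1.2
  have hcm : ∀ i, (P i).IsPrime → P i ≤ m → ((P i).map φ).comap φ = P i := by
    intro i hi him
    refine le_antisymm (fun x hx => ?_) Ideal.le_comap_map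
    obtain ⟨t, ht, htx⟩ := h₁ _ _ hx
    rw [sup_eq_left.2 (hIP i)] at htx
    exact (hi.mem_or_mem htx).resolve_left fun h => ht (him h)
  have hmp : ∀ i, (P i).IsPrime → P i ≤ m → ((P i).map φ).IsPrime := by
    intro i hi him
    have hc := hcm i hi him
    have hmem : ∀ x, φ x ∈ (P i).map φ → x ∈ P i := fun x hx =>
      hc.le (Ideal.mem_comap.2 hx)
    refine ⟨fun h => hi.ne_top ?_, fun {a b} hab => ?_⟩
    · rw [← hc, h]; rfl
    · obtain ⟨a₁, a₂, ha₂, ha⟩ := h₂ a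
      obtain ⟨b₁, b₂, hb₂, hb⟩ := h₂ b
      have h : φ (a₁ * b₁) ∈ (P i).map φ := by
        rw [map_mul, ← ha, ← hb]
        have : a * φ a₂ * (b * φ b₂) = (φ a₂ * φ b₂) * (a * b) := by ring
        rw [this]
        exact Ideal.mul_mem_left _ _ hab
      rcases hi.mem_or_mem (hmem _ h) with h | h
      · left
        have := Ideal.mem_map_of_mem φ h
        rw [← ha] at this
        exact (Ideal.mul_unit_mem_iff_mem _ (h₃ _ ha₂)).1 this
      · right
        have := Ideal.mem_map_of_mem φ h
        rw [← hb] at this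
        exact (Ideal.mul_unit_mem_iff_mem _ (h₃ _ hb₂)).1 this
  have hle : ∀ i, P i ≤ p.comap φ → p.comap φ = P i := by
    intro i hi
    have hne : P i ≠ ⊤ := fun h =>
      (Ideal.IsPrime.ne_top (I := p.comap φ) inferInstance) (top_le_iff.1 (h ▸ hi))
    have hpr := hP i hne
    have h1 := hp.2 ⟨hmp i hpr (hi.trans hpm), Ideal.map_mono (iInf_le _ i)⟩
      (Ideal.map_le_iff_le_comap.2 hi)
    refine le_antisymm ?_ hi
    rw [← hcm i hpr (hi.trans hpm)]
    exact Ideal.comap_mono h1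
  have : ∃ i, P i ≤ p.comap φ := by
    have h1 : ∏ i, P i ≤ p.comap φ := by
      refine le_trans ?_ hB
      refine le_iInf fun i => ?_
      exact Ideal.prod_le_inf.trans (Finset.inf_le (Finset.mem_univ i))
    obtain ⟨i, -, hi⟩ := (Ideal.IsPrime.prod_le (inferInstance : (p.comap φ).IsPrime)).1 h1
    exact ⟨i, hi⟩
  obtain ⟨i, hi⟩ := this
  have hne : P i ≠ ⊤ := fun h =>
    (Ideal.IsPrime.ne_top (I := p.comap φ) inferInstance) (top_le_iff.1 (h ▸ hi))
  exact ⟨i, hP i hne, hi.trans hpm, hle i hi, fun c hc =>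
    (hle c (hc.trans hi)).symm.trans (hle i hi)⟩

/-- At a component `P i` that is minimal among the `P c`, the other components become invisible:
some `T ∉ P i` multiplies `P i` into all of them, so the powers of `P i` and of the intersection
agree after localization. -/
theorem mem_symbolicPower_map_iInf {R S ι : Type*} [CommRing R] [CommRing S] [Fintype ι]
    (φ : R →+* S) (m I₀ : Ideal R) [m.IsPrime]
    (h₁ : ∀ (a : Ideal R) (x : R), φ x ∈ a.map φ → ∃ t ∉ m, t * x ∈ a ⊔ I₀)
    (h₂ : ∀ s : S, ∃ s₁ s₂ : R, s₂ ∉ m ∧ s * φ s₂ = φ s₁)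
    (h₃ : ∀ t ∉ m, IsUnit (φ t)) (h₄ : ∀ x ∈ I₀, φ x = 0)
    (P : ι → Ideal R) (hP : ∀ i, P i ≠ ⊤ → (P i).IsPrime) (hIP : ∀ i, I₀ ≤ P i) (ℓ : ℕ) (G : R)
    (H : ∀ i, P i ≠ ⊤ → ∃ s ∉ P i, s * G ∈ P i ^ ℓ ⊔ I₀) :
    φ G ∈ symbolicPower ((⨅ i, P i).map φ) ℓ := by
  classical
  intro p hp
  obtain ⟨i, hi, him, hpi, hmin⟩ :=
    exists_eq_map_of_mem_minimalPrimes φ m I₀ h₁ h₂ h₃ P hP hIP p hp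
  obtain ⟨s, hs, hsG⟩ := H i hi.ne_top
  have : ∀ c, ∃ t ∉ P i, ∀ x ∈ P i, t * x ∈ P c := by
    intro c
    by_cases h : P c ≤ P i
    · exact ⟨1, (Ideal.ne_top_iff_one _).1 hi.ne_top, fun x hx => by
        rw [one_mul, hmin c h]; exact hx⟩
    · obtain ⟨t, ht, hti⟩ := SetLike.not_le_iff_exists.1 h
      exact ⟨t, hti, fun x _ => Ideal.mul_mem_right _ _ ht⟩
  choose t ht htx using this
  let T := ∏ c, t c
  have hT : T ∉ P i := fun h => by
    obtain ⟨c, -, hc⟩ := (hi.prod_mem_iff).1 h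
    exact ht c hc
  have hTB : ∀ x ∈ P i, T * x ∈ ⨅ c, P c := by
    intro x hx
    rw [Ideal.mem_iInf]
    intro c
    obtain ⟨u, hu⟩ := Finset.dvd_prod_of_mem t (Finset.mem_univ c)
    have : T * x = u * (t c * x) := by rw [show T = t c * u from hu]; ring
    rw [this]
    exact Ideal.mul_mem_left _ _ (htx c x hx)
  have hpow : Ideal.span {T ^ ℓ} * P i ^ ℓ ≤ (⨅ c, P c) ^ ℓ := by
    rw [← Ideal.span_singleton_pow, ← mul_pow]
    refine Ideal.pow_right_mono ?_ ℓ
    rw [Ideal.mul_le]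
    intro r hr x hx
    obtain ⟨u, rfl⟩ := Ideal.mem_span_singleton'.1 hr
    rw [mul_assoc]
    exact Ideal.mul_mem_left _ _ (hTB x hx)
  refine ⟨φ (T ^ ℓ * s), fun h => ?_, ?_⟩
  · have h' : T ^ ℓ * s ∈ P i := by rw [← hpi]; exact h
    exact (hi.mem_or_mem h').elim (fun h => hT (hi.mem_of_pow_mem _ h)) hs
  · obtain ⟨a, ha, b, hb, hab⟩ := Submodule.mem_sup.1 hsG
    rw [← map_mul, mul_assoc, ← hab, mul_add, map_add, ← Ideal.map_pow]
    refine add_mem (Ideal.mem_map_of_mem _ (hpow ?_)) ?_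
    · exact Ideal.mul_mem_mul (Ideal.mem_span_singleton_self _) ha
    · rw [map_mul, h₄ b hb, mul_zero]
      exact zero_mem _

/-- There is no control over which component `i` is obtained. This is harmless later because
polarizations are symmetric in their arguments. -/
theorem exists_mul_mem_of_mem_symbolicPower {R S ι : Type*} [CommRing R] [CommRing S] [Fintype ι]
    (φ : R →+* S) (m I₀ : Ideal R) [m.IsPrime]
    (h₁ : ∀ (a : Ideal R) (x : R), φ x ∈ a.map φ → ∃ t ∉ m, t * x ∈ a ⊔ I₀)
    (h₂ : ∀ s : S, ∃ s₁ s₂ : R, s₂ ∉ m ∧ s * φ s₂ = φ s₁)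
    (h₃ : ∀ t ∉ m, IsUnit (φ t)) (hIm : I₀ ≤ m)
    (P : ι → Ideal R) (hP : ∀ i, P i ≠ ⊤ → (P i).IsPrime) (hIP : ∀ i, I₀ ≤ P i)
    (i₀ : ι) (hi₀ : P i₀ ≤ m) (ℓ : ℕ) (G : R)
    (hG : φ G ∈ symbolicPower ((⨅ i, P i).map φ) ℓ) :
    ∃ i, P i ≠ ⊤ ∧ ∃ s ∉ P i, s * G ∈ P i ^ ℓ ⊔ I₀ := by
  have hne : (⨅ i, P i).map φ ≠ ⊤ := by
    intro h
    have h1 : φ 1 ∈ (P i₀).map φ := Ideal.map_mono (iInf_le _ i₀) (h ▸ Submodule.mem_top)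
    obtain ⟨t, ht, htx⟩ := h₁ _ _ h1
    rw [mul_one] at htx
    exact ht (sup_le hi₀ hIm htx)
  obtain ⟨p, hp⟩ := Ideal.nonempty_minimalPrimes hne
  obtain ⟨i, hi, him, hpi, -⟩ :=
    exists_eq_map_of_mem_minimalPrimes φ m I₀ h₁ h₂ h₃ P hP hIP p hp
  obtain ⟨s, hs, hsG⟩ := hG p hp
  refine ⟨i, hi.ne_top, ?_⟩
  obtain ⟨s₁, s₂, hs₂, hss⟩ := h₂ s
  have hs₁ : s₁ ∉ P i := by
    rw [← hpi, Ideal.mem_comap, ← hss]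
    exact fun h => (hp.1.1.mem_or_mem h).elim hs
      fun h => hp.1.1.ne_top (Ideal.eq_top_of_isUnit_mem _ h (h₃ _ hs₂))
  have h5 : φ (s₁ * G) ∈ (P i ^ ℓ).map φ := by
    rw [map_mul, ← hss]
    have : s * φ s₂ * φ G = φ s₂ * (s * φ G) := by ring
    rw [this, Ideal.map_pow]
    exact Ideal.mul_mem_left _ _ (Ideal.pow_right_mono (Ideal.map_mono (iInf_le _ i)) ℓ hsG)
  obtain ⟨t, ht, htx⟩ := h₁ _ _ h5
  refine ⟨t * s₁, fun h => (hi.mem_or_mem h).elim (fun h => ht (him h)) hs₁, ?_⟩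
  rwa [mul_assoc]

variable {σ : Type} (Y : Set (σ → ℂ)) (p : Y)

theorem evalAt_mk (f : MvPolynomial σ ℂ) :
    evalAt Y p (Ideal.Quotient.mk _ f) = MvPolynomial.eval (p : σ → ℂ) f := by
  rw [evalAt, Ideal.Quotient.lift_mk]
  rfl

/-- The ideal of the polynomials that vanish at a point. -/
noncomputable def pointIdeal (v : σ → ℂ) : Ideal (MvPolynomial σ ℂ) :=
  RingHom.ker (MvPolynomial.eval v)

theorem mem_pointIdeal (v : σ → ℂ) (f : MvPolynomial σ ℂ) :
    f ∈ pointIdeal v ↔ MvPolynomial.eval v f = 0 := Iff.rfl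

instance pointIdeal_isPrime (v : σ → ℂ) : (pointIdeal v).IsPrime := RingHom.ker_isPrime _

theorem mk_mem_idealAt_iff (f : MvPolynomial σ ℂ) :
    Ideal.Quotient.mk _ f ∈ idealAt Y p ↔ f ∈ pointIdeal (p : σ → ℂ) := by
  rw [idealAt, RingHom.mem_ker, evalAt_mk, mem_pointIdeal]

section Localization
variable (S : Type*) [CommRing S] [Algebra (CoordRing Y) S] [IsLocalization.AtPrime S (idealAt Y p)]

/-- The germ of a polynomial function in a model of the local ring at a point. -/
noncomputable def toLocal : MvPolynomial σ ℂ →+* S :=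
  (algebraMap (CoordRing Y) S).comp (Ideal.Quotient.mk _)

theorem exists_mul_mem_of_toLocal_mem (a : Ideal (MvPolynomial σ ℂ)) (x : MvPolynomial σ ℂ)
    (h : toLocal Y S x ∈ a.map (toLocal Y S)) :
    ∃ t ∉ pointIdeal (p : σ → ℂ), t * x ∈ a ⊔ MvPolynomial.vanishingIdeal ℂ Y := by
  rw [toLocal, ← Ideal.map_map, RingHom.comp_apply,
    IsLocalization.algebraMap_mem_map_algebraMap_iff (idealAt Y p).primeCompl] at h
  obtain ⟨t, ht, htx⟩ := h
  obtain ⟨t, rfl⟩ := Ideal.Quotient.mk_surjective t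
  refine ⟨t, fun h => ht ((mk_mem_idealAt_iff Y p t).2 h), ?_⟩
  rw [← map_mul, ← Ideal.mem_comap, Ideal.comap_map_quotientMk] at htx
  rwa [sup_comm]

theorem exists_mul_toLocal_eq (s : S) :
    ∃ s₁ s₂ : MvPolynomial σ ℂ, s₂ ∉ pointIdeal (p : σ → ℂ) ∧
      s * toLocal Y S s₂ = toLocal Y S s₁ := by
  obtain ⟨⟨a, b⟩, h⟩ := IsLocalization.surj (idealAt Y p).primeCompl s
  obtain ⟨a, rfl⟩ := Ideal.Quotient.mk_surjective a
  obtain ⟨b, hb⟩ := b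
  obtain ⟨b, rfl⟩ := Ideal.Quotient.mk_surjective b
  exact ⟨a, b, fun h' => hb ((mk_mem_idealAt_iff Y p b).2 h'), h⟩

theorem isUnit_toLocal (t : MvPolynomial σ ℂ) (ht : t ∉ pointIdeal (p : σ → ℂ)) :
    IsUnit (toLocal Y S t) :=
  IsLocalization.map_units (M := (idealAt Y p).primeCompl) S
    ⟨Ideal.Quotient.mk _ t, fun h => ht ((mk_mem_idealAt_iff Y p t).1 h)⟩

theorem toLocal_eq_zero (x : MvPolynomial σ ℂ) (hx : x ∈ MvPolynomial.vanishingIdeal ℂ Y) :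
    toLocal Y S x = 0 := by
  rw [toLocal, RingHom.comp_apply, Ideal.Quotient.eq_zero_iff_mem.2 hx, map_zero]

end Localization

theorem vanishingIdeal_le_pointIdeal (Z : Set (σ → ℂ)) {v : σ → ℂ} (hv : v ∈ Z) :
    MvPolynomial.vanishingIdeal ℂ Z ≤ pointIdeal v := fun f hf => by
  have := hf v hv
  rwa [MvPolynomial.aeval_eq_eval] at this

theorem toLocal_mem_symbolicPower {ι : Type} [Fintype ι] (S : Type*) [CommRing S]
    [Algebra (CoordRing Y) S] [IsLocalization.AtPrime S (idealAt Y p)]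
    (Z : ι → Set (σ → ℂ)) (hZ : ∀ i, Z i ⊆ Y)
    (hP : ∀ i, MvPolynomial.vanishingIdeal ℂ (Z i) ≠ ⊤ →
      (MvPolynomial.vanishingIdeal ℂ (Z i)).IsPrime) (ℓ : ℕ) (G : MvPolynomial σ ℂ)
    (H : ∀ i, MvPolynomial.vanishingIdeal ℂ (Z i) ≠ ⊤ →
      ∃ s ∉ MvPolynomial.vanishingIdeal ℂ (Z i),
        s * G ∈ MvPolynomial.vanishingIdeal ℂ (Z i) ^ ℓ ⊔ MvPolynomial.vanishingIdeal ℂ Y) :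
    toLocal Y S G ∈ symbolicPower
      ((⨅ i, MvPolynomial.vanishingIdeal ℂ (Z i)).map (toLocal Y S)) ℓ :=
  mem_symbolicPower_map_iInf (toLocal Y S) (pointIdeal (p : σ → ℂ))
    (MvPolynomial.vanishingIdeal ℂ Y) (exists_mul_mem_of_toLocal_mem Y p S)
    (exists_mul_toLocal_eq Y p S) (isUnit_toLocal Y p S) (toLocal_eq_zero Y S)
    (fun i => MvPolynomial.vanishingIdeal ℂ (Z i)) hP
    (fun i => vanishingIdeal_anti_mono (hZ i)) ℓ G H

theorem exists_mul_mem_of_toLocal_mem_symbolicPower {ι : Type} [Fintype ι] (S : Type*)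
    [CommRing S] [Algebra (CoordRing Y) S] [IsLocalization.AtPrime S (idealAt Y p)]
    (Z : ι → Set (σ → ℂ)) (hZ : ∀ i, Z i ⊆ Y)
    (hP : ∀ i, MvPolynomial.vanishingIdeal ℂ (Z i) ≠ ⊤ →
      (MvPolynomial.vanishingIdeal ℂ (Z i)).IsPrime) (i₀ : ι) (hi₀ : (p : σ → ℂ) ∈ Z i₀)
    (ℓ : ℕ) (G : MvPolynomial σ ℂ)
    (hG : toLocal Y S G ∈ symbolicPower
      ((⨅ i, MvPolynomial.vanishingIdeal ℂ (Z i)).map (toLocal Y S)) ℓ) :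
    ∃ i, MvPolynomial.vanishingIdeal ℂ (Z i) ≠ ⊤ ∧
      ∃ s ∉ MvPolynomial.vanishingIdeal ℂ (Z i),
        s * G ∈ MvPolynomial.vanishingIdeal ℂ (Z i) ^ ℓ ⊔ MvPolynomial.vanishingIdeal ℂ Y :=
  exists_mul_mem_of_mem_symbolicPower (toLocal Y S) (pointIdeal (p : σ → ℂ))
    (MvPolynomial.vanishingIdeal ℂ Y) (exists_mul_mem_of_toLocal_mem Y p S)
    (exists_mul_toLocal_eq Y p S) (isUnit_toLocal Y p S) (vanishingIdeal_le_pointIdeal _ p.2)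
    (fun i => MvPolynomial.vanishingIdeal ℂ (Z i)) hP
    (fun i => vanishingIdeal_anti_mono (hZ i)) i₀ (vanishingIdeal_le_pointIdeal _ hi₀) ℓ G hG

theorem germAt_mem_symbolicPower_iff (Z : Set (σ → ℂ)) (ℓ : ℕ) (G : MvPolynomial σ ℂ) :
    germAt Y p G ∈ symbolicPower (idealStalk Y Z p) ℓ ↔
      toLocal Y (LocalRingAt Y p) G ∈ symbolicPower
        ((MvPolynomial.vanishingIdeal ℂ Z).map (toLocal Y (LocalRingAt Y p))) ℓ := Iff.rfl

end Symbolic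

/-! ### Jacobian determinants and the dimension of the cone. -/

section Frames
variable {N : ℕ}

/-- The Jacobian determinant of `N + 1` polynomials in `N + 1` variables. -/
noncomputable def jacDet (Q : Fin (N + 1) → Forms N) : Forms N :=
  Matrix.det (Matrix.of fun i m => pderiv m (Q i))

theorem isAlgebraic_quotient_of_jacDet {κ : Type} (P : Ideal (Forms N)) [P.IsPrime]
    (Q : Fin (N + 1) → Forms N) (ι : κ → Fin (N + 1)) (hQ : ∀ i ∉ Set.range ι, Q i ∈ P)
    (hdet : jacDet Q ∉ P) :
    Algebra.IsAlgebraic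
      (Algebra.adjoin ℂ (Set.range fun k => Ideal.Quotient.mk P (Q (ι k)))) (Forms N ⧸ P) := by
  have haev : ∀ f : Forms N, aeval (fun i => Ideal.Quotient.mk P (X i)) f =
      Ideal.Quotient.mk P f := fun f => by
    have := MvPolynomial.aeval_algebraMap_apply (Forms N ⧸ P) (X : Fin (N + 1) → Forms N) f
    rw [MvPolynomial.aeval_X_left_apply] at this
    exact this
  refine isAlgebraic_of_jacobian (fun i => Ideal.Quotient.mk P (X i)) ?_ Q _ (fun i => ?_) ?_
  · rw [Algebra.adjoin_range_eq_range_aeval, AlgHom.range_eq_top]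
    intro z
    obtain ⟨f, rfl⟩ := Ideal.Quotient.mk_surjective z
    exact ⟨f, haev f⟩
  · rw [haev]
    by_cases h : i ∈ Set.range ι
    · obtain ⟨k, rfl⟩ := h
      exact Or.inr ⟨k, rfl⟩
    · exact Or.inl (Ideal.Quotient.eq_zero_iff_mem.2 (hQ i h))
  · rw [haev]
    exact fun h => hdet (Ideal.Quotient.eq_zero_iff_mem.1 h)

/-- A nonzero element of a domain algebraic over a subring divides a nonzero element of that
subring. -/
theorem exists_aeval_sub_mul_mem {κ : Type} (P : Ideal (Forms N)) [P.IsPrime]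
    (Q : Fin (N + 1) → Forms N) (ι : κ → Fin (N + 1)) (hQ : ∀ i ∉ Set.range ι, Q i ∈ P)
    (hdet : jacDet Q ∉ P) (H : Forms N) (hH : H ∉ P) :
    ∃ (c : MvPolynomial κ ℂ) (H' : Forms N), c ≠ 0 ∧
      aeval (fun k => Q (ι k)) c - H * H' ∈ P := by
  have halg := isAlgebraic_quotient_of_jacDet P Q ι hQ hdet
  have hmk : ∀ c : MvPolynomial κ ℂ, aeval (fun k => Ideal.Quotient.mk P (Q (ι k))) c =
      Ideal.Quotient.mk P (aeval (fun k => Q (ι k)) c) := fun c => by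
    have := MvPolynomial.aeval_algebraMap_apply (Forms N ⧸ P) (fun k => Q (ι k)) c
    exact this
  have h0 : Ideal.Quotient.mk P H ≠ 0 := fun h => hH (Ideal.Quotient.eq_zero_iff_mem.1 h)
  obtain ⟨r, hr, H', hd⟩ := (halg.isAlgebraic (Ideal.Quotient.mk P H)).exists_nonzero_dvd
    (mem_nonZeroDivisors_of_ne_zero h0)
  obtain ⟨H', rfl⟩ := Ideal.Quotient.mk_surjective H'
  obtain ⟨r, hr'⟩ := r
  have hr2 := hr'
  rw [Algebra.adjoin_range_eq_range_aeval] at hr2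
  obtain ⟨c, hc⟩ := hr2
  refine ⟨c, H', ?_, ?_⟩
  · rintro rfl
    exact hr (Subtype.ext (hc.symm.trans (map_zero _)))
  · rw [← Ideal.Quotient.eq_zero_iff_mem, map_sub, map_mul, ← hd, ← hmk]
    exact sub_eq_zero.2 hc

/-- The `n + 1` elements `Q (ι k)` generate a subring over which the quotient is algebraic, and the
transcendence degree is at least `n + 1`; so they form a transcendence basis. -/
theorem algebraicIndependent_of_jacDet (P : Ideal (Forms N)) [P.IsPrime] {n : ℕ}
    (hn : ((n + 1 : ℕ) : WithBot ℕ∞) ≤ ringKrullDim (Forms N ⧸ P))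
    (Q : Fin (N + 1) → Forms N) (ι : Fin (n + 1) → Fin (N + 1))
    (hQ : ∀ i ∉ Set.range ι, Q i ∈ P) (hdet : jacDet Q ∉ P)
    (c : MvPolynomial (Fin (n + 1)) ℂ) (hc : aeval (fun k => Q (ι k)) c ∈ P) : c = 0 := by
  have halg := isAlgebraic_quotient_of_jacDet P Q ι hQ hdet
  have h1 := ringKrullDim_le_trdeg (Forms N ⧸ P) (n + 1) hn
  have := (faithfulSMul_iff_algebraMap_injective ℂ (Forms N ⧸ P)).2
    (algebraMap ℂ (Forms N ⧸ P)).injective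
  have h2 :=
    Algebra.IsAlgebraic.isTranscendenceBasis_of_lift_le_trdeg_of_finite ℂ
    (fun k => Ideal.Quotient.mk P (Q (ι k))) (by simpa only [Cardinal.mk_fin, Cardinal.lift_natCast, Cardinal.lift_id] using h1)
  have h3 := algebraicIndependent_iff.1 h2.1 c
  apply h3
  have := MvPolynomial.aeval_algebraMap_apply (Forms N ⧸ P) (fun k => Q (ι k)) c
  exact this.trans (Ideal.Quotient.eq_zero_iff_mem.2 hc)

/-- `projDim` uses default values and truncated subtraction. They do no harm here because the
dimension of the coordinate ring is finite and positive. -/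
theorem le_ringKrullDim_of_prime (X : Set (PSpace N)) (hX : (homIdeal X).IsPrime)
    {z : PSpace N} (hz : z ∈ X) :
    ((projDim X + 1 : ℕ) : WithBot ℕ∞) ≤ ringKrullDim (Forms N ⧸ homIdeal X) := by
  have hfin : ringKrullDim (Forms N ⧸ homIdeal X) ≤ ((N + 1 : ℕ) : WithBot ℕ∞) := by
    refine (ringKrullDim_quotient_le _).trans ?_
    rw [MvPolynomial.ringKrullDim_of_isNoetherianRing, ringKrullDim_eq_zero_of_field]
    simp
  -- In dimension zero the prime ideal would be maximal, hence the ideal of the origin, although the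
  -- cone contains a nonzero vector.
  have hpos : ¬ ringKrullDim (Forms N ⧸ homIdeal X) ≤ 0 := by
    intro h
    have h1 : Ring.KrullDimLE 0 (Forms N ⧸ homIdeal X) := Ring.krullDimLE_iff.2 h
    have h2 : (homIdeal X).IsMaximal := by
      rw [Ideal.Quotient.maximal_ideal_iff_isField_quotient]
      exact Ring.KrullDimLE.isField_of_isDomain
    have h3 : homIdeal X ≤ pointIdeal (0 : Vec N) :=
      vanishingIdeal_le_pointIdeal _ ⟨z, hz, z.submodule.zero_mem⟩
    have h4 := h2.eq_of_le (Ideal.IsPrime.ne_top inferInstance) h3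
    apply z.rep_nonzero
    funext i
    have h5 : (MvPolynomial.X i : Forms N) ∈ homIdeal X := by
      rw [h4, mem_pointIdeal]; simp
    have := h5 z.rep ⟨z, hz, by
      rw [Projectivization.submodule_eq]; exact Submodule.mem_span_singleton_self _⟩
    simpa using this
  unfold projDim
  generalize ringKrullDim (Forms N ⧸ homIdeal X) = d at hfin hpos
  induction d using WithBot.recBotCoe with
  | bot => exact absurd bot_le hpos
  | coe d =>
    induction d using ENat.recTopCoe with
    | top => exact absurd (lt_of_le_of_lt hfin (by exact_mod_cast ENat.natCast_lt_top _)) (lt_irrefl _)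
    | coe d =>
      have : d ≠ 0 := by
        rintro rfl
        exact hpos le_rfl
      simp only [WithBot.unbotD_coe, ENat.toNat_natCast]
      rw [Nat.sub_add_cancel (Nat.pos_of_ne_zero this)]
      rfl

end Frames

/-! ### Multilinear forms and spanning sets. -/

section Multilinear

/-- The arguments are freed from `S i` to its span one at a time. -/
theorem MultilinearMap.eq_zero_of_mem_span {ι E : Type*} [Finite ι] [AddCommGroup E] [Module ℂ E]
    (M : MultilinearMap ℂ (fun _ : ι => E) ℂ) (S : ι → Set E)
    (h : ∀ w : ι → E, (∀ i, w i ∈ S i) → M w = 0) (w : ι → E)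
    (hw : ∀ i, w i ∈ Submodule.span ℂ (S i)) : M w = 0 := by
  classical
  have := Fintype.ofFinite ι
  have key : ∀ s : Finset ι, ∀ w : ι → E, (∀ i ∈ s, w i ∈ Submodule.span ℂ (S i)) →
      (∀ i ∉ s, w i ∈ S i) → M w = 0 := by
    intro s
    induction s using Finset.induction_on with
    | empty => exact fun w _ hw => h w fun i => hw i (Finset.notMem_empty i)
    | insert a s has ih =>
      intro w hw hw'
      let f : E →ₗ[ℂ] ℂ := M.toLinearMap w a
      have hf : Submodule.span ℂ (S a) ≤ LinearMap.ker f := by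
        rw [Submodule.span_le]
        intro x hx
        change M (Function.update w a x) = 0
        refine ih _ (fun i hi => ?_) (fun i hi => ?_)
        · rw [Function.update_of_ne (by rintro rfl; exact has hi)]
          exact hw i (Finset.mem_insert_of_mem hi)
        · by_cases hia : i = a
          · subst hia
            rwa [Function.update_self]
          · rw [Function.update_of_ne hia]
            exact hw' i (by simp [hia, hi])
      have := hf (hw a (Finset.mem_insert_self a s))
      change M (Function.update w a (w a)) = 0 at this
      rwa [Function.update_eq_self] at this
  exact key Finset.univ w (fun i _ => hw i) (fun i hi => absurd (Finset.mem_univ i) hi)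

end Multilinear

/-! ### Polarization as an iterated directional derivative. -/

section Polarization
variable {N : ℕ}

/-- The derivative of a polynomial in the direction of a vector. -/
noncomputable def dirDeriv (w : Vec N) (F : Forms N) : Forms N :=
  ∑ m, C (w m) * pderiv m F

theorem pderiv_comm (i j : Fin (N + 1)) (F : Forms N) :
    pderiv i (pderiv j F) = pderiv j (pderiv i F) := by
  induction F using MvPolynomial.induction_on' with
  | add p q hp hq => simp [hp, hq]
  | monomial u a =>
    by_cases hij : i = j
    · rw [hij]
    · simp only [pderiv_monomial]
      congr 1
      · rw [tsub_right_comm]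
      · simp [hij, Ne.symm hij]
        ring

theorem dirDeriv_comm (v w : Vec N) (F : Forms N) :
    dirDeriv v (dirDeriv w F) = dirDeriv w (dirDeriv v F) := by
  simp only [dirDeriv, map_sum, pderiv_C_mul, Finset.mul_sum]
  rw [Finset.sum_comm]
  refine Finset.sum_congr rfl fun i _ => Finset.sum_congr rfl fun j _ => ?_
  rw [pderiv_comm]
  ring

theorem foldr_dirDeriv (d : ℕ) (w : Fin d → Vec N) (F : Forms N) :
    (List.ofFn w).foldr dirDeriv F =
      ∑ j : Fin d → Fin (N + 1), C (∏ i, w i (j i)) *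
        (List.ofFn j).foldr (fun m G => pderiv m G) F := by
  induction d with
  | zero => simp
  | succ d ih =>
    rw [List.ofFn_succ, List.foldr_cons, ih, dirDeriv]
    rw [← (Fin.consEquiv fun _ : Fin (d + 1) => Fin (N + 1)).sum_comp, Fintype.sum_prod_type]
    refine Finset.sum_congr rfl fun m _ => ?_
    rw [map_sum, Finset.mul_sum]
    refine Finset.sum_congr rfl fun j _ => ?_
    simp only [Fin.consEquiv_apply, Fin.prod_univ_succ, Fin.cons_zero, Fin.cons_succ,
      List.ofFn_succ, List.foldr_cons, pderiv_C_mul, map_mul]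
    ring

/-- The symmetric multilinear form of a form of degree `d`. -/
noncomputable def polarForm (d : ℕ) (F : Forms N) : MultilinearMap ℂ (fun _ : Fin d => Vec N) ℂ :=
  (d.factorial : ℂ)⁻¹ • ∑ j : Fin d → Fin (N + 1),
    constantCoeff ((List.ofFn j).foldr (fun m G => pderiv m G) F) •
      (MultilinearMap.mkPiAlgebra ℂ (Fin d) ℂ).compLinearMap fun i => LinearMap.proj (j i)

theorem eval_polarization (d : ℕ) (F : Forms N) (x : Fin d × Fin (N + 1) → ℂ) :
    eval x (polarization d F) = polarForm d F fun i m => x (i, m) := by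
  simp [polarization, polarForm]

theorem polarForm_eq (d : ℕ) (F : Forms N) (w : Fin d → Vec N) :
    polarForm d F w = (d.factorial : ℂ)⁻¹ * eval 0 ((List.ofFn w).foldr dirDeriv F) := by
  rw [foldr_dirDeriv]
  rw [eval_zero, polarForm, _root_.smul_apply, _root_.sum_apply, map_sum,
    smul_eq_mul]
  congr 1
  refine Finset.sum_congr rfl fun j _ => ?_
  rw [map_mul, constantCoeff_C, mul_comm]
  simp

/-- Directional derivatives commute. -/
theorem polarForm_comp_perm (d : ℕ) (F : Forms N) (w : Fin d → Vec N) (σ : Equiv.Perm (Fin d)) :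
    polarForm d F (w ∘ σ) = polarForm d F w := by
  have : LeftCommutative (dirDeriv (N := N)) := ⟨dirDeriv_comm⟩
  rw [polarForm_eq, polarForm_eq, (Equiv.Perm.ofFn_comp_perm σ w).foldr_eq]

/-- The differential of a polynomial function at a point. -/
noncomputable def polyDeriv {σ : Type*} [Fintype σ] (F : MvPolynomial σ ℂ) (v : σ → ℂ) :
    (σ → ℂ) →L[ℂ] ℂ :=
  ∑ m, eval v (pderiv m F) • ContinuousLinearMap.proj (R := ℂ) (φ := fun _ : σ => ℂ) m

theorem polyDeriv_apply {σ : Type*} [Fintype σ] (F : MvPolynomial σ ℂ) (v w : σ → ℂ) :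
    polyDeriv F v w = ∑ m, eval v (pderiv m F) * w m := by
  simp [polyDeriv]

theorem hasStrictFDerivAt_eval {σ : Type*} [Fintype σ] (F : MvPolynomial σ ℂ) (v : σ → ℂ) :
    HasStrictFDerivAt (fun x : σ → ℂ => eval x F) (polyDeriv F v) v := by
  classical
  induction F using MvPolynomial.induction_on with
  | C a =>
    have h : polyDeriv (C a : MvPolynomial σ ℂ) v = 0 := by
      ext w; simp [polyDeriv_apply]
    rw [h]
    simpa using hasStrictFDerivAt_const (𝕜 := ℂ) a v
  | add p q hp hq =>
    refine ((hp.add hq).congr_fderiv ?_).congr_of_eventuallyEq (.of_forall fun x => ?_)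
    · ext w
      simp [polyDeriv_apply, add_mul, Finset.sum_add_distrib]
    · simp
  | mul_X p i hp =>
    have h1 : HasStrictFDerivAt (fun x : σ → ℂ => x i)
      (ContinuousLinearMap.proj (R := ℂ) (φ := fun _ : σ => ℂ) i) v :=
      (ContinuousLinearMap.proj (R := ℂ) (φ := fun _ : σ => ℂ) i).hasStrictFDerivAt
    refine ((hp.mul h1).congr_fderiv ?_).congr_of_eventuallyEq (.of_forall fun x => ?_)
    · ext w
      have h2 : ∀ m, eval v (pderiv m (p * X i)) * w m =
          v i * (eval v (pderiv m p) * w m) + if m = i then eval v p * w i else 0 := by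
        intro m
        by_cases h : m = i
        · subst h
          simp only [pderiv_mul, pderiv_X_self, map_add, map_mul, eval_X, map_one, if_true]
          ring
        · simp only [pderiv_mul, pderiv_X_of_ne (Ne.symm h), map_add, map_mul, eval_X, map_zero,
            if_neg h]
          ring
      rw [polyDeriv_apply]
      simp only [h2]
      simp [polyDeriv_apply, Finset.sum_add_distrib, Finset.mul_sum, add_comm]
    · simp

theorem eval_dirDeriv (w v : Vec N) (F : Forms N) :
    eval v (dirDeriv w F) = ∑ m, w m * eval v (pderiv m F) := by
  simp [dirDeriv]

theorem hasDerivAt_eval_line (F : Forms N) (v w : Vec N) :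
    HasDerivAt (fun t : ℂ => eval (v + t • w) F) (eval v (dirDeriv w F)) 0 := by
  have h1 : HasDerivAt (fun t : ℂ => v + t • w) w 0 := by
    simpa using ((hasDerivAt_id (0 : ℂ)).smul_const w).const_add v
  have h2 : HasFDerivAt (fun x : Vec N => eval x F) (polyDeriv F v) (v + (0 : ℂ) • w) := by
    rw [zero_smul, add_zero]
    exact (hasStrictFDerivAt_eval F v).hasFDerivAt
  have h3 := h2.comp_hasDerivAt 0 h1
  have h4 : eval v (dirDeriv w F) = polyDeriv F v w := by
    rw [eval_dirDeriv, polyDeriv_apply]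
    exact Finset.sum_congr rfl fun m _ => mul_comm _ _
  rw [h4]
  exact h3

theorem eval_dirDeriv_eq_zero (W : Submodule ℂ (Vec N)) (F : Forms N)
    (hF : ∀ v ∈ W, eval v F = 0) {w : Vec N} (hw : w ∈ W) :
    ∀ v ∈ W, eval v (dirDeriv w F) = 0 := by
  intro v hv
  have h := hasDerivAt_eval_line F v w
  have h0 : HasDerivAt (fun _ : ℂ => (0 : ℂ)) (eval v (dirDeriv w F)) 0 :=
    h.congr_of_eventuallyEq
      (.of_forall fun t => (hF _ (W.add_mem hv (W.smul_mem t hw))).symm)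
  exact h0.unique (hasDerivAt_const (0 : ℂ) (0 : ℂ))

/-- Derivatives along `W` of a function vanishing on `W` vanish on `W`, in particular at the origin.
-/
theorem polarForm_eq_zero (W : Submodule ℂ (Vec N)) (d : ℕ) (F : Forms N)
    (hF : ∀ v ∈ W, eval v F = 0) (w : Fin d → Vec N) (hw : ∀ i, w i ∈ W) :
    polarForm d F w = 0 := by
  have key : ∀ l : List (Vec N), (∀ w ∈ l, w ∈ W) → ∀ v ∈ W, eval v (l.foldr dirDeriv F) = 0 := by
    intro l
    induction l with
    | nil => exact fun _ => hF
    | cons a l ih =>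
      intro hl
      exact eval_dirDeriv_eq_zero W _ (ih fun w hw => hl w (List.mem_cons_of_mem _ hw))
        (hl a List.mem_cons_self)
  rw [polarForm_eq, key _ (fun x hx => ?_) 0 W.zero_mem, mul_zero]
  obtain ⟨i, rfl⟩ := (List.mem_ofFn' _ _).1 hx
  exact hw i

theorem isHomogeneous_dirDeriv (v : Vec N) {d : ℕ} {F : Forms N} (hF : F.IsHomogeneous (d + 1)) :
    (dirDeriv v F).IsHomogeneous d := by
  refine IsHomogeneous.sum _ _ _ fun m _ => ?_
  have := (hF.pderiv (i := m)).C_mul (v m)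
  simpa using this

theorem eval_dirDeriv_self (v : Vec N) {d : ℕ} {F : Forms N} (hF : F.IsHomogeneous d) :
    eval v (dirDeriv v F) = d * eval v F := by
  have := congrArg (eval v) hF.sum_X_mul_pderiv
  simpa [eval_dirDeriv] using this

/-- Euler's identity applied `d` times, producing the factor `d!` that the normalization cancels. -/
theorem polarForm_diag (d : ℕ) {F : Forms N} (hF : F.IsHomogeneous d) (v : Vec N) :
    polarForm d F (fun _ => v) = eval v F := by
  have key : ∀ (d : ℕ) (F : Forms N), F.IsHomogeneous d →
      eval v ((dirDeriv v)^[d] F) = d.factorial * eval v F ∧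
        ((dirDeriv v)^[d] F).IsHomogeneous 0 := by
    intro d
    induction d with
    | zero => exact fun F hF => ⟨by simp, hF⟩
    | succ d ih =>
      intro F hF
      rw [Function.iterate_succ_apply]
      obtain ⟨h1, h2⟩ := ih _ (isHomogeneous_dirDeriv v hF)
      refine ⟨?_, h2⟩
      rw [h1, eval_dirDeriv_self v hF, Nat.factorial_succ]
      push_cast
      ring
  obtain ⟨h1, h2⟩ := key d F hF
  have hfold : (List.ofFn fun _ : Fin d => v).foldr dirDeriv F = (dirDeriv v)^[d] F := by
    rw [List.ofFn_const]
    clear h1 h2 hF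
    induction d with
    | zero => rfl
    | succ d ih => rw [List.replicate_succ, List.foldr_cons, ih, Function.iterate_succ_apply']
  -- After `d` derivatives the form is constant, so its value at `0`, as in `polarForm_eq`, is its
  -- value at `v`.
  obtain ⟨c, hc⟩ : ∃ c, (dirDeriv v)^[d] F = C c :=
    ⟨_, totalDegree_eq_zero_iff_eq_C.1 (Nat.le_zero.1 h2.totalDegree_le)⟩
  rw [polarForm_eq, hfold]
  rw [hc] at h1 ⊢
  rw [eval_C] at h1 ⊢
  rw [h1, inv_mul_cancel_left₀ (by exact_mod_cast d.factorial_ne_zero)]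

end Polarization

/-! ### Generic points on products of cones. -/

section Products

/-- Coordinates on `ι → Vec N` as a function on pairs of indices. -/
def tupleCoord {N : ℕ} {ι : Type} (v : ι → Vec N) : ι × Fin (N + 1) → ℂ := fun x => v x.1 x.2

/-- Restriction of a polynomial in several groups of variables to one of these groups. -/
noncomputable def partialEval {N : ℕ} {ι : Type} [DecidableEq ι]
    (f : MvPolynomial (ι × Fin (N + 1)) ℂ) (v : ι → Vec N) (c : ι) : Forms N :=
  aeval (fun x : ι × Fin (N + 1) => if x.1 = c then X x.2 else C (v x.1 x.2)) f

theorem eval_partialEval {N : ℕ} {ι : Type} [DecidableEq ι]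
    (f : MvPolynomial (ι × Fin (N + 1)) ℂ) (v : ι → Vec N) (c : ι) (w : Vec N) :
    eval w (partialEval f v c) = eval (tupleCoord (Function.update v c w)) f := by
  induction f using MvPolynomial.induction_on with
  | C a => simp [partialEval]
  | add p q hp hq =>
    have : partialEval (p + q) v c = partialEval p v c + partialEval q v c := by
      simp [partialEval]
    rw [this, map_add, map_add, hp, hq]
  | mul_X p i hp =>
    have : partialEval (p * X i) v c =
        partialEval p v c * if i.1 = c then X i.2 else C (v i.1 i.2) := by
      simp [partialEval]
    rw [this, map_mul, map_mul, hp, eval_X]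
    congr 1
    unfold tupleCoord
    split_ifs with h
    · rw [h, Function.update_self, eval_X]
    · rw [Function.update_of_ne h, eval_C]

/-- This is irreducibility of a product of copies of an irreducible set, with the common
nonvanishing point chosen in Zariski dense subsets `S c`. Two tuples, one for `f` and one for `g`,
are made to agree slot by slot: in the current slot the product of the two restrictions is a
polynomial outside the prime ideal of `T`. -/
theorem exists_eval_ne_zero_of_isPrime {N : ℕ} {ι : Type} [Fintype ι] {T : Set (Vec N)}
    (hT : (MvPolynomial.vanishingIdeal ℂ T).IsPrime) (S : ι → Set (Vec N))
    (hS : ∀ c, ∀ H : Forms N, H ∉ MvPolynomial.vanishingIdeal ℂ T → ∃ w ∈ S c, eval w H ≠ 0)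
    (f g : MvPolynomial (ι × Fin (N + 1)) ℂ) (v v' : ι → Vec N) (hv : ∀ c, v c ∈ T)
    (hv' : ∀ c, v' c ∈ T) (hf : eval (tupleCoord v) f ≠ 0) (hg : eval (tupleCoord v') g ≠ 0) :
    ∃ u : ι → Vec N, (∀ c, u c ∈ S c) ∧ eval (tupleCoord u) f ≠ 0 ∧
      eval (tupleCoord u) g ≠ 0 := by
  classical
  have key : ∀ s : Finset ι, ∃ v v' : ι → Vec N, (∀ c ∈ s, v c = v' c ∧ v c ∈ S c) ∧
      (∀ c ∉ s, v c ∈ T ∧ v' c ∈ T) ∧ eval (tupleCoord v) f ≠ 0 ∧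
      eval (tupleCoord v') g ≠ 0 := by
    intro s
    induction s using Finset.induction_on with
    | empty => exact ⟨v, v', by simp, fun c _ => ⟨hv c, hv' c⟩, hf, hg⟩
    | insert a s has ih =>
      obtain ⟨v, v', h1, h2, h3, h4⟩ := ih
      have hH : partialEval f v a * partialEval g v' a ∉ MvPolynomial.vanishingIdeal ℂ T := by
        intro h
        rcases hT.mem_or_mem h with h | h
        · have := h _ (h2 a has).1
          rw [aeval_eq_eval] at this
          apply h3
          have h' : eval (v a) (partialEval f v a) = 0 := this
          rwa [eval_partialEval, Function.update_eq_self] at h'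
        · have := h _ (h2 a has).2
          rw [aeval_eq_eval] at this
          apply h4
          have h' : eval (v' a) (partialEval g v' a) = 0 := this
          rwa [eval_partialEval, Function.update_eq_self] at h'
      obtain ⟨w, hwS, hw⟩ := hS a _ hH
      rw [map_mul, eval_partialEval, eval_partialEval] at hw
      refine ⟨Function.update v a w, Function.update v' a w, fun c hc => ?_, fun c hc => ?_,
        left_ne_zero_of_mul hw, right_ne_zero_of_mul hw⟩
      · by_cases hca : c = a
        · subst hca
          simp [hwS]
        · rw [Function.update_of_ne hca, Function.update_of_ne hca]
          exact h1 c (Finset.mem_of_mem_insert_of_ne hc hca)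
      · rw [Finset.mem_insert, not_or] at hc
        rw [Function.update_of_ne hc.1, Function.update_of_ne hc.1]
        exact h2 c hc.2
  obtain ⟨v, v', h1, -, h3, h4⟩ := key Finset.univ
  have : v = v' := funext fun c => (h1 c (Finset.mem_univ c)).1
  subst this
  exact ⟨v, fun c => (h1 c (Finset.mem_univ c)).2, h3, h4⟩

/-- The tuple of vectors rescaled so that chosen coordinates become `1`. -/
noncomputable def normalCoord {N : ℕ} {ι : Type} (j : ι → Fin (N + 1)) (v : ι → Vec N) :
    ι × Fin (N + 1) → ℂ := fun x => (v x.1 (j x.1))⁻¹ * v x.1 x.2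

/-- Clearing denominators. The full product of the distinguished coordinates is used so that one
exponent serves all factors, which allows the polynomials to be added. -/
theorem exists_homogenization {N : ℕ} {ι : Type} [Fintype ι] (j : ι → Fin (N + 1))
    (f : MvPolynomial (ι × Fin (N + 1)) ℂ) :
    ∃ (d : ℕ) (g : MvPolynomial (ι × Fin (N + 1)) ℂ), ∀ v : ι → Vec N, (∀ c, v c (j c) ≠ 0) →
      eval (tupleCoord v) g = (∏ c, v c (j c)) ^ d * eval (normalCoord j v) f := by
  classical
  let h : MvPolynomial (ι × Fin (N + 1)) ℂ := ∏ c, X (c, j c)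
  have hh : ∀ v : ι → Vec N, eval (tupleCoord v) h = ∏ c, v c (j c) := fun v => by
    simp [h, tupleCoord]
  induction f using MvPolynomial.induction_on with
  | C a => exact ⟨0, C a, fun v _ => by simp⟩
  | add p q hp hq =>
    obtain ⟨d, g, hg⟩ := hp
    obtain ⟨d', g', hg'⟩ := hq
    refine ⟨d + d', g * h ^ d' + g' * h ^ d, fun v hv => ?_⟩
    simp only [map_add, map_mul, map_pow, hh, hg v hv, hg' v hv]
    ring
  | mul_X p i hp =>
    obtain ⟨d, g, hg⟩ := hp
    refine ⟨d + 1, g * (X i * ∏ c ∈ Finset.univ.erase i.1, X (c, j c)), fun v hv => ?_⟩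
    have h1 : ∏ c, v c (j c) = v i.1 (j i.1) * ∏ c ∈ Finset.univ.erase i.1, v c (j c) :=
      (Finset.mul_prod_erase _ _ (Finset.mem_univ _)).symm
    simp only [map_mul, map_prod, eval_X, hg v hv, pow_succ]
    rw [h1]
    have := hv i.1
    simp only [tupleCoord, normalCoord]
    field_simp

end Products

/-! ### The components of the big diagonal in the charts. -/

section Cones
variable {N : ℕ}

theorem smul_mem_cone {X : Set (PSpace N)} {v : Vec N} (hv : v ∈ cone X) (c : ℂ) :
    c • v ∈ cone X := by
  obtain ⟨z, hz, hvz⟩ := hv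
  exact ⟨z, hz, z.submodule.smul_mem c hvz⟩

theorem cone_mono {X Y : Set (PSpace N)} (h : X ⊆ Y) : cone X ⊆ cone Y := by
  rintro v ⟨z, hz, hv⟩
  exact ⟨z, h hz, hv⟩

theorem mem_homIdeal {X : Set (PSpace N)} {F : Forms N} :
    F ∈ homIdeal X ↔ ∀ v ∈ cone X, eval v F = 0 := by
  rw [homIdeal, mem_vanishingIdeal_iff]
  rfl

theorem rep_mem_submodule (z : PSpace N) : z.rep ∈ z.submodule := by
  rw [Projectivization.submodule_eq]
  exact Submodule.mem_span_singleton_self _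

/-- `G` is an equation of `A` not vanishing at some point of `U`, times a coordinate nonzero at that
point. The coordinate keeps away the zero vector, which belongs to every cone over a nonempty set.
-/
theorem exists_form_of_isOpen {X A U : Set (PSpace N)} (hX : (homIdeal X).IsPrime)
    (hA : IsZariskiClosed A) (hU : U = X \ A) (hne : U.Nonempty) :
    ∃ G : Forms N, G ∉ homIdeal X ∧ ∀ v ∈ cone X, eval v G ≠ 0 → v ∈ cone U ∧ v ≠ 0 := by
  obtain ⟨z, hz⟩ := hne
  rw [hU] at hz
  have h1 : z ∉ zariskiClosure A := by rw [hA]; exact hz.2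
  simp only [zariskiClosure, Set.mem_ofPred_eq, not_forall] at h1
  obtain ⟨F, hF, v, hv, hFv⟩ := h1
  obtain ⟨i, hi⟩ := Function.ne_iff.1 z.rep_nonzero
  refine ⟨F * MvPolynomial.X i, fun h => ?_, fun w hw hw' => ?_⟩
  · rcases hX.mem_or_mem h with h | h
    · exact hFv (mem_homIdeal.1 h v ⟨z, hz.1, hv⟩)
    · exact hi (by simpa using mem_homIdeal.1 h z.rep ⟨z, hz.1, rep_mem_submodule z⟩)
  · rw [map_mul, eval_X] at hw'
    obtain ⟨y, hy, hwy⟩ := hw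
    refine ⟨⟨y, ?_, hwy⟩, fun h => right_ne_zero_of_mul hw' (by simp [h])⟩
    rw [hU]
    exact ⟨hy, fun hyA => left_ne_zero_of_mul hw' (mem_homIdeal.1 hF w ⟨y, hyA, hwy⟩)⟩

/-- The part of the diagonal `x_a = x_b` in a chart of `U^d`. -/
def pairDiagonal (U : Set (PSpace N)) {d : ℕ} (j : Fin d → Fin (N + 1)) (a b : Fin d) :
    Set (Fin d × Fin (N + 1) → ℂ) :=
  {x | x ∈ boxChart U j ∧
    Submodule.span ℂ {fun m => x (a, m)} = Submodule.span ℂ {fun m => x (b, m)}}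

theorem normalCoord_mem_boxChart {U : Set (PSpace N)} {d : ℕ} {j : Fin d → Fin (N + 1)}
    {v : Fin d → Vec N} (hv : ∀ c, v c ∈ cone U ∧ v c (j c) ≠ 0) :
    normalCoord j v ∈ boxChart U j := fun c =>
  ⟨inv_mul_cancel₀ (hv c).2, smul_mem_cone (hv c).1 (v c (j c))⁻¹⟩

theorem normalCoord_mem_pairDiagonal {U : Set (PSpace N)} {d : ℕ} {j : Fin d → Fin (N + 1)}
    {v : Fin d → Vec N} (hv : ∀ c, v c ∈ cone U ∧ v c (j c) ≠ 0) {a b : Fin d}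
    (hab : v b = v a) : normalCoord j v ∈ pairDiagonal U j a b := by
  refine ⟨normalCoord_mem_boxChart hv, ?_⟩
  have h : ∀ c, Submodule.span ℂ {fun m => normalCoord j v (c, m)} = Submodule.span ℂ {v c} :=
    fun c => Submodule.span_singleton_smul_eq
      (IsUnit.mk0 _ (inv_ne_zero (hv c).2)) (v c)
  rw [h, h, hab]

theorem exists_eq_normalCoord {U : Set (PSpace N)} {d : ℕ} {j : Fin d → Fin (N + 1)}
    {x : Fin d × Fin (N + 1) → ℂ} {a b : Fin d} (hx : x ∈ pairDiagonal U j a b) :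
    ∃ v : Fin d → Vec N, (∀ c, v c ∈ cone U ∧ v c (j c) ≠ 0) ∧ v b = v a ∧
      x = normalCoord j v := by
  classical
  obtain ⟨hx, hs⟩ := hx
  have hmem : (fun m => x (b, m)) ∈ Submodule.span ℂ {fun m => x (a, m)} := by
    rw [hs]; exact Submodule.mem_span_singleton_self _
  obtain ⟨c₀, hc₀⟩ := Submodule.mem_span_singleton.1 hmem
  have hc : ∀ m, c₀ * x (a, m) = x (b, m) := fun m => congrFun hc₀ m
  have hb : c₀ * x (a, j b) = 1 := (hc _).trans (hx b).1
  refine ⟨Function.update (fun c m => x (c, m)) b (fun m => x (a, m)), fun c => ?_, ?_, ?_⟩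
  · by_cases h : c = b
    · subst h
      rw [Function.update_self]
      exact ⟨(hx a).2, right_ne_zero_of_mul_eq_one hb⟩
    · rw [Function.update_of_ne h]
      exact ⟨(hx c).2, by rw [(hx c).1]; exact one_ne_zero⟩
  · rw [Function.update_self]
    by_cases h : a = b
    · rw [h, Function.update_self]
    · rw [Function.update_of_ne h]
  · funext ⟨c, m⟩
    simp only [normalCoord]
    by_cases h : c = b
    · subst h
      rw [Function.update_self, ← hc m, ← eq_inv_of_mul_eq_one_left hb]
    · rw [Function.update_of_ne h, (hx c).1, inv_one, one_mul]

/-- The piece `x_a = x_b` is parametrized by tuples of cone vectors with the slot `b` overwritten by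
the slot `a`, so it inherits irreducibility from the product. The sets `S c` may be any Zariski
dense subsets of the cone; later they are analytic neighbourhoods, and generic points can thereby be
found near a given one. -/
theorem exists_generic_on_pairDiagonal {X A U : Set (PSpace N)} (hX : (homIdeal X).IsPrime)
    (hA : IsZariskiClosed A) (hU : U = X \ A) (hne : U.Nonempty) {d : ℕ}
    (j : Fin d → Fin (N + 1)) (a b : Fin d) (S : Fin d → Set (Vec N))
    (hSX : ∀ c, S c ⊆ cone X) (hS : ∀ c, ∀ H : Forms N, H ∉ homIdeal X → ∃ w ∈ S c, eval w H ≠ 0)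
    (f g : MvPolynomial (Fin d × Fin (N + 1)) ℂ)
    (hf : f ∉ MvPolynomial.vanishingIdeal ℂ (pairDiagonal U j a b))
    (hg : g ∉ MvPolynomial.vanishingIdeal ℂ (pairDiagonal U j a b)) :
    ∃ u : Fin d → Vec N, (∀ c, c ≠ b → u c ∈ S c) ∧ u b = u a ∧
      (∀ c, u c ∈ cone U ∧ u c (j c) ≠ 0) ∧ eval (normalCoord j u) f ≠ 0 ∧
      eval (normalCoord j u) g ≠ 0 := by
  classical
  obtain ⟨G, hG, hGU⟩ := exists_form_of_isOpen hX hA hU hne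
  have hUX : U ⊆ X := by rw [hU]; exact Set.sdiff_subset
  -- Precomposition with `r` makes the entries `a` and `b` equal; `R` is the corresponding pullback
  -- of polynomials, so nonvanishing on the diagonal becomes nonvanishing on a full product.
  let r : Fin d → Fin d := fun c => if c = b then a else c
  have hr : ∀ v : Fin d → Vec N, v b = v a → v ∘ r = v := by
    intro v hv
    funext c
    simp only [r, Function.comp_apply]
    split_ifs with h
    · rw [h, hv]
    · rfl
  let R : MvPolynomial (Fin d × Fin (N + 1)) ℂ → MvPolynomial (Fin d × Fin (N + 1)) ℂ :=
    rename (Prod.map r id)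
  have hR : ∀ (v : Fin d → Vec N) (p), eval (tupleCoord v) (R p) = eval (tupleCoord (v ∘ r)) p := by
    intro v p
    simp only [R, eval_rename]
    rfl
  obtain ⟨df, f', hf'⟩ := exists_homogenization j f
  obtain ⟨dg, g', hg'⟩ := exists_homogenization j g
  have hpt : ∀ p : MvPolynomial (Fin d × Fin (N + 1)) ℂ,
      p ∉ MvPolynomial.vanishingIdeal ℂ (pairDiagonal U j a b) →
      ∃ v : Fin d → Vec N, (∀ c, v c ∈ cone U ∧ v c (j c) ≠ 0) ∧ v b = v a ∧
        eval (normalCoord j v) p ≠ 0 := by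
    intro p hp
    rw [mem_vanishingIdeal_iff] at hp
    push Not at hp
    obtain ⟨x, hx, hpx⟩ := hp
    obtain ⟨v, h1, h2, rfl⟩ := exists_eq_normalCoord hx
    exact ⟨v, h1, h2, hpx⟩
  obtain ⟨v, hv, hvab, hvf⟩ := hpt f hf
  obtain ⟨v', hv', hvab', hvg⟩ := hpt g hg
  have hprod : ∀ {v : Fin d → Vec N}, (∀ c, v c ∈ cone U ∧ v c (j c) ≠ 0) →
      ∏ c, v c (j c) ≠ 0 := fun hv => Finset.prod_ne_zero_iff.2 fun c _ => (hv c).2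
  have hself : ∀ c, ∀ H : Forms N, H ∉ homIdeal X → ∃ w ∈ (fun _ : Fin d => cone X) c,
      eval w H ≠ 0 := by
    intro c H hH
    rw [mem_homIdeal] at hH
    push Not at hH
    exact hH
  -- a common nonvanishing point of the two homogenizations
  obtain ⟨u₁, hu₁, hu₁f, hu₁g⟩ := exists_eval_ne_zero_of_isPrime hX _ hself (R f') (R g') v v'
    (fun c => cone_mono hUX (hv c).1) (fun c => cone_mono hUX (hv' c).1)
    (by rw [hR, hr v hvab, hf' v fun c => (hv c).2]; exact mul_ne_zero (pow_ne_zero _ (hprod hv)) hvf)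
    (by rw [hR, hr v' hvab', hg' v' fun c => (hv' c).2]
        exact mul_ne_zero (pow_ne_zero _ (hprod hv')) hvg)
  let h : MvPolynomial (Fin d × Fin (N + 1)) ℂ := ∏ c, MvPolynomial.X (c, j c)
  have hh : ∀ v : Fin d → Vec N, eval (tupleCoord v) h = ∏ c, v c (j c) := fun v => by
    simp [h, tupleCoord]
  obtain ⟨u₂, hu₂, hu₂fg, hu₂h⟩ := exists_eval_ne_zero_of_isPrime hX _ hself (R f' * R g') (R h)
    u₁ v hu₁ (fun c => cone_mono hUX (hv c).1) (by rw [map_mul]; exact mul_ne_zero hu₁f hu₁g)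
    (by rw [hR, hr v hvab, hh]; exact hprod hv)
  obtain ⟨w, hw⟩ := hself a G hG
  let k : MvPolynomial (Fin d × Fin (N + 1)) ℂ := ∏ c, rename (fun m => (c, m)) G
  have hk : ∀ v : Fin d → Vec N, eval (tupleCoord v) k = ∏ c, eval (v c) G := fun v => by
    simp only [k, map_prod, eval_rename]
    rfl
  obtain ⟨u, hu, hufgh, huk⟩ := exists_eval_ne_zero_of_isPrime hX S hS (R f' * R g' * R h) k
    u₂ (fun _ => w) hu₂ (fun _ => hw.1) (by rw [map_mul]; exact mul_ne_zero hu₂fg hu₂h)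
    (by rw [hk]; exact Finset.prod_ne_zero_iff.2 fun c _ => hw.2)
  rw [map_mul, map_mul, hR, hR, hR] at hufgh
  rw [hk] at huk
  have hcoord : ∀ c, (u ∘ r) c (j c) ≠ 0 := by
    have := right_ne_zero_of_mul hufgh
    rw [hh] at this
    exact fun c => Finset.prod_ne_zero_iff.1 this c (Finset.mem_univ c)
  refine ⟨u ∘ r, fun c hc => ?_, ?_, fun c => ⟨?_, hcoord c⟩, ?_, ?_⟩
  · simp only [Function.comp_apply, r, if_neg hc]
    exact hu c
  · simp only [Function.comp_apply, r, if_true]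
    split_ifs <;> rfl
  · exact (hGU _ (hSX _ (hu _)) (Finset.prod_ne_zero_iff.1 huk _ (Finset.mem_univ _))).1
  · have := left_ne_zero_of_mul (left_ne_zero_of_mul hufgh)
    rw [hf' _ hcoord] at this
    exact right_ne_zero_of_mul this
  · have := right_ne_zero_of_mul (left_ne_zero_of_mul hufgh)
    rw [hg' _ hcoord] at this
    exact right_ne_zero_of_mul this

theorem isPrime_vanishingIdeal_pairDiagonal {X A U : Set (PSpace N)} (hX : (homIdeal X).IsPrime)
    (hA : IsZariskiClosed A) (hU : U = X \ A) (hne : U.Nonempty) {d : ℕ}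
    (j : Fin d → Fin (N + 1)) (a b : Fin d)
    (h : MvPolynomial.vanishingIdeal ℂ (pairDiagonal U j a b) ≠ ⊤) :
    (MvPolynomial.vanishingIdeal ℂ (pairDiagonal U j a b)).IsPrime := by
  refine ⟨h, fun {f g} hfg => ?_⟩
  by_contra hcon
  rw [not_or] at hcon
  obtain ⟨u, -, hab, hu, huf, hug⟩ := exists_generic_on_pairDiagonal hX hA hU hne j a b
    (fun _ => cone X) (fun _ => subset_rfl)
    (fun c H hH => by rw [mem_homIdeal] at hH; push Not at hH; exact hH) f g hcon.1 hcon.2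
  have := hfg _ (normalCoord_mem_pairDiagonal hu hab)
  rw [map_mul] at this
  exact mul_ne_zero huf hug this

theorem vanishingIdeal_bigDiagonal (U : Set (PSpace N)) {d : ℕ} (j : Fin d → Fin (N + 1)) :
    MvPolynomial.vanishingIdeal ℂ (bigDiagonal U j) =
      ⨅ i : {i : Fin d × Fin d // i.1 ≠ i.2},
        MvPolynomial.vanishingIdeal ℂ (pairDiagonal U j i.1.1 i.1.2) := by
  ext f
  simp only [Ideal.mem_iInf, mem_vanishingIdeal_iff]
  constructor
  · rintro h ⟨⟨a, b⟩, hab⟩ x hx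
    exact h x ⟨hx.1, a, b, hab, hx.2⟩
  · rintro h x ⟨hx, a, b, hab, hs⟩
    exact h ⟨(a, b), hab⟩ x ⟨hx, hs⟩

theorem vanishesAlongDiagonal_of_exists {X A U : Set (PSpace N)} (hX : (homIdeal X).IsPrime)
    (hA : IsZariskiClosed A) (hU : U = X \ A) (hne : U.Nonempty) (d ℓ : ℕ) (F : Forms N)
    (H : ∀ (j : Fin d → Fin (N + 1)) (a b : Fin d), a ≠ b →
      MvPolynomial.vanishingIdeal ℂ (pairDiagonal U j a b) ≠ ⊤ →
      ∃ s ∉ MvPolynomial.vanishingIdeal ℂ (pairDiagonal U j a b), s * polarization d F ∈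
        MvPolynomial.vanishingIdeal ℂ (pairDiagonal U j a b) ^ ℓ ⊔
          MvPolynomial.vanishingIdeal ℂ (boxChart U j)) :
    VanishesAlongDiagonal U d ℓ F := by
  intro j p
  rw [germAt_mem_symbolicPower_iff, vanishingIdeal_bigDiagonal]
  exact toLocal_mem_symbolicPower (boxChart U j) p _
    (fun i : {i : Fin d × Fin d // i.1 ≠ i.2} => pairDiagonal U j i.1.1 i.1.2)
    (fun i x hx => hx.1)
    (fun i hi => isPrime_vanishingIdeal_pairDiagonal hX hA hU hne j _ _ hi) ℓ _
    (fun i hi => H j _ _ i.2 hi)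

/-- The pair in the conclusion may differ from the given one, which serves only to exhibit a point
where germs are tested. -/
theorem exists_mul_polarization_mem {X A U : Set (PSpace N)} (hX : (homIdeal X).IsPrime)
    (hA : IsZariskiClosed A) (hU : U = X \ A) (hne : U.Nonempty) {d ℓ : ℕ} {F : Forms N}
    (hF : VanishesAlongDiagonal U d ℓ F) (j : Fin d → Fin (N + 1)) {a b : Fin d} (hab : a ≠ b)
    (hne' : (pairDiagonal U j a b).Nonempty) :
    ∃ a b : Fin d, a ≠ b ∧
      ∃ s ∉ MvPolynomial.vanishingIdeal ℂ (pairDiagonal U j a b), s * polarization d F ∈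
        MvPolynomial.vanishingIdeal ℂ (pairDiagonal U j a b) ^ ℓ ⊔
          MvPolynomial.vanishingIdeal ℂ (boxChart U j) := by
  obtain ⟨x, hx⟩ := hne'
  have h := hF j ⟨x, hx.1⟩
  rw [germAt_mem_symbolicPower_iff, vanishingIdeal_bigDiagonal] at h
  obtain ⟨i, -, hi⟩ := exists_mul_mem_of_toLocal_mem_symbolicPower (boxChart U j) ⟨x, hx.1⟩ _
    (fun i : {i : Fin d × Fin d // i.1 ≠ i.2} => pairDiagonal U j i.1.1 i.1.2)
    (fun i x hx => hx.1)
    (fun i hi => isPrime_vanishingIdeal_pairDiagonal hX hA hU hne j _ _ hi) ⟨(a, b), hab⟩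
    hx ℓ _ h
  exact ⟨_, _, i.2, hi⟩

end Cones

/-! ### Orders of vanishing and iterated directional derivatives. -/

section IteratedDirectional

variable {E F G : Type*} [NormedAddCommGroup E] [NormedSpace ℂ E] [NormedAddCommGroup F]
  [NormedSpace ℂ F] [CompleteSpace F] [NormedAddCommGroup G] [NormedSpace ℂ G] [CompleteSpace G]

/-- Iterated directional derivatives along the vectors of a list, the last one innermost. -/
noncomputable def iterDir (l : List E) (f : E → F) : E → F :=
  l.foldr (fun h g x => fderiv ℂ g x h) f

set_option linter.unusedSectionVars false

theorem iterDir_cons (h : E) (l : List E) (f : E → F) :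
    iterDir (h :: l) f = fun x => fderiv ℂ (iterDir l f) x h := rfl

theorem iterDir_append (l l' : List E) (f : E → F) :
    iterDir (l ++ l') f = iterDir l (iterDir l' f) := by
  simp [iterDir, List.foldr_append]

theorem analyticAt_fderiv_apply {f : E → F} {x : E} (hf : AnalyticAt ℂ f x) (h : E) :
    AnalyticAt ℂ (fun y => fderiv ℂ f y h) x :=
  ((ContinuousLinearMap.apply ℂ F h).analyticAt _).comp hf.fderiv

theorem analyticAt_iterDir {f : E → F} {x : E} (hf : AnalyticAt ℂ f x) (l : List E) :
    AnalyticAt ℂ (iterDir l f) x := by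
  induction l with
  | nil => exact hf
  | cons h l ih => exact analyticAt_fderiv_apply ih h

theorem iterDir_clm_comp (L : F →L[ℂ] G) {f : E → F} {x : E} (hf : AnalyticAt ℂ f x)
    (l : List E) : iterDir l (fun y => L (f y)) =ᶠ[𝓝 x] fun y => L (iterDir l f y) := by
  induction l with
  | nil => exact Filter.EventuallyEq.rfl
  | cons h l ih =>
    filter_upwards [ih.eventuallyEq_nhds, (analyticAt_iterDir hf l).eventually_analyticAt]
      with y hy hy'
    rw [iterDir_cons, iterDir_cons]
    beta_reduce
    rw [hy.fderiv_eq]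
    have := (L.hasFDerivAt.comp y hy'.differentiableAt.hasFDerivAt).fderiv
    simp only [Function.comp_def] at this
    rw [this]
    rfl

theorem iterDir_comp_add_left (f : E → F) (τ : E) (l : List E) :
    iterDir l (fun t => f (τ + t)) = fun t => iterDir l f (τ + t) := by
  induction l with
  | nil => rfl
  | cons h l ih =>
    rw [iterDir_cons, ih, iterDir_cons]
    funext t
    rw [fderiv_comp_add_left]

theorem iterDir_comp_line {f : E → F} (τ h : E) (hf : AnalyticAt ℂ f τ) (m : ℕ) :
    ∀ᶠ ε in 𝓝 (0 : ℂ), iterDir (List.replicate m 1) (fun ε : ℂ => f (τ + ε • h)) ε =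
      iterDir (List.replicate m h) f (τ + ε • h) := by
  have hline : ∀ ε : ℂ, HasFDerivAt (fun ε : ℂ => τ + ε • h)
      ((ContinuousLinearMap.id ℂ ℂ).smulRight h) ε := fun ε =>
    ((hasFDerivAt_id ε).smul_const h).const_add τ
  induction m with
  | zero => exact Filter.Eventually.of_forall fun _ => rfl
  | succ m ih =>
    have hc : Filter.Tendsto (fun ε : ℂ => τ + ε • h) (𝓝 0) (𝓝 τ) := by
      have := (hline 0).continuousAt
      simpa [ContinuousAt] using this
    filter_upwards [ih.eventually_nhds,
      hc.eventually (analyticAt_iterDir hf (List.replicate m h)).eventually_analyticAt] with ε h1 h2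
    rw [List.replicate_succ, List.replicate_succ, iterDir_cons, iterDir_cons]
    beta_reduce
    rw [Filter.EventuallyEq.fderiv_eq h1]
    have := (h2.differentiableAt.hasFDerivAt.comp ε (hline ε)).fderiv
    simp only [Function.comp_def] at this
    rw [this]
    simp

theorem iteratedFDeriv_eq_iterDir {f : E → F} {x : E} (hf : AnalyticAt ℂ f x) (m : ℕ)
    (v : Fin m → E) : iteratedFDeriv ℂ m f x v = iterDir (List.ofFn v) f x := by
  induction m generalizing x with
  | zero => simp [iterDir]
  | succ m ih =>
    rw [List.ofFn_succ, iterDir_cons, iteratedFDeriv_succ_apply_left]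
    have h1 : (fun y => iteratedFDeriv ℂ m f y (Fin.tail v)) =ᶠ[𝓝 x]
        iterDir (List.ofFn (Fin.tail v)) f := by
      filter_upwards [hf.eventually_analyticAt] with y hy using ih hy _
    have h2 := h1.fderiv_eq (𝕜 := ℂ)
    have hd : DifferentiableAt ℂ (iteratedFDeriv ℂ m f) x :=
      (hf.contDiffAt (n := (m + 1 : ℕ))).differentiableAt_iteratedFDeriv
        (by exact_mod_cast Nat.lt_succ_self m)
    have h3 := (HasFDerivAt.comp (g := fun S => ContinuousMultilinearMap.apply ℂ
      (fun _ : Fin m => E) F (Fin.tail v) S) x (ContinuousLinearMap.hasFDerivAt _)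
      hd.hasFDerivAt).fderiv
    simp only [Function.comp_def, ContinuousMultilinearMap.apply_apply] at h3
    have h4 : (fun i => v (Fin.succ i)) = Fin.tail v := rfl
    beta_reduce
    rw [h4, ← h2, h3]
    rfl

/-- Cauchy's estimate on the circle of radius `‖x‖` about `x` in the direction `v`, whose points
have norm at most `‖x‖ (1 + ‖v‖)`. The case `r = 0` is continuity of the derivative, and at `x = 0`
the circle degenerates, but there the derivative is zero. -/
theorem isBigO_fderiv_apply {f : E → F} (hf : AnalyticAt ℂ f 0) {r : ℕ}
    (h : f =O[𝓝 0] fun x => ‖x‖ ^ (r + 1)) (v : E) :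
    (fun x => fderiv ℂ f x v) =O[𝓝 0] fun x => ‖x‖ ^ r := by
  obtain ⟨C, hC⟩ := h.bound
  have hgood : ∀ᶠ x in 𝓝 (0 : E), ‖f x‖ ≤ C * ‖x‖ ^ (r + 1) ∧ DifferentiableAt ℂ f x := by
    filter_upwards [hC, hf.eventually_analyticAt] with x h1 h2
    exact ⟨by simpa using h1, h2.differentiableAt⟩
  obtain ⟨R, hR, hball⟩ := Metric.eventually_nhds_iff_ball.1 hgood
  by_cases hr : r = 0
  · subst hr
    simp only [pow_zero]
    exact (analyticAt_fderiv_apply hf v).continuousAt.isBigO_one ℝ |>.trans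
      (Asymptotics.isBigO_refl _ _)
  refine Asymptotics.IsBigO.of_bound (C * (1 + ‖v‖) ^ (r + 1)) ?_
  have hpos : 0 < R / (1 + ‖v‖) := by positivity
  filter_upwards [Metric.ball_mem_nhds (0 : E) hpos] with x hx
  have hx : ‖x‖ * (1 + ‖v‖) < R := by
    rw [mem_ball_zero_iff] at hx
    rwa [lt_div_iff₀ (by positivity)] at hx
  rw [norm_pow, norm_norm]
  rcases eq_or_ne x 0 with rfl | hx0
  · have h0 : HasFDerivAt f (0 : E →L[ℂ] F) 0 := by
      apply Asymptotics.IsBigO.hasFDerivAt (n := r + 1) (x₀ := 0) _ (by lia)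
      simpa using h
    rw [h0.fderiv]
    simp [hr]
  have hxp : 0 < ‖x‖ := norm_pos_iff.2 hx0
  have hnorm : ∀ ζ : ℂ, ‖ζ‖ ≤ ‖x‖ → ‖x + ζ • v‖ ≤ ‖x‖ * (1 + ‖v‖) := by
    intro ζ hζ
    calc ‖x + ζ • v‖ ≤ ‖x‖ + ‖ζ‖ * ‖v‖ := (norm_add_le _ _).trans (by rw [norm_smul])
      _ ≤ ‖x‖ + ‖x‖ * ‖v‖ := by gcongr
      _ = _ := by ring
  have hline : ∀ ζ : ℂ, HasFDerivAt (fun ζ : ℂ => x + ζ • v)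
      ((ContinuousLinearMap.id ℂ ℂ).smulRight v) ζ := fun ζ =>
    ((hasFDerivAt_id ζ).smul_const v).const_add x
  have hdiff : ∀ ζ : ℂ, ‖ζ‖ ≤ ‖x‖ → HasDerivAt (fun ζ : ℂ => f (x + ζ • v))
      (fderiv ℂ f (x + ζ • v) v) ζ := by
    intro ζ hζ
    have h1 := (hball (x + ζ • v) (by
      rw [mem_ball_zero_iff]; exact (hnorm ζ hζ).trans_lt hx)).2.hasFDerivAt
    have := (h1.comp ζ (hline ζ)).hasDerivAt
    simpa [Function.comp_def] using this
  have hd : DiffContOnCl ℂ (fun ζ : ℂ => f (x + ζ • v)) (Metric.ball 0 ‖x‖) := by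
    apply DifferentiableOn.diffContOnCl
    intro ζ hζ
    refine (hdiff ζ ?_).differentiableAt.differentiableWithinAt
    have := Metric.closure_ball_subset_closedBall hζ
    simpa using this
  have hC0 : 0 ≤ C := by
    have h1 := (hball x (by
      rw [mem_ball_zero_iff]; nlinarith [norm_nonneg v, mul_nonneg hxp.le (norm_nonneg v)])).1
    by_contra hneg
    push Not at hneg
    have : C * ‖x‖ ^ (r + 1) < 0 := mul_neg_of_neg_of_pos hneg (by positivity)
    linarith [norm_nonneg (f x)]
  have key := Complex.norm_deriv_le_of_forall_mem_sphere_norm_le (c := 0) (R := ‖x‖)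
    (C := C * (‖x‖ * (1 + ‖v‖)) ^ (r + 1)) hxp hd (by
      intro ζ hζ
      have hζ : ‖ζ‖ ≤ ‖x‖ := by simpa using (Metric.sphere_subset_closedBall hζ)
      refine (hball (x + ζ • v) (by
        rw [mem_ball_zero_iff]; exact (hnorm ζ hζ).trans_lt hx)).1.trans ?_
      gcongr
      exact hnorm ζ hζ)
  rw [(hdiff 0 (by simp)).deriv] at key
  simp only [zero_smul, add_zero] at key
  refine key.trans (le_of_eq ?_)
  rw [mul_pow, pow_succ ‖x‖ r]
  field_simp

theorem isBigO_iterDir {f : E → F} (hf : AnalyticAt ℂ f 0) (l : List E) {r : ℕ}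
    (h : f =O[𝓝 0] fun x => ‖x‖ ^ (r + l.length)) :
    iterDir l f =O[𝓝 0] fun x => ‖x‖ ^ r := by
  induction l generalizing r with
  | nil => exact h
  | cons v l ih =>
    refine isBigO_fderiv_apply (analyticAt_iterDir hf l) (ih ?_) v
    rwa [show r + 1 + l.length = r + (v :: l).length by simp; ring]

theorem iterDir_eq_zero_of_isBigO {f : E → F} (hf : AnalyticAt ℂ f 0) (l : List E) {r : ℕ}
    (h : f =O[𝓝 0] fun x => ‖x‖ ^ r) (hl : l.length < r) : iterDir l f 0 = 0 := by
  obtain ⟨s, rfl⟩ := Nat.exists_eq_add_of_lt hl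
  have h1 := isBigO_iterDir (r := s + 1) hf l (by rwa [show s + 1 + l.length = l.length + s + 1 by ring])
  obtain ⟨C, hC⟩ := h1.bound
  simpa using hC.self_of_nhds

/-- The mean value inequality on the segment from `0` to `x`. -/
theorem isBigO_of_fderiv {f : E → F} (hf : AnalyticAt ℂ f 0) (h0 : f 0 = 0) {r : ℕ}
    (h : fderiv ℂ f =O[𝓝 0] fun x => ‖x‖ ^ r) : f =O[𝓝 0] fun x => ‖x‖ ^ (r + 1) := by
  obtain ⟨C, hCp, hC⟩ := h.exists_pos
  have hC := hC.bound
  have hgood : ∀ᶠ x in 𝓝 (0 : E), ‖fderiv ℂ f x‖ ≤ C * ‖x‖ ^ r ∧ DifferentiableAt ℂ f x := by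
    filter_upwards [hC, hf.eventually_analyticAt] with x h1 h2
    exact ⟨by simpa using h1, h2.differentiableAt⟩
  obtain ⟨R, hR, hball⟩ := Metric.eventually_nhds_iff_ball.1 hgood
  refine Asymptotics.IsBigO.of_bound C ?_
  filter_upwards [Metric.ball_mem_nhds (0 : E) hR] with x hx
  have hseg : ∀ y ∈ segment ℝ 0 x, ‖y‖ ≤ ‖x‖ := by
    intro y hy
    have := (convex_closedBall (0 : E) ‖x‖).segment_subset (by simp) (by simp) hy
    simpa using this
  have hsub : ∀ y ∈ segment ℝ 0 x, y ∈ Metric.ball (0 : E) R := by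
    intro y hy
    rw [mem_ball_zero_iff] at hx ⊢
    exact (hseg y hy).trans_lt hx
  have key := Convex.norm_image_sub_le_of_norm_fderiv_le (𝕜 := ℂ) (f := f) (C := C * ‖x‖ ^ r)
    (s := segment ℝ 0 x) (x := 0) (y := x)
    (fun y hy => (hball y (hsub y hy)).2)
    (fun y hy => (hball y (hsub y hy)).1.trans (by gcongr; exact hseg y hy))
    (convex_segment 0 x) (left_mem_segment ℝ 0 x) (right_mem_segment ℝ 0 x)
  rw [h0, sub_zero, sub_zero] at key
  simpa [pow_succ, mul_assoc] using key

theorem isBigO_fderiv_of_basis {ι : Type*} [Fintype ι] (b : Module.Basis ι ℂ E) {f : E → F}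
    {r : ℕ} (h : ∀ i, (fun x => fderiv ℂ f x (b i)) =O[𝓝 0] fun x => ‖x‖ ^ r) :
    fderiv ℂ f =O[𝓝 0] fun x => ‖x‖ ^ r := by
  have : FiniteDimensional ℂ E := b.finiteDimensional_of_finite
  have hfd : fderiv ℂ f = fun x => ∑ i, (LinearMap.toContinuousLinearMap (b.coord i)).smulRight
      (fderiv ℂ f x (b i)) := by
    funext x
    ext v
    have h1 : fderiv ℂ f x v = fderiv ℂ f x (∑ i, b.repr v i • b i) := by rw [b.sum_repr v]
    rw [h1, map_sum]
    simp [-Module.Basis.sum_repr]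
  rw [hfd]
  refine Asymptotics.IsBigO.fun_sum fun i _ => ?_
  refine Asymptotics.IsBigO.trans ?_ (h i)
  refine Asymptotics.IsBigO.of_bound ‖LinearMap.toContinuousLinearMap (b.coord i)‖ ?_
  exact Filter.Eventually.of_forall fun x => by
    rw [ContinuousLinearMap.norm_smulRight_apply]

theorem isBigO_of_iterDir_eq_zero {ι : Type*} [Finite ι] (b : Module.Basis ι ℂ E) (k : ℕ)
    {f : E → F} (hf : AnalyticAt ℂ f 0)
    (h : ∀ l : List ι, l.length ≤ k → iterDir (l.map b) f 0 = 0) :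
    f =O[𝓝 0] fun x => ‖x‖ ^ (k + 1) := by
  cases nonempty_fintype ι
  induction k generalizing f with
  | zero =>
    refine isBigO_of_fderiv hf (h [] le_rfl) ?_
    simp only [pow_zero]
    exact hf.fderiv.continuousAt.isBigO_one ℝ
  | succ k ih =>
    refine isBigO_of_fderiv hf (h [] (by simp)) (isBigO_fderiv_of_basis b fun i => ?_)
    refine ih (analyticAt_fderiv_apply hf (b i)) ?_
    intro l hl
    -- The last entry of the list acts first, so appending `i` differentiates `f` along `b i` before
    -- the derivatives in `l`.
    have := h (l ++ [i]) (by simpa using hl)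
    rwa [List.map_append, iterDir_append] at this

end IteratedDirectional

/-! ### Jet spaces and bilinear pairings of jets. -/

section Jets

variable {N n : ℕ}

theorem jetSpan_le_iff {φ : (Fin n → ℂ) → Vec N} (hφ : AnalyticAt ℂ φ 0) {k : ℕ}
    {W : Submodule ℂ (Vec N)} : jetSpan φ k ≤ W ↔ ∀ l : List (Fin n), l.length ≤ k →
      iterDir (l.map (Pi.basisFun ℂ (Fin n))) φ 0 ∈ W := by
  rw [jetSpan, Submodule.span_le]
  constructor
  · intro h l hl
    refine h ⟨l.length, hl, l.get, ?_⟩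
    rw [iteratedFDeriv_eq_iterDir hφ]
    congr 1
    conv_lhs => rw [← List.ofFn_get l, List.map_ofFn]
    congr 1
    funext i
    simp
  · rintro h _ ⟨m, hm, j, rfl⟩
    rw [iteratedFDeriv_eq_iterDir hφ]
    have := h (List.ofFn j) (by simpa using hm)
    rw [List.map_ofFn] at this
    have h2 : (Pi.basisFun ℂ (Fin n) : Fin n → Fin n → ℂ) ∘ j = fun i => Pi.single (j i) 1 := by
      funext i
      simp
    rwa [h2] at this

theorem iterDir_clm_comp_apply (L : Vec N →L[ℂ] ℂ) {φ : (Fin n → ℂ) → Vec N}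
    (hφ : AnalyticAt ℂ φ 0) (l : List (Fin n → ℂ)) :
    iterDir l (fun t => L (φ t)) 0 = L (iterDir l φ 0) :=
  (iterDir_clm_comp L hφ l).self_of_nhds

theorem analyticAt_clm_comp (L : Vec N →L[ℂ] ℂ) {φ : (Fin n → ℂ) → Vec N} {τ : Fin n → ℂ}
    (hφ : AnalyticAt ℂ φ τ) : AnalyticAt ℂ (fun t => L (φ t)) τ :=
  (L.analyticAt _).comp hφ

/-- The dual description of the jet space by contact order. It depends neither on coordinates nor on
a basis, and so gives invariance under reparametrization and rescaling. -/
theorem jetSpan_le_ker_iff {φ : (Fin n → ℂ) → Vec N} (hφ : AnalyticAt ℂ φ 0) {k : ℕ}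
    (L : Vec N →L[ℂ] ℂ) : (∀ w ∈ jetSpan φ k, L w = 0) ↔
      (fun t => L (φ t)) =O[𝓝 0] fun t => ‖t‖ ^ (k + 1) := by
  have hL := analyticAt_clm_comp L hφ
  constructor
  · intro h
    refine isBigO_of_iterDir_eq_zero (Pi.basisFun ℂ (Fin n)) k hL fun l hl => ?_
    rw [iterDir_clm_comp_apply L hφ]
    exact h _ ((jetSpan_le_iff hφ).1 le_rfl l hl)
  · intro h
    have : jetSpan φ k ≤ LinearMap.ker (L : Vec N →ₗ[ℂ] ℂ) := by
      refine (jetSpan_le_iff hφ).2 fun l hl => ?_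
      rw [LinearMap.mem_ker]
      change L _ = 0
      rw [← iterDir_clm_comp_apply L hφ]
      exact iterDir_eq_zero_of_isBigO hL _ h (by simpa using Nat.lt_succ_of_le hl)
    exact fun w hw => this hw

theorem le_of_forall_clm {W W' : Submodule ℂ (Vec N)}
    (h : ∀ L : Vec N →L[ℂ] ℂ, (∀ w ∈ W', L w = 0) → ∀ w ∈ W, L w = 0) : W ≤ W' := by
  intro w hw
  by_contra hw'
  obtain ⟨f, hf, hle⟩ := Submodule.exists_le_ker_of_notMem hw'
  exact hf (h (LinearMap.toContinuousLinearMap f) (fun x hx => hle hx) w hw)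

theorem iterDir_mem_jetSpan {φ : (Fin n → ℂ) → Vec N} (hφ : AnalyticAt ℂ φ 0) {k : ℕ}
    (l : List (Fin n → ℂ)) (hl : l.length ≤ k) : iterDir l φ 0 ∈ jetSpan φ k := by
  rw [← Submodule.span_singleton_le_iff_mem]
  refine le_of_forall_clm fun L hL w hw => ?_
  obtain ⟨c, rfl⟩ := Submodule.mem_span_singleton.1 hw
  rw [map_smul, ← iterDir_clm_comp_apply L hφ, iterDir_eq_zero_of_isBigO
    (analyticAt_clm_comp L hφ) l ((jetSpan_le_ker_iff hφ L).1 hL) (Nat.lt_succ_of_le hl), smul_zero]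

theorem analyticAt_comp_add_left {φ : (Fin n → ℂ) → Vec N} {τ : Fin n → ℂ}
    (hφ : AnalyticAt ℂ φ τ) : AnalyticAt ℂ (fun t => φ (τ + t)) 0 := by
  have h1 : AnalyticAt ℂ (fun t : Fin n → ℂ => τ + t) 0 := analyticAt_const.add analyticAt_id
  exact AnalyticAt.comp (g := φ) (by simpa using hφ) h1

/-- Pairing of the jets of two maps from the order of vanishing of the pairing of the maps. -/
theorem apply_iterDir_eq_zero_of_isBigO {E E' F F' : Type*}
    [NormedAddCommGroup E] [NormedSpace ℂ E] [NormedAddCommGroup E'] [NormedSpace ℂ E']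
    [NormedAddCommGroup F] [NormedSpace ℂ F] [CompleteSpace F]
    [NormedAddCommGroup F'] [NormedSpace ℂ F'] [CompleteSpace F']
    (B : F →L[ℂ] F' →L[ℂ] ℂ) {φ : E → F} {ψ : E' → F'} (hφ : AnalyticAt ℂ φ 0)
    (hψ : AnalyticAt ℂ ψ 0) {r : ℕ}
    (h : (fun p : E × E' => B (φ p.1) (ψ p.2)) =O[𝓝 0] fun p => ‖p‖ ^ r)
    (l : List E) (l' : List E') (hl : l.length + l'.length < r) :
    B (iterDir l φ 0) (iterDir l' ψ 0) = 0 := by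
  have hfst : Filter.Tendsto (Prod.fst : E × E' → E) (𝓝 0) (𝓝 0) := continuous_fst.tendsto 0
  have hsnd : Filter.Tendsto (Prod.snd : E × E' → E') (𝓝 0) (𝓝 0) := continuous_snd.tendsto 0
  have hder : ∀ {f : E → F} {g : E' → F'} {p : E × E'}, DifferentiableAt ℂ f p.1 →
      DifferentiableAt ℂ g p.2 → ∀ v, fderiv ℂ (fun p : E × E' => B (f p.1) (g p.2)) p v =
        B (fderiv ℂ f p.1 v.1) (g p.2) + B (f p.1) (fderiv ℂ g p.2 v.2) := by
    intro f g p hf hg v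
    have h1 : HasFDerivAt (fun p : E × E' => f p.1) _ p := hf.hasFDerivAt.comp p hasFDerivAt_fst
    have h2 : HasFDerivAt (fun p : E × E' => g p.2) _ p := hg.hasFDerivAt.comp p hasFDerivAt_snd
    rw [(B.hasFDerivAt_of_bilinear h1 h2).fderiv]
    simp [add_comm]
  -- The derivatives in `l` are taken in the first variable and those in `l'` in the second;
  -- bilinearity lets them act on `φ` and `ψ` separately.
  have key : iterDir (l.map (fun v => (v, (0 : E'))) ++ l'.map (fun v => ((0 : E), v)))
      (fun p : E × E' => B (φ p.1) (ψ p.2)) =ᶠ[𝓝 0]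
        fun p => B (iterDir l φ p.1) (iterDir l' ψ p.2) := by
    induction l with
    | nil =>
      rw [List.map_nil, List.nil_append]
      clear hl
      induction l' with
      | nil => exact Filter.EventuallyEq.rfl
      | cons v l' ih =>
        filter_upwards [ih.eventuallyEq_nhds, hfst.eventually hφ.eventually_analyticAt,
          hsnd.eventually (analyticAt_iterDir hψ l').eventually_analyticAt] with p h1 h2 h3
        rw [List.map_cons, iterDir_cons]
        beta_reduce
        rw [h1.fderiv_eq, hder (by exact h2.differentiableAt) h3.differentiableAt]
        simp [iterDir]
    | cons v l ih =>
      filter_upwards [(ih (by simp at hl; lia)).eventuallyEq_nhds,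
        hfst.eventually (analyticAt_iterDir hφ l).eventually_analyticAt,
        hsnd.eventually (analyticAt_iterDir hψ l').eventually_analyticAt] with p h1 h2 h3
      rw [List.map_cons, List.cons_append, iterDir_cons]
      beta_reduce
      rw [h1.fderiv_eq, hder h2.differentiableAt h3.differentiableAt]
      simp [iterDir]
  have han : AnalyticAt ℂ (fun p : E × E' => B (φ p.1) (ψ p.2)) 0 := by
    have h1 : AnalyticAt ℂ (fun p : E × E' => φ p.1) 0 :=
      AnalyticAt.comp (g := φ) (f := Prod.fst) hφ analyticAt_fst
    have h2 : AnalyticAt ℂ (fun p : E × E' => ψ p.2) 0 :=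
      AnalyticAt.comp (g := ψ) (f := Prod.snd) hψ analyticAt_snd
    exact AnalyticAt.comp (g := fun p : F × F' => B p.1 p.2) (f := fun p : E × E' => (φ p.1, ψ p.2))
      (B.analyticAt_bilinear _) (h1.prod h2)
  rw [← show _ = B (iterDir l φ 0) (iterDir l' ψ 0) from key.self_of_nhds]
  exact iterDir_eq_zero_of_isBigO han _ h (by simpa using hl)

/-- A curve whose jets of order at most `k` are isotropic for a symmetric bilinear form pairs with
each of its points to order `2 * k + 2`. -/
theorem isBigO_pairing_curve (B : Vec N →L[ℂ] Vec N →L[ℂ] ℂ) (hB : ∀ x y, B x y = B y x)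
    {γ : ℂ → Vec N} (hγ : AnalyticAt ℂ γ 0) {k : ℕ}
    (h : ∀ i ≤ k, ∀ j ≤ k, ∀ᶠ ε in 𝓝 (0 : ℂ),
      B (iterDir (List.replicate i 1) γ ε) (iterDir (List.replicate j 1) γ ε) = 0) :
    (fun ε => B (γ ε) (γ 0)) =O[𝓝 0] fun ε => ‖ε‖ ^ (2 * k + 2) := by
  set D : ℕ → ℂ → Vec N := fun i => iterDir (List.replicate i 1) γ with hD
  have hDan : ∀ i, AnalyticAt ℂ (D i) 0 := fun i => analyticAt_iterDir hγ _
  have hstep : ∀ i j, (∀ᶠ ε in 𝓝 (0 : ℂ), B (D i ε) (D j ε) = 0) →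
      ∀ᶠ ε in 𝓝 (0 : ℂ), B (D (i + 1) ε) (D j ε) + B (D i ε) (D (j + 1) ε) = 0 := by
    intro i j hij
    filter_upwards [hij.eventually_nhds, (hDan i).eventually_analyticAt,
      (hDan j).eventually_analyticAt] with ε h1 h2 h3
    have h4 := (B.hasFDerivAt_of_bilinear h2.differentiableAt.hasFDerivAt
      h3.differentiableAt.hasFDerivAt).fderiv
    have h5 : (fun y => B (D i y) (D j y)) =ᶠ[𝓝 ε] fun _ => (0 : ℂ) := h1
    rw [h5.fderiv_eq, fderiv_fun_const] at h4
    have h6 := congrArg (fun L : ℂ →L[ℂ] ℂ => L 1) h4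
    simp only [Pi.zero_apply, _root_.zero_apply, _root_.add_apply] at h6
    rw [h6, add_comm]
    rfl
  -- Orders are moved from the first slot to the second by differentiating identities already known.
  -- If `i < k`, the other term of the product rule vanishes by induction. The only remaining case
  -- is `i = j = k`, where the two terms agree by symmetry and their sum is zero; this gives the
  -- order `2k + 1`.
  have hall : ∀ j, ∀ i, i ≤ k → i + j ≤ 2 * k + 1 → ∀ᶠ ε in 𝓝 (0 : ℂ), B (D i ε) (D j ε) = 0 := by
    intro j
    induction j with
    | zero => exact fun i hi _ => h i hi 0 (Nat.zero_le _)
    | succ j ih =>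
      intro i hi hij
      by_cases hj : j + 1 ≤ k
      · exact h i hi _ hj
      have h1 := hstep i j (ih i hi (by lia))
      by_cases hik : i < k
      · filter_upwards [h1, ih (i + 1) hik (by lia)] with ε h2 h3
        rwa [h3, zero_add] at h2
      · obtain rfl : i = k := by lia
        obtain rfl : j = i := by lia
        filter_upwards [h1] with ε h2
        rw [hB (D (j + 1) ε)] at h2
        exact self_eq_neg.1 (eq_neg_of_add_eq_zero_left h2)
  have han : AnalyticAt ℂ (fun ε => B.flip (γ 0) (γ ε)) 0 := ((B.flip (γ 0)).analyticAt _).comp hγ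
  refine isBigO_of_iterDir_eq_zero (Module.Basis.singleton Unit ℂ) (2 * k + 1)
    (f := fun ε => B.flip (γ 0) (γ ε)) han fun l hl => ?_
  have hrep : l.map (Module.Basis.singleton Unit ℂ) = List.replicate l.length 1 := by
    rw [List.eq_replicate_iff]
    simp
  rw [hrep, (iterDir_clm_comp (B.flip (γ 0)) hγ _).self_of_nhds]
  have := (hall l.length 0 (Nat.zero_le _) (by lia)).self_of_nhds
  rw [hB] at this
  exact this

theorem isBigO_pairing_of_jetSpan (B : Vec N →L[ℂ] Vec N →L[ℂ] ℂ) (hB : ∀ x y, B x y = B y x)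
    {φ : (Fin n → ℂ) → Vec N} {τ : Fin n → ℂ} (hφ : AnalyticAt ℂ φ τ) {k : ℕ}
    (h : ∀ᶠ τ' in 𝓝 τ, ∀ x ∈ jetSpan (fun t => φ (τ' + t)) k,
      ∀ y ∈ jetSpan (fun t => φ (τ' + t)) k, B x y = 0) (w : Fin n → ℂ) :
    (fun ε : ℂ => B (φ (τ + ε • w)) (φ τ)) =O[𝓝 0] fun ε => ‖ε‖ ^ (2 * k + 2) := by
  have hline : AnalyticAt ℂ (fun ε : ℂ => τ + ε • w) 0 :=
    analyticAt_const.add (analyticAt_id.smul analyticAt_const)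
  have hγ : AnalyticAt ℂ (fun ε : ℂ => φ (τ + ε • w)) 0 :=
    AnalyticAt.comp (g := φ) (by simpa using hφ) hline
  have hc : Filter.Tendsto (fun ε : ℂ => τ + ε • w) (𝓝 0) (𝓝 τ) := by
    simpa [ContinuousAt] using hline.continuousAt
  have := isBigO_pairing_curve B hB hγ (k := k) ?_
  · simpa using this
  intro i hi j hj
  filter_upwards [iterDir_comp_line τ w hφ i, iterDir_comp_line τ w hφ j, hc.eventually h,
    hc.eventually hφ.eventually_analyticAt] with ε h1 h2 h3 h4
  rw [h1, h2]
  have hmem : ∀ i ≤ k, iterDir (List.replicate i w) φ (τ + ε • w) ∈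
      jetSpan (fun t => φ (τ + ε • w + t)) k := by
    intro i hi
    have := iterDir_mem_jetSpan (analyticAt_comp_add_left h4) (List.replicate i w)
      (by simpa using hi)
    rw [iterDir_comp_add_left] at this
    simpa using this
  exact h3 _ (hmem i hi) _ (hmem j hj)

end Jets

/-! ### Scale-invariant left inverses of immersions into projective space. -/

section Retraction

variable {N n : ℕ}

/-- A local left inverse, invariant under scalars, of a lifting of an immersion into `ℙV`. -/
theorem exists_retraction {φ : (Fin n → ℂ) → Vec N} (hφ : AnalyticAt ℂ φ 0) (h0 : φ 0 ≠ 0)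
    (him : ∀ w, fderiv ℂ φ 0 w ∈ Submodule.span ℂ {φ 0} → w = 0) :
    ∃ ρ : Vec N → Fin n → ℂ, ContDiffAt ℂ 1 ρ (φ 0) ∧ (∀ c : ℂ, c ≠ 0 → ∀ v, ρ (c • v) = ρ v) ∧
      ∀ᶠ t in 𝓝 0, ρ (φ t) = t := by
  obtain ⟨j, hj⟩ : ∃ j, φ 0 j ≠ 0 := by
    by_contra! h
    exact h0 (funext h)
  set D := fderiv ℂ φ 0
  have hD : HasFDerivAt φ D 0 := hφ.differentiableAt.hasFDerivAt
  set π : Vec N → Vec N := fun v => (v j)⁻¹ • v with hπ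
  have hπc : ContDiffAt ℂ 1 π (φ 0) := by
    have h1 : ContDiffAt ℂ 1 (fun v : Vec N => v j) (φ 0) := by fun_prop
    exact (h1.inv hj).smul contDiffAt_id
  have hyc : ContDiffAt ℂ 1 (fun t => π (φ t)) 0 := hπc.comp 0 hφ.contDiffAt
  set Dy := fderiv ℂ (fun t => π (φ t)) 0 with hDy
  have hyd : HasFDerivAt (fun t => π (φ t)) Dy 0 :=
    (hyc.differentiableAt one_ne_zero).hasFDerivAt
  -- Since `φ = φ_j · (π ∘ φ)`, a direction killed by the derivative of `π ∘ φ` is sent by that of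
  -- `φ` into the line of `φ 0`, and the immersion hypothesis applies.
  have hinj : ∀ w, Dy w = 0 → w = 0 := by
    intro w hw
    apply him
    have h1 : HasFDerivAt (fun t => φ t j) ((ContinuousLinearMap.proj j).comp D) 0 :=
      (ContinuousLinearMap.proj (R := ℂ) (φ := fun _ : Fin (N + 1) => ℂ) j).hasFDerivAt.comp 0 hD
    have h2 : HasFDerivAt (fun t => φ t j • π (φ t)) _ 0 := h1.smul hyd
    have hev : (fun t => φ t j • π (φ t)) =ᶠ[𝓝 0] φ := by
      filter_upwards [h1.continuousAt.eventually_ne hj] with t ht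
      simp [hπ, smul_smul, mul_inv_cancel₀ ht]
    have h3 := (h2.congr_of_eventuallyEq hev.symm).unique hD
    rw [← h3]
    simp only [_root_.add_apply, _root_.smul_apply, hw, smul_zero, zero_add]
    simp only [hπ, ContinuousLinearMap.smulRight_apply]
    exact Submodule.smul_mem _ _ (Submodule.smul_mem _ _ (Submodule.mem_span_singleton_self _))
  obtain ⟨L, hL⟩ := LinearMap.exists_leftInverse_of_injective (Dy : (Fin n → ℂ) →ₗ[ℂ] Vec N)
    (LinearMap.ker_eq_bot'.2 hinj)
  set L' := LinearMap.toContinuousLinearMap L with hL'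
  have hfc : ContDiffAt ℂ 1 (fun t => L' (π (φ t))) 0 := L'.contDiff.contDiffAt.comp 0 hyc
  have hfd : HasFDerivAt (fun t => L' (π (φ t)))
      ((ContinuousLinearEquiv.refl ℂ (Fin n → ℂ) : (Fin n → ℂ) →L[ℂ] (Fin n → ℂ))) 0 := by
    have h1 : HasFDerivAt (fun t => L' (π (φ t))) (L'.comp Dy) 0 := L'.hasFDerivAt.comp 0 hyd
    convert h1 using 1
    ext w : 1
    exact (LinearMap.congr_fun hL w).symm
  set g := hfc.localInverse hfd one_ne_zero with hg
  have hgc : ContDiffAt ℂ 1 g (L' (π (φ 0))) := hfc.to_localInverse hfd one_ne_zero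
  refine ⟨fun v => g (L' (π v)), ?_, ?_, ?_⟩
  · exact ContDiffAt.comp (φ 0) (g := g) (f := fun v => L' (π v)) hgc
      (L'.contDiff.contDiffAt.comp _ hπc)
  · intro c hc v
    have : π (c • v) = π v := by
      simp only [hπ, Pi.smul_apply, smul_eq_mul, smul_smul, mul_inv]
      congr 1
      field_simp
    simp only [this]
  · exact (hfc.hasStrictFDerivAt' hfd one_ne_zero).eventually_left_inverse

end Retraction

/-! ### Local parametrizations: translation, independence of the jet space, semicontinuity. -/

section Lifts

variable {N : ℕ} {X : Set (PSpace N)} {z : PSpace N} {φ : (Fin (projDim X) → ℂ) → Vec N}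

theorem IsLocalLift.tendsto_nhdsWithin (hφ : IsLocalLift X z φ) :
    Filter.Tendsto φ (𝓝 0) (𝓝[cone X] (φ 0)) :=
  tendsto_nhdsWithin_iff.2 ⟨hφ.analyticAt.continuousAt, hφ.mem_cone⟩

/-- A lifting of a local parametrization has a retraction that inverts it up to scalars. -/
theorem IsLocalLift.exists_retraction (hφ : IsLocalLift X z φ) :
    ∃ ρ : Vec N → Fin (projDim X) → ℂ, ContDiffAt ℂ 1 ρ (φ 0) ∧
      (∀ᶠ t in 𝓝 0, ρ (φ t) = t) ∧ ∀ᶠ v in 𝓝[cone X] (φ 0), ∃ c : ℂ, c ≠ 0 ∧ v = c • φ (ρ v) := by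
  obtain ⟨ρ, h1, h2, h3⟩ := OscSec.exists_retraction hφ.analyticAt hφ.base_ne_zero hφ.immersion
  refine ⟨ρ, h1, h3, ?_⟩
  have hne : ∀ᶠ v in 𝓝[cone X] (φ 0), v ≠ 0 :=
    eventually_nhdsWithin_of_eventually_nhds (eventually_ne_nhds hφ.base_ne_zero)
  -- The parameter supplied by `onto` is taken where `ρ` inverts `φ`, so it equals `ρ v` by scale
  -- invariance.
  filter_upwards [hφ.onto _ h3, hne] with v ⟨t, ht, c, hv⟩ hv0
  have ht : ρ (φ t) = t := ht
  have hc : c ≠ 0 := by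
    rintro rfl
    exact hv0 (by rw [hv, zero_smul])
  refine ⟨c, hc, ?_⟩
  rw [hv, h2 c hc, ht]

theorem mem_cone_iff_mk {v : Vec N} (hv : v ≠ 0) :
    v ∈ cone X ↔ Projectivization.mk ℂ v hv ∈ X := by
  constructor
  · rintro ⟨z, hz, hvz⟩
    have : Projectivization.mk ℂ v hv = z := by
      rw [← Projectivization.mk_rep z, Projectivization.mk_eq_mk_iff']
      rw [Projectivization.submodule_eq] at hvz
      obtain ⟨c, hc⟩ := Submodule.mem_span_singleton.1 hvz
      exact ⟨c, hc⟩
    rwa [this]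
  · intro h
    refine ⟨_, h, ?_⟩
    rw [Projectivization.submodule_mk]
    exact Submodule.mem_span_singleton_self v

theorem mk_eq_of_mem {v : Vec N} (hv : v ≠ 0) (hz : v ∈ z.submodule) :
    Projectivization.mk ℂ v hv = z := by
  rw [← Projectivization.mk_rep z, Projectivization.mk_eq_mk_iff']
  rw [Projectivization.submodule_eq] at hz
  exact Submodule.mem_span_singleton.1 hz

/-- A local parametrization is a local parametrization at all nearby points. -/
theorem IsLocalLift.eventually_translate (hφ : IsLocalLift X z φ) :
    ∀ᶠ τ in 𝓝 0, ∃ h : φ τ ≠ 0, IsLocalLift X (Projectivization.mk ℂ (φ τ) h)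
      fun t => φ (τ + t) := by
  obtain ⟨ρ, hρ, hρφ, hon⟩ := hφ.exists_retraction
  have hρc : ∀ᶠ v in 𝓝 (φ 0), DifferentiableAt ℂ ρ v := by
    filter_upwards [hρ.eventually (by simp)] with v hv using hv.differentiableAt one_ne_zero
  have htend := hφ.analyticAt.continuousAt
  have himm : ∀ᶠ τ in 𝓝 0, ∀ w, fderiv ℂ φ τ w ∈ Submodule.span ℂ {φ τ} → w = 0 := by
    have hF : ContinuousAt (fun τ => (Fin.cons (φ τ) (fun i => fderiv ℂ φ τ (Pi.single i 1)) :
        Fin (projDim X + 1) → Vec N)) 0 := by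
      rw [continuousAt_pi]
      intro i
      refine Fin.cases ?_ (fun i => ?_) i
      · exact htend
      · simp only [Fin.cons_succ]
        exact (analyticAt_fderiv_apply hφ.analyticAt _).continuousAt
    have hsum : ∀ τ w, fderiv ℂ φ τ w = ∑ i, w i • fderiv ℂ φ τ (Pi.single i 1) := by
      intro τ w
      conv_lhs => rw [pi_eq_sum_univ' w]
      simp [map_sum]
    -- Being an immersion into projective space means that the value and the partial derivatives are
    -- linearly independent, which is an open condition.
    have hiff : ∀ τ, LinearIndependent ℂ (Fin.cons (φ τ)
        (fun i => fderiv ℂ φ τ (Pi.single i 1)) : Fin (projDim X + 1) → Vec N) ↔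
        φ τ ≠ 0 ∧ ∀ w, fderiv ℂ φ τ w ∈ Submodule.span ℂ {φ τ} → w = 0 := by
      intro τ
      constructor
      · intro h
        refine ⟨by simpa using h.ne_zero 0, fun w hw => ?_⟩
        obtain ⟨c, hc⟩ := Submodule.mem_span_singleton.1 hw
        have h1 := Fintype.linearIndependent_iff.1 h (Fin.cons (-c) w) (by
          rw [Fin.sum_univ_succ]
          simp only [Fin.cons_zero, Fin.cons_succ]
          rw [← hsum, ← hc]
          simp)
        funext i
        simpa using h1 i.succ
      · rintro ⟨h0, h1⟩
        rw [Fintype.linearIndependent_iff]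
        intro g hg
        rw [Fin.sum_univ_succ] at hg
        simp only [Fin.cons_zero, Fin.cons_succ] at hg
        have h2 : fderiv ℂ φ τ (fun i => g i.succ) = - g 0 • φ τ := by
          rw [hsum, neg_smul]
          exact eq_neg_of_add_eq_zero_right hg
        have h3 := h1 (fun i => g i.succ) (by
          rw [h2]; exact Submodule.smul_mem _ _ (Submodule.mem_span_singleton_self _))
        rw [h3, map_zero] at h2
        have h4 : g 0 = 0 := by
          have := (smul_eq_zero.1 h2.symm).resolve_right h0
          simpa using this
        intro i
        refine Fin.cases h4 (fun i => congrFun h3 i) i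
    have hopen := hF.eventually (isOpen_setOfPred_linearIndependent.mem_nhds
      ((hiff 0).2 ⟨hφ.base_ne_zero, hφ.immersion⟩))
    filter_upwards [hopen] with τ hτ using ((hiff τ).1 hτ).2
  filter_upwards [htend.eventually_ne hφ.base_ne_zero, hφ.analyticAt.eventually_analyticAt, himm,
    hφ.mem_cone.eventually_nhds, htend.eventually hρc, hρφ,
    hφ.tendsto_nhdsWithin.eventually (eventually_eventually_nhdsWithin.2 hon)]
    with τ h1 h2 h3 h4 h5 h6 h7
  have hadd : Filter.Tendsto (fun t => τ + t) (𝓝 0) (𝓝 τ) := by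
    simpa using (continuous_const_add τ).tendsto 0
  refine ⟨h1, analyticAt_comp_add_left h2, by simpa using h1, ?_, hadd.eventually h4, ?_, ?_⟩
  · rw [Projectivization.submodule_mk]
    simp
  · intro w hw
    rw [fderiv_comp_add_left] at hw
    simp only [add_zero] at hw
    exact h3 w hw
  · intro W hW
    simp only [add_zero]
    have hsub : Filter.Tendsto (fun v => ρ v - τ) (𝓝[cone X] (φ τ)) (𝓝 0) := by
      have : Filter.Tendsto (fun v => ρ v - τ) (𝓝 (φ τ)) (𝓝 (ρ (φ τ) - τ)) :=
        h5.continuousAt.sub continuousAt_const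
      rw [h6, sub_self] at this
      exact this.mono_left nhdsWithin_le_nhds
    filter_upwards [h7, hsub hW] with v ⟨c, _, hv⟩ hW'
    exact ⟨ρ v - τ, hW', c, by simpa using hv⟩

/-- Up to a bounded scalar, `φ'` is `φ ∘ θ` with `θ 0 = 0` and `θ` differentiable at `0`. So a
functional vanishing to order `k + 1` along `φ` does so along `φ'`. Only boundedness of the scalar
is used, not its regularity. -/
theorem IsLocalLift.jetSpan_le {φ' : (Fin (projDim X) → ℂ) → Vec N} (hφ : IsLocalLift X z φ)
    (hφ' : IsLocalLift X z φ') (k : ℕ) : jetSpan φ' k ≤ jetSpan φ k := by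
  obtain ⟨ρ, hρ, hρφ, hon⟩ := hφ.exists_retraction
  obtain ⟨a, ha⟩ : ∃ a : ℂ, a • φ' 0 = φ 0 := by
    have h1 := (mk_eq_of_mem hφ.base_ne_zero hφ.base_mem).trans
      (mk_eq_of_mem hφ'.base_ne_zero hφ'.base_mem).symm
    rwa [Projectivization.mk_eq_mk_iff'] at h1
  have ha0 : a ≠ 0 := by
    rintro rfl
    exact hφ.base_ne_zero (by rw [← ha, zero_smul])
  have htend : Filter.Tendsto (fun t => a • φ' t) (𝓝 0) (𝓝[cone X] (φ 0)) := by
    refine tendsto_nhdsWithin_iff.2 ⟨?_, ?_⟩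
    · rw [← ha]
      exact hφ'.analyticAt.continuousAt.const_smul a
    · filter_upwards [hφ'.mem_cone] with t ht using smul_mem_cone ht a
  set θ : (Fin (projDim X) → ℂ) → Fin (projDim X) → ℂ := fun t => ρ (a • φ' t) with hθ
  have hθd : DifferentiableAt ℂ θ 0 := by
    have h1 : DifferentiableAt ℂ ρ (a • φ' 0) := by
      rw [ha]
      exact hρ.differentiableAt one_ne_zero
    exact DifferentiableAt.comp (g := ρ) (f := fun t => a • φ' t) 0 h1
      (hφ'.analyticAt.differentiableAt.const_smul a)
  have hθ0 : θ 0 = 0 := by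
    simp only [hθ, ha]
    exact hρφ.self_of_nhds
  have hθO : θ =O[𝓝 0] fun t => ‖t‖ := by
    have := hθd.isBigO_sub
    simpa [hθ0] using this.norm_right
  have hθt : Filter.Tendsto θ (𝓝 0) (𝓝 0) := by
    have := hθd.continuousAt.tendsto
    rwa [hθ0] at this
  refine le_of_forall_clm fun L hL => ?_
  rw [jetSpan_le_ker_iff hφ'.analyticAt]
  have h1 := (jetSpan_le_ker_iff hφ.analyticAt L).1 hL
  have h2 : (fun t => L (φ (θ t))) =O[𝓝 0] fun t => ‖t‖ ^ (k + 1) :=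
    (h1.comp_tendsto hθt).trans (hθO.norm_left.pow (k + 1))
  refine Asymptotics.IsBigO.trans (Asymptotics.IsBigO.of_bound (‖a‖⁻¹ * 4) ?_) h2
  have hp : 0 < ‖φ 0‖ := norm_pos_iff.2 hφ.base_ne_zero
  have hb1 : ∀ᶠ t in 𝓝 0, ‖φ 0‖ / 2 < ‖φ (θ t)‖ := by
    have : Filter.Tendsto (fun t => ‖φ (θ t)‖) (𝓝 0) (𝓝 ‖φ 0‖) :=
      (hφ.analyticAt.continuousAt.norm.tendsto).comp hθt
    exact this.eventually_const_lt (by linarith)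
  have hb2 : ∀ᶠ t in 𝓝 0, ‖a • φ' t‖ < 2 * ‖φ 0‖ := by
    have : Filter.Tendsto (fun t => ‖a • φ' t‖) (𝓝 0) (𝓝 ‖φ 0‖) := by
      have := (tendsto_nhds_of_tendsto_nhdsWithin htend).norm
      exact this
    exact this.eventually_lt_const (by linarith)
  filter_upwards [htend.eventually hon, hb1, hb2] with t ⟨c, hc, hv⟩ h3 h4
  -- The factor relates a vector of norm less than `2 ‖φ 0‖` to one of norm more than `‖φ 0‖ / 2`.
  have h5 : ‖c‖ ≤ 4 := by
    rw [hv, norm_smul] at h4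
    by_contra! h6
    nlinarith [norm_nonneg c]
  have h6 : φ' t = a⁻¹ • c • φ (θ t) := by
    rw [← hv, smul_smul, inv_mul_cancel₀ ha0, one_smul]
  rw [h6, map_smul, map_smul, norm_smul, norm_smul, norm_inv, mul_assoc]
  gcongr

theorem IsLocalLift.oscSpace_eq (hφ : IsLocalLift X z φ) (k : ℕ) :
    oscSpace X k z = jetSpan φ k := by
  refine le_antisymm (iSup₂_le fun φ' hφ' => hφ.jetSpan_le hφ' k) ?_
  exact le_iSup₂_of_le φ hφ le_rfl

/-- Lower semicontinuity of the dimension of the span of jet spaces. -/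
theorem eventually_finrank_iSup_jetSpan_le {n q : ℕ} {φ : Fin q → (Fin n → ℂ) → Vec N}
    (hφ : ∀ i, AnalyticAt ℂ (φ i) 0) (k : ℕ) :
    ∀ᶠ τ in 𝓝 (0 : Fin q → Fin n → ℂ), Module.finrank ℂ (⨆ i, jetSpan (φ i) k : Submodule ℂ (Vec N)) ≤
      Module.finrank ℂ (⨆ i, jetSpan (fun t => φ i (τ i + t)) k : Submodule ℂ (Vec N)) := by
  set b := Pi.basisFun ℂ (Fin n)
  have hgen : (⨆ i, jetSpan (φ i) k : Submodule ℂ (Vec N)) = Submodule.span ℂ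
      (Set.range fun p : {p : Fin q × List (Fin n) // p.2.length ≤ k} =>
        iterDir (p.1.2.map b) (φ p.1.1) 0) := by
    refine le_antisymm (iSup_le fun i => (jetSpan_le_iff (hφ i)).2 fun l hl =>
      Submodule.subset_span ⟨⟨(i, l), hl⟩, rfl⟩) ?_
    rw [Submodule.span_le]
    rintro _ ⟨p, rfl⟩
    exact Submodule.mem_iSup_of_mem p.1.1 ((jetSpan_le_iff (hφ _)).1 le_rfl _ p.2)
  -- A basis is chosen among the generating derivatives. The same derivatives at nearby parameters
  -- stay linearly independent, so the dimension cannot drop.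
  obtain ⟨f, hfmem, -, hfli⟩ := Submodule.exists_fun_fin_finrank_span_eq ℂ
    (Set.range fun p : {p : Fin q × List (Fin n) // p.2.length ≤ k} =>
        iterDir (p.1.2.map b) (φ p.1.1) 0)
  rw [hgen]
  choose p hp using hfmem
  have hF : ContinuousAt (fun (τ : Fin q → Fin n → ℂ) i =>
      iterDir ((p i).1.2.map b) (φ (p i).1.1) (τ (p i).1.1)) 0 := by
    rw [continuousAt_pi]
    intro i
    have h1 : ContinuousAt (fun τ : Fin q → Fin n → ℂ => τ (p i).1.1) 0 :=
      (continuous_apply _).continuousAt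
    exact ContinuousAt.comp (g := iterDir ((p i).1.2.map b) (φ (p i).1.1)) (x := 0)
      (analyticAt_iterDir (hφ _) _).continuousAt h1
  have hopen := hF.eventually ((isOpen_setOfPred_linearIndependent (𝕜 := ℂ)).mem_nhds (by
    rw [Set.mem_ofPred_eq]
    beta_reduce
    have : (fun i => iterDir ((p i).1.2.map b) (φ (p i).1.1) ((0 : Fin q → Fin n → ℂ) (p i).1.1))
      = f := funext hp
    rw [this]
    exact hfli))
  have han : ∀ᶠ τ in 𝓝 (0 : Fin q → Fin n → ℂ), ∀ i, AnalyticAt ℂ (φ i) (τ i) := by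
    rw [Filter.eventually_all]
    intro i
    exact ((continuous_apply i).tendsto (0 : Fin q → Fin n → ℂ)).eventually
      (hφ i).eventually_analyticAt
  filter_upwards [hopen, han] with τ h1 h2
  rw [← Fintype.card_fin (Module.finrank ℂ (Submodule.span ℂ _)), ← finrank_span_eq_card h1]
  refine Submodule.finrank_mono (Submodule.span_le.2 ?_)
  rintro _ ⟨i, rfl⟩
  refine Submodule.mem_iSup_of_mem (p i).1.1 ?_
  have := (jetSpan_le_iff (analyticAt_comp_add_left (h2 (p i).1.1))).1 le_rfl _ (p i).2
  rw [iterDir_comp_add_left] at this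
  simpa using this

end Lifts

/-! ### Tangent spaces of the cone and frames at smooth points. -/

section Tangent

variable {N : ℕ} {X : Set (PSpace N)}

theorem mem_coneTangentSpace_iff {v w : Vec N} :
    w ∈ coneTangentSpace X v ↔ ∀ F ∈ homIdeal X, polyDeriv F v w = 0 := by
  simp only [polyDeriv_apply]
  change (∀ F ∈ homIdeal X, ∑ i, w i * eval v (pderiv i F) = 0) ↔ _
  simp only [mul_comm]

theorem hasDerivAt_eval_add_smul (F : Forms N) (v w : Vec N) :
    HasDerivAt (fun t : ℂ => eval (v + t • w) F) (polyDeriv F v w) 0 := by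
  have h1 : HasDerivAt (fun t : ℂ => v + t • w) w 0 := by
    simpa using ((hasDerivAt_id (0 : ℂ)).smul_const w).const_add v
  have h2 : HasFDerivAt (fun x : Vec N => eval x F) (polyDeriv F v) (v + (0 : ℂ) • w) := by
    rw [zero_smul, add_zero]
    exact (hasStrictFDerivAt_eval F v).hasFDerivAt
  exact h2.comp_hasDerivAt 0 h1

theorem polyDeriv_self_eq_zero {v : Vec N} (hv : v ∈ cone X) {F : Forms N} (hF : F ∈ homIdeal X) :
    polyDeriv F v v = 0 := by
  have h1 := hasDerivAt_eval_add_smul F v v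
  have h2 : (fun t : ℂ => eval (v + t • v) F) = fun _ => 0 := by
    funext t
    have : v + t • v = (1 + t) • v := by rw [add_smul, one_smul]
    rw [this]
    exact mem_homIdeal.1 hF _ (smul_mem_cone hv _)
  rw [h2] at h1
  exact h1.unique (hasDerivAt_const 0 0)

/-- `homIdeal` is defined as a vanishing ideal, with no homogeneity built in. Stability under
substituting `c x` for `x` is the form of homogeneity that is used. -/
theorem exists_mem_homIdeal_eval_smul {F : Forms N} (hF : F ∈ homIdeal X) (c : ℂ) :
    ∃ G ∈ homIdeal X, ∀ x : Vec N, eval x G = eval (c • x) F := by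
  have hev : ∀ x : Vec N, eval x (aeval (fun i => C c * MvPolynomial.X i) F : Forms N) =
      eval (c • x) F := by
    intro x
    have h : (aeval x : Forms N →ₐ[ℂ] ℂ).comp (aeval fun i => C c * MvPolynomial.X i) =
        aeval (c • x) := by
      ext i
      simp
    exact DFunLike.congr_fun h F
  exact ⟨_, mem_homIdeal.2 fun x hx => by
    rw [hev]; exact mem_homIdeal.1 hF _ (smul_mem_cone hx c), hev⟩

theorem mem_cone_of_forall_eval_eq_zero (hX : IsZariskiClosed X) {v : Vec N} (hv : v ≠ 0)
    (h : ∀ F ∈ homIdeal X, eval v F = 0) : v ∈ cone X := by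
  rw [mem_cone_iff_mk hv]
  rw [← show zariskiClosure X = X from hX]
  intro F hF w hw
  rw [Projectivization.submodule_mk] at hw
  obtain ⟨c, rfl⟩ := Submodule.mem_span_singleton.1 hw
  obtain ⟨G, hG, hGF⟩ := exists_mem_homIdeal_eval_smul hF c
  rw [← hGF]
  exact h G hG

theorem coneTangentSpace_smul (v : Vec N) {c : ℂ} (hc : c ≠ 0) :
    coneTangentSpace X (c • v) = coneTangentSpace X v := by
  have key : ∀ (v : Vec N) (c : ℂ), c ≠ 0 → coneTangentSpace X v ≤ coneTangentSpace X (c • v) := by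
    intro v c hc w hw
    rw [mem_coneTangentSpace_iff] at hw ⊢
    intro F hF
    obtain ⟨G, hGI, hev⟩ := exists_mem_homIdeal_eval_smul hF c
    have h1 := hasDerivAt_eval_add_smul G v w
    rw [hw G hGI] at h1
    have h2 := hasDerivAt_eval_add_smul F (c • v) (c • w)
    have h3 : (fun t : ℂ => eval (v + t • w) G) = fun t => eval (c • v + t • c • w) F := by
      funext t
      rw [hev, smul_add, smul_comm]
    rw [h3] at h1
    have h4 := h2.unique h1
    rw [map_smul, smul_eq_mul] at h4
    exact (mul_eq_zero.1 h4).resolve_left hc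
  refine le_antisymm ?_ (key v c hc)
  have := key (c • v) c⁻¹ (inv_ne_zero hc)
  rwa [smul_smul, inv_mul_cancel₀ hc, one_smul] at this

theorem mk_mem_smoothLocus_iff {v : Vec N} (hv : v ≠ 0) :
    Projectivization.mk ℂ v hv ∈ smoothLocus X ↔
      v ∈ cone X ∧ Module.finrank ℂ (coneTangentSpace X v) = projDim X + 1 := by
  obtain ⟨a, ha⟩ := Projectivization.exists_smul_eq_mk_rep ℂ v hv
  rw [smoothLocus, Set.mem_ofPred_eq, mem_cone_iff_mk hv, ← ha]
  rw [show a • v = (a : ℂ) • v from rfl, coneTangentSpace_smul v a.ne_zero]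

theorem exists_basis_apply_zero_eq {E : Type*} [AddCommGroup E] [Module ℂ E]
    [FiniteDimensional ℂ E] {n : ℕ} (h : Module.finrank ℂ E = n + 1) {x : E} (hx : x ≠ 0) :
    ∃ b : Module.Basis (Fin (n + 1)) ℂ E, b 0 = x := by
  have h1 : LinearIndepOn ℂ id ({x} : Set E) := LinearIndepOn.singleton hx
  let B := Module.Basis.extend h1
  have hx' : x ∈ h1.extend (Set.subset_univ _) := h1.subset_extend _ (Set.mem_singleton x)
  have hfin : Finite (h1.extend (Set.subset_univ _)) :=
    Module.Finite.finite_basis B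
  have hcard : Nat.card (h1.extend (Set.subset_univ _)) = n + 1 := by
    rw [← Module.finrank_eq_nat_card_basis B, h]
  let e := Finite.equivFinOfCardEq hcard
  let e' := e.trans (Equiv.swap (e ⟨x, hx'⟩) 0)
  refine ⟨B.reindex e', ?_⟩
  have : e'.symm 0 = ⟨x, hx'⟩ := by
    rw [Equiv.symm_apply_eq]
    simp [e']
  rw [Module.Basis.reindex_apply, this]
  exact Module.Basis.extend_apply_self h1 _

/-- Equations and linear coordinates, one of them prescribed, with nonzero Jacobian determinant at a
smooth point of the cone. -/
theorem exists_frame {v : Vec N} (hv : v ∈ cone X) {n : ℕ}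
    (hT : Module.finrank ℂ (coneTangentSpace X v) = n + 1) {j : Fin (N + 1)} (hj : v j ≠ 0) :
    ∃ (Q : Fin (N + 1) → Forms N) (ι : Fin (n + 1) → Fin (N + 1)) (a : Fin (n + 1) → Vec N),
      Function.Injective ι ∧ (∀ i ∉ Set.range ι, Q i ∈ homIdeal X) ∧
      (∀ k, Q (ι k) = ∑ m, C (a k m) * MvPolynomial.X m) ∧ Q (ι 0) = MvPolynomial.X j ∧
      eval v (jacDet Q) ≠ 0 := by
  let grad : Forms N →ₗ[ℂ] Module.Dual ℂ (Vec N) :=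
    { toFun := fun F => (polyDeriv F v : Vec N →ₗ[ℂ] ℂ)
      map_add' := by
        intro F G
        refine LinearMap.ext fun w => ?_
        simp [polyDeriv_apply, add_mul, Finset.sum_add_distrib]
      map_smul' := by
        intro c F
        refine LinearMap.ext fun w => ?_
        simp [polyDeriv_apply, Finset.mul_sum, mul_assoc] }
  have hgrad : ∀ F w, grad F w = ∑ m, eval v (pderiv m F) * w m := fun F w => polyDeriv_apply F v w
  -- The differentials at `v` of the equations of the cone. Their common kernel is the tangent
  -- space, so `Module.Dual ℂ (Vec N) ⧸ E` has dimension `n + 1`.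
  let E : Submodule ℂ (Module.Dual ℂ (Vec N)) := ((homIdeal X).restrictScalars ℂ).map grad
  have hE : E.dualCoannihilator = coneTangentSpace X v := by
    ext w
    rw [mem_coneTangentSpace_iff, Submodule.mem_dualCoannihilator]
    constructor
    · exact fun h F hF => h (grad F) ⟨F, hF, rfl⟩
    · rintro h _ ⟨F, hF, rfl⟩
      exact h F hF
  have hdim := Subspace.finrank_add_finrank_dualCoannihilator_eq E
  rw [hE, hT] at hdim
  have hVec : Module.finrank ℂ (Vec N) = N + 1 := by simp
  rw [hVec] at hdim
  set d := Module.finrank ℂ E with hd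
  let bE : Module.Basis (Fin d) ℂ E := Module.finBasis ℂ E
  let xj : Module.Dual ℂ (Vec N) := LinearMap.proj j
  -- Differentials of equations kill `v` because the cone contains the line through `v`, while `xj v
  -- ≠ 0`. Hence `xj` can start a basis of the quotient.
  have hxj : E.mkQ xj ≠ 0 := by
    rw [Ne, Submodule.mkQ_apply, Submodule.Quotient.mk_eq_zero]
    rintro ⟨F, hF, hFj⟩
    have h1 : grad F v = 0 := polyDeriv_self_eq_zero hv hF
    rw [hFj] at h1
    exact hj h1
  have hquot : Module.finrank ℂ (Module.Dual ℂ (Vec N) ⧸ E) = n + 1 := by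
    have := Submodule.finrank_quotient_add_finrank E
    rw [Subspace.dual_finrank_eq, hVec] at this
    lia
  obtain ⟨bQ, hbQ⟩ := exists_basis_apply_zero_eq hquot hxj
  choose lft hlft using fun x : Module.Dual ℂ (Vec N) ⧸ E => E.mkQ_surjective x
  let L : Fin (n + 1) → Module.Dual ℂ (Vec N) := fun k => if k = 0 then xj else lft (bQ k)
  have hL : ∀ k, E.mkQ (L k) = bQ k := by
    intro k
    by_cases hk : k = 0
    · simp [L, hk, hbQ]
    · simp only [L, hk, if_false]
      exact hlft _
  choose F hFI hF using fun i : Fin d => (bE i).2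
  let e : Fin d ⊕ Fin (n + 1) ≃ Fin (N + 1) := Fintype.equivFinOfCardEq (by simp [hdim])
  let a : Fin (n + 1) → Vec N := fun k m => L k (Pi.single m 1)
  let Q0 : Fin d ⊕ Fin (n + 1) → Forms N :=
    Sum.elim F fun k => ∑ m, C (a k m) * MvPolynomial.X m
  have hLgrad : ∀ k, grad (∑ m, C (a k m) * MvPolynomial.X m) = L k := by
    intro k
    refine LinearMap.pi_ext' fun m => LinearMap.ext_ring ?_
    simp only [LinearMap.comp_apply, hgrad, LinearMap.single_apply]
    rw [Finset.sum_eq_single m]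
    · simp [pderiv_X, Pi.single_apply, a]
    · intro b _ hb
      simp [hb]
    · simp
  refine ⟨fun i => Q0 (e.symm i), fun k => e (Sum.inr k), a, ?_, ?_, ?_, ?_, ?_⟩
  · exact e.injective.comp Sum.inr_injective
  · intro i hi
    rcases hs : e.symm i with b | k
    · simpa [Q0, hs] using hFI b
    · exact absurd ⟨k, by simp [← hs]⟩ hi
  · intro k
    simp [Q0]
  · simp only [Equiv.symm_apply_apply, Q0, Sum.elim_inr]
    rw [Finset.sum_eq_single j]
    · simp [a, L, xj]
    · intro b _ hb
      simp [a, L, xj, hb.symm]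
    · simp
  · rw [jacDet, RingHom.map_det]
    intro hdet
    obtain ⟨c, hc0, hc⟩ := Matrix.exists_vecMul_eq_zero_iff.2 hdet
    apply hc0
    have hsum : ∑ s, c (e s) • grad (Q0 s) = 0 := by
      refine LinearMap.pi_ext' fun m => LinearMap.ext_ring ?_
      have h1 := congrFun hc m
      simp only [Matrix.vecMul, dotProduct, RingHom.mapMatrix_apply, Matrix.map_apply,
        Matrix.of_apply, Pi.zero_apply] at h1
      rw [← e.sum_comp] at h1
      simp only [Equiv.symm_apply_apply] at h1
      simp only [LinearMap.comp_apply, LinearMap.sum_apply, LinearMap.smul_apply, hgrad,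
        LinearMap.single_apply, LinearMap.zero_apply]
      rw [← h1]
      refine Finset.sum_congr rfl fun s _ => ?_
      rw [Finset.sum_eq_single m] <;> simp +contextual
    rw [Fintype.sum_sum_type] at hsum
    simp only [Q0, Sum.elim_inl, Sum.elim_inr, hLgrad] at hsum
    have h2 : ∀ k, c (e (Sum.inr k)) = 0 := by
      have h3 := congrArg E.mkQ hsum
      rw [map_add, map_sum, map_sum, map_zero] at h3
      have h4 : ∀ x, E.mkQ (c (e (Sum.inl x)) • grad (F x)) = 0 := by
        intro x
        rw [map_smul, hF, Submodule.mkQ_apply, (Submodule.Quotient.mk_eq_zero E).2 (bE x).2,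
          smul_zero]
      rw [Finset.sum_eq_zero fun x _ => h4 x, zero_add] at h3
      simp only [map_smul, hL] at h3
      exact Fintype.linearIndependent_iff.1 bQ.linearIndependent _ h3
    have h5 : ∀ x, c (e (Sum.inl x)) = 0 := by
      simp only [h2, zero_smul, Finset.sum_const_zero, add_zero, hF] at hsum
      have h6 : ∑ x, c (e (Sum.inl x)) • bE x = 0 := by
        apply Subtype.ext
        simpa using hsum
      exact Fintype.linearIndependent_iff.1 bE.linearIndependent _ h6
    funext i
    rw [← e.apply_symm_apply i]
    rcases e.symm i with x | k
    · exact h5 x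
    · exact h2 k

/-- The tangent spaces of the cone have dimension at most `n + 1` where `N - n` equations have
independent differentials. -/
theorem finrank_coneTangentSpace_le {v : Vec N} {n : ℕ} (Q : Fin (N + 1) → Forms N)
    (ι : Fin (n + 1) → Fin (N + 1)) (hQ : ∀ i ∉ Set.range ι, Q i ∈ homIdeal X)
    (hdet : eval v (jacDet Q) ≠ 0) : Module.finrank ℂ (coneTangentSpace X v) ≤ n + 1 := by
  let T : Vec N →ₗ[ℂ] (Fin (n + 1) → ℂ) := LinearMap.pi fun k => (polyDeriv (Q (ι k)) v : Vec N →ₗ[ℂ] ℂ)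
  have hinj : ∀ w ∈ coneTangentSpace X v, T w = 0 → w = 0 := by
    intro w hw hTw
    have h1 : ∀ i, polyDeriv (Q i) v w = 0 := by
      intro i
      by_cases hi : i ∈ Set.range ι
      · obtain ⟨k, rfl⟩ := hi
        exact congrFun hTw k
      · exact mem_coneTangentSpace_iff.1 hw _ (hQ i hi)
    by_contra hw0
    apply hdet
    rw [jacDet, RingHom.map_det]
    refine Matrix.exists_mulVec_eq_zero_iff.1 ⟨w, hw0, ?_⟩
    funext i
    have := h1 i
    rw [polyDeriv_apply] at this
    simpa [Matrix.mulVec, dotProduct] using this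
  have h2 : Function.Injective (T.comp (coneTangentSpace X v).subtype) := by
    rw [← LinearMap.ker_eq_bot]
    refine LinearMap.ker_eq_bot'.2 fun w hw => Subtype.ext (hinj w w.2 hw)
  simpa using LinearMap.finrank_le_finrank_of_injective h2

end Tangent

/-! ### Analytic charts of the cone at smooth points. -/

section Chart

variable {N : ℕ} {X : Set (PSpace N)}

/-- The leading form of a homogeneous expression vanishes along a direction of high contact. -/
theorem eval_map_eq_zero_of_isBigO {R : Type*} [CommRing R] {m r : ℕ} (p : MvPolynomial (Fin m) R)
    (hp : p.IsHomogeneous r) (f : Fin m → R) (e : ℂ → R →+* ℂ) (e₀ : R →+* ℂ) (d : Fin m → ℂ)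
    (he : ∀ a, Filter.Tendsto (fun ε => e ε a) (𝓝[≠] 0) (𝓝 (e₀ a)))
    (hd : ∀ i, Filter.Tendsto (fun ε => ε⁻¹ * e ε (f i)) (𝓝[≠] 0) (𝓝 (d i)))
    (hO : (fun ε => e ε (eval f p)) =O[𝓝[≠] 0] fun ε => ‖ε‖ ^ (r + 1)) :
    eval d (map e₀ p) = 0 := by
  have hsum : ∀ (φ : R →+* ℂ) (x : Fin m → ℂ),
      eval x (map φ p) = ∑ k ∈ p.support, φ (p.coeff k) * ∏ i, x i ^ k i := by
    intro φ x
    rw [eval_map, eval₂_eq']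
  have h1 : Filter.Tendsto (fun ε => eval (fun i => ε⁻¹ * e ε (f i)) (map (e ε) p)) (𝓝[≠] 0)
      (𝓝 (eval d (map e₀ p))) := by
    simp only [hsum]
    exact tendsto_finsetSum _ fun k _ => (he _).mul (tendsto_finsetProd _ fun i _ => (hd i).pow _)
  -- Homogeneity of degree `r` takes `ε⁻¹` out of the arguments as a factor `ε⁻ʳ`, which is absorbed
  -- by the contact order `r + 1`.
  have h2 : ∀ ε, eval (fun i => ε⁻¹ * e ε (f i)) (map (e ε) p) = (ε⁻¹) ^ r * e ε (eval f p) := by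
    intro ε
    have h3 : e ε (eval f p) = eval (fun i => e ε (f i)) (map (e ε) p) := by
      rw [eval_map, ← eval₂_id, hom_eval₂]
      rfl
    rw [h3, hsum, hsum, Finset.mul_sum]
    refine Finset.sum_congr rfl fun k hk => ?_
    have hk' : ∑ i, k i = r := by
      have := hp (mem_support_iff.1 hk)
      rw [Finsupp.weight_apply, Finsupp.sum_fintype _ _ (by simp)] at this
      simpa using this
    simp only [mul_pow, Finset.prod_mul_distrib, Finset.prod_pow_eq_pow_sum, hk']
    ring
  have h4 : Filter.Tendsto (fun ε => eval (fun i => ε⁻¹ * e ε (f i)) (map (e ε) p)) (𝓝[≠] 0)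
      (𝓝 0) := by
    simp only [h2]
    have h5 : (fun ε : ℂ => (ε⁻¹) ^ r * e ε (eval f p)) =O[𝓝[≠] 0] fun ε => ‖ε‖ := by
      refine ((Asymptotics.isBigO_refl (fun ε : ℂ => (ε⁻¹) ^ r) (𝓝[≠] 0)).norm_right.mul hO).trans ?_
      refine Filter.EventuallyEq.isBigO ?_
      filter_upwards [self_mem_nhdsWithin] with ε hε
      have hε : ‖ε‖ ≠ 0 := norm_ne_zero_iff.2 hε
      rw [norm_pow, norm_inv, pow_succ, ← mul_assoc, ← mul_pow, inv_mul_cancel₀ hε, one_pow, one_mul]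
    refine h5.trans_tendsto ?_
    have : Filter.Tendsto (fun ε : ℂ => ‖ε‖) (𝓝 0) (𝓝 0) := by
      simpa using (continuous_norm (E := ℂ)).tendsto 0
    exact this.mono_left nhdsWithin_le_nhds
  exact tendsto_nhds_unique h1 h4

theorem analyticAt_eval_comp {E : Type*} [NormedAddCommGroup E] [NormedSpace ℂ E] (F : Forms N)
    {g : E → Vec N} {x : E} (hg : AnalyticAt ℂ g x) : AnalyticAt ℂ (fun s => eval (g s) F) x :=
  AnalyticAt.comp (g := fun v => eval v F) (AnalyticOnNhd.eval_mvPolynomial F _ (Set.mem_univ _)) hg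

/-- The germs of analytic functions have no zero divisors. -/
theorem eventually_eq_zero_or_of_mul {E : Type*} [NormedAddCommGroup E] [NormedSpace ℂ E]
    {f g : E → ℂ} (hf : AnalyticAt ℂ f 0) (hg : AnalyticAt ℂ g 0)
    (h : ∀ᶠ x in 𝓝 0, f x * g x = 0) : (∀ᶠ x in 𝓝 0, f x = 0) ∨ ∀ᶠ x in 𝓝 0, g x = 0 := by
  obtain ⟨r, hr, hball⟩ := Metric.eventually_nhds_iff_ball.1
    (hf.eventually_analyticAt.and (hg.eventually_analyticAt.and h))
  by_cases hz : ∀ x ∈ Metric.ball (0 : E) r, f x = 0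
  · exact Or.inl (Metric.eventually_nhds_iff_ball.2 ⟨r, hr, hz⟩)
  push Not at hz
  obtain ⟨x₀, hx₀, hfx⟩ := hz
  right
  have hg0 : ∀ᶠ x in 𝓝 x₀, g x = 0 := by
    filter_upwards [(hball x₀ hx₀).1.continuousAt.eventually_ne hfx,
      Metric.isOpen_ball.mem_nhds hx₀] with x h1 h2
    exact (mul_eq_zero.1 (hball x h2).2.2).resolve_left h1
  have hgan : AnalyticOnNhd ℂ g (Metric.ball 0 r) := fun x hx => (hball x hx).2.1
  have := hgan.eqOn_zero_of_preconnected_of_eventuallyEq_zero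
    (convex_ball (0 : E) r).isPreconnected hx₀ hg0
  exact Metric.eventually_nhds_iff_ball.2 ⟨r, hr, this⟩

theorem eq_zero_of_polyDeriv_eq_zero {v w : Vec N} (Q : Fin (N + 1) → Forms N)
    (hdet : eval v (jacDet Q) ≠ 0) (h : ∀ i, polyDeriv (Q i) v w = 0) : w = 0 := by
  by_contra hw0
  apply hdet
  rw [jacDet, RingHom.map_det]
  refine Matrix.exists_mulVec_eq_zero_iff.1 ⟨w, hw0, ?_⟩
  funext i
  have := h i
  rw [polyDeriv_apply] at this
  simpa [Matrix.mulVec, dotProduct] using this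

theorem exists_localInverse {v : Vec N} (Q : Fin (N + 1) → Forms N)
    (hdet : eval v (jacDet Q) ≠ 0) : ∃ g : Vec N → Vec N,
      AnalyticAt ℂ g (fun i => eval v (Q i)) ∧ g (fun i => eval v (Q i)) = v ∧
      (∀ᶠ x in 𝓝 v, g (fun i => eval x (Q i)) = x) ∧
      ∀ᶠ y in 𝓝 (fun i => eval v (Q i)), (fun i => eval (g y) (Q i)) = y := by
  set ω : Vec N → Vec N := fun x i => eval x (Q i)
  let A : Vec N →L[ℂ] Vec N := ContinuousLinearMap.pi fun i => polyDeriv (Q i) v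
  have hA : ∀ w, A w = 0 → w = 0 := fun w hw =>
    eq_zero_of_polyDeriv_eq_zero Q hdet fun i => congrFun hw i
  let A' : Vec N ≃L[ℂ] Vec N := (LinearEquiv.ofInjectiveEndo (A : Vec N →ₗ[ℂ] Vec N)
    (LinearMap.ker_eq_bot.1 (LinearMap.ker_eq_bot'.2 hA))).toContinuousLinearEquiv
  have hAA : (A' : Vec N →L[ℂ] Vec N) = A := by
    ext w : 1
    rfl
  have hωd : HasFDerivAt ω (A' : Vec N →L[ℂ] Vec N) v := by
    rw [hAA]
    exact hasFDerivAt_pi.2 fun i => (hasStrictFDerivAt_eval (Q i) v).hasFDerivAt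
  have hωan : AnalyticAt ℂ ω v := AnalyticAt.pi fun i => analyticAt_eval_comp (Q i) analyticAt_id
  have hωc : ContDiffAt ℂ ⊤ ω v := hωan.contDiffAt
  have hs := hωc.hasStrictFDerivAt' hωd (by simp)
  refine ⟨hωc.localInverse hωd (by simp), ?_, hs.eventually_left_inverse.self_of_nhds,
    hs.eventually_left_inverse, hs.eventually_right_inverse⟩
  exact ContDiffAt.analyticAt (hωc.to_localInverse hωd (by simp))

theorem eq_aeval_C_self {σ : Type*} (F : MvPolynomial σ ℂ) (v : σ → ℂ) :
    aeval (fun m => (C (v m) : MvPolynomial σ ℂ)) F = C (eval v F) := by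
  have h : (aeval (fun m => (C (v m) : MvPolynomial σ ℂ)) : MvPolynomial σ ℂ →ₐ[ℂ] _) =
      (Algebra.ofId ℂ (MvPolynomial σ ℂ)).comp (aeval v) := by
    ext i
    simp [Algebra.ofId_apply, algebraMap_eq]
  exact DFunLike.congr_fun h F

theorem exists_sub_C_eval_eq {σ : Type} [Fintype σ] (F : MvPolynomial σ ℂ) (v : σ → ℂ) :
    ∃ A : σ → MvPolynomial σ ℂ, F - C (eval v F) = ∑ m, A m * (MvPolynomial.X m - C (v m)) ∧
      ∀ m, eval v (A m) = eval v (pderiv m F) := by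
  obtain ⟨A, h1, h2⟩ := exists_difference_quotients F (fun m => (MvPolynomial.X m : MvPolynomial σ ℂ))
    (fun m => C (v m))
  rw [eq_aeval_C_self, aeval_X_left, AlgHom.id_apply] at h1
  refine ⟨A, h1, fun m => ?_⟩
  have h3 : Ideal.span (Set.range fun m => (MvPolynomial.X m - C (v m) : MvPolynomial σ ℂ)) ≤
      pointIdeal v := by
    rw [Ideal.span_le]
    rintro _ ⟨m, rfl⟩
    change eval v _ = 0
    simp
  have h4 : eval v (A m - aeval (fun m => C (v m)) (pderiv m F)) = 0 := h3 (h2 m)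
  rw [eq_aeval_C_self, map_sub, eval_C] at h4
  exact sub_eq_zero.1 h4

theorem isMaximal_pointIdeal {σ : Type} (v : σ → ℂ) : (pointIdeal v).IsMaximal :=
  RingHom.ker_isMaximal_of_surjective _ fun c => ⟨C c, eval_C c⟩

/-- The polynomials vanishing on the image of an analytic germ form a prime ideal because analytic
germs have no zero divisors. -/
theorem isPrime_eventually_eq_zero {E : Type*} [NormedAddCommGroup E] [NormedSpace ℂ E]
    {g : E → Vec N} (hg : AnalyticAt ℂ g 0) : ∃ P : Ideal (Forms N), P.IsPrime ∧
      ∀ F, F ∈ P ↔ ∀ᶠ s in 𝓝 0, eval (g s) F = 0 := by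
  let P : Ideal (Forms N) :=
    { carrier := {F | ∀ᶠ s in 𝓝 0, eval (g s) F = 0}
      add_mem' := by
        intro a b ha hb
        filter_upwards [ha, hb] with s h1 h2
        rw [map_add, h1, h2, add_zero]
      zero_mem' := by simp
      smul_mem' := by
        intro c a ha
        filter_upwards [ha] with s h1
        rw [smul_eq_mul, map_mul, h1, mul_zero] }
  have hP : ∀ F, F ∈ P ↔ ∀ᶠ s in 𝓝 0, eval (g s) F = 0 := fun F => Iff.rfl
  refine ⟨P, ⟨?_, ?_⟩, hP⟩
  · rw [Ideal.ne_top_iff_one, hP]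
    intro h
    simpa using h.self_of_nhds
  · intro a b hab
    rw [hP] at hab
    simp only [hP]
    refine eventually_eq_zero_or_of_mul (analyticAt_eval_comp a hg) (analyticAt_eval_comp b hg) ?_
    filter_upwards [hab] with s h1
    rwa [map_mul] at h1

/-- A polynomial whose image in every infinitesimal neighbourhood of a point of the affine variety
of a prime ideal is in the ideal lies in the ideal. -/
theorem mem_of_forall_mul_mem_pow_sup {σ : Type} [Finite σ] (I : Ideal (MvPolynomial σ ℂ))
    [I.IsPrime] {v : σ → ℂ} (hI : I ≤ pointIdeal v) (H : MvPolynomial σ ℂ)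
    (h : ∀ ℓ, ∃ s ∉ pointIdeal v, s * H ∈ pointIdeal v ^ ℓ ⊔ I) : H ∈ I := by
  have h1 : ∀ ℓ, H ∈ pointIdeal v ^ ℓ ⊔ I := by
    intro ℓ
    obtain ⟨s, hs, hsH⟩ := h ℓ
    -- The ideal of the point is maximal, so `s` is invertible modulo each of its powers and can be
    -- removed.
    have h2 : Ideal.span {s} ⊔ pointIdeal v ^ ℓ = ⊤ := by
      refine Ideal.sup_pow_eq_top ?_
      have := (isMaximal_pointIdeal v).1.2 (Ideal.span {s} ⊔ pointIdeal v) ?_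
      · exact this
      · refine lt_of_le_of_ne le_sup_right fun heq => hs ?_
        rw [heq]
        exact Ideal.mem_sup_left (Ideal.mem_span_singleton_self s)
    have h3 : (1 : MvPolynomial σ ℂ) ∈ Ideal.span {s} ⊔ pointIdeal v ^ ℓ := by
      rw [h2]; trivial
    obtain ⟨a, ha, b, hb, hab⟩ := Submodule.mem_sup.1 h3
    obtain ⟨c, rfl⟩ := Ideal.mem_span_singleton'.1 ha
    have h4 : H = c * (s * H) + b * H := by
      calc H = (c * s + b) * H := by rw [hab, one_mul]
        _ = _ := by ring
    rw [h4]
    exact add_mem (Ideal.mul_mem_left _ _ hsH)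
      (Ideal.mem_sup_left (Ideal.mul_mem_right _ _ hb))
  -- Krull's intersection theorem in the domain `MvPolynomial σ ℂ ⧸ I`.
  have h5 := Ideal.iInf_pow_eq_bot_of_isDomain
    (I := (pointIdeal v).map (Ideal.Quotient.mk I)) (by
      intro h2
      apply (isMaximal_pointIdeal v).ne_top
      rw [← Ideal.comap_map_mk hI, h2, Ideal.comap_top])
  have h6 : Ideal.Quotient.mk I H ∈ ⨅ ℓ, (pointIdeal v).map (Ideal.Quotient.mk I) ^ ℓ := by
    rw [Ideal.mem_iInf]
    intro ℓ
    have := Ideal.mem_map_of_mem (Ideal.Quotient.mk I) (h1 ℓ)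
    rwa [Ideal.map_sup, Ideal.map_quotient_self, sup_bot_eq, Ideal.map_pow] at this
  rw [h5, Ideal.mem_bot] at h6
  exact Ideal.Quotient.eq_zero_iff_mem.1 h6

/-- Near a smooth point `v` of the cone over a variety, `Q (ι k)` are analytic coordinates. -/
theorem exists_chart (hX : IsProjectiveVariety X) {v : Vec N} (hv : v ∈ cone X) (hv0 : v ≠ 0)
    (Q : Fin (N + 1) → Forms N) (ι : Fin (projDim X + 1) → Fin (N + 1))
    (hι : Function.Injective ι) (hQ : ∀ i ∉ Set.range ι, Q i ∈ homIdeal X)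
    (hdet : eval v (jacDet Q) ≠ 0) :
    ∃ g : (Fin (projDim X + 1) → ℂ) → Vec N, AnalyticAt ℂ g 0 ∧ g 0 = v ∧
      (∀ᶠ s in 𝓝 0, g s ∈ cone X) ∧
      (∀ᶠ s in 𝓝 0, ∀ k, eval (g s) (Q (ι k)) = eval v (Q (ι k)) + s k) ∧
      (∀ᶠ y in 𝓝[cone X] v, y = g fun k => eval y (Q (ι k)) - eval v (Q (ι k))) ∧
      ∀ H, (∀ᶠ s in 𝓝 0, eval (g s) H = 0) → H ∈ homIdeal X := by
  have hXp := hX.2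
  obtain ⟨g₀, hg₀, hg₀v, hleft, hright⟩ := exists_localInverse Q hdet
  have hQv : ∀ y ∈ cone X, ∀ i ∉ Set.range ι, eval y (Q i) = 0 := fun y hy i hi =>
    mem_homIdeal.1 (hQ i hi) y hy
  -- In the coordinates `Q` the chart is a coordinate plane: parameters go into the slots `ι k` and
  -- the equations are set to zero. So `g` parametrizes the common zeros of the chosen equations
  -- near `v`; that these lie in the cone is shown below by comparing `P`, the ideal of the image,
  -- with `homIdeal X`.
  let emb : (Fin (projDim X + 1) → ℂ) → Vec N := fun s i => eval v (Q i) + Function.extend ι s 0 i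
  have hembk : ∀ s k, emb s (ι k) = eval v (Q (ι k)) + s k := fun s k => by
    simp only [emb, hι.extend_apply]
  have hembi : ∀ s, ∀ i ∉ Set.range ι, emb s i = 0 := fun s i hi => by
    simp only [emb, hQv v hv i hi, Function.extend_apply' _ _ _ hi, Pi.zero_apply, add_zero]
  have hemb : AnalyticAt ℂ emb 0 := by
    refine AnalyticAt.pi fun i => ?_
    by_cases hi : i ∈ Set.range ι
    · obtain ⟨k, rfl⟩ := hi
      change AnalyticAt ℂ (fun s => emb s (ι k)) 0
      simp only [hembk]
      exact analyticAt_const.add ((ContinuousLinearMap.proj (R := ℂ)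
        (φ := fun _ : Fin (projDim X + 1) => ℂ) k).analyticAt 0)
    · change AnalyticAt ℂ (fun s => emb s i) 0
      simp only [hembi _ i hi]
      exact analyticAt_const
  have hemb0 : emb 0 = fun i => eval v (Q i) := by
    funext i
    by_cases hi : i ∈ Set.range ι
    · obtain ⟨k, rfl⟩ := hi
      simp [hembk]
    · rw [hembi _ i hi, hQv v hv i hi]
  have hembt : Filter.Tendsto emb (𝓝 0) (𝓝 fun i => eval v (Q i)) := by
    rw [← hemb0]; exact hemb.continuousAt
  let g : (Fin (projDim X + 1) → ℂ) → Vec N := fun s => g₀ (emb s)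
  have hg : AnalyticAt ℂ g 0 := AnalyticAt.comp (g := g₀) (by rw [hemb0]; exact hg₀) hemb
  have hg0 : g 0 = v := by simp only [g, hemb0, hg₀v]
  have hQg : ∀ᶠ s in 𝓝 0, ∀ i, eval (g s) (Q i) = emb s i := by
    filter_upwards [hembt.eventually hright] with s hs i using congrFun hs i
  obtain ⟨P, hPp, hP⟩ := isPrime_eventually_eq_zero hg
  have hQP : ∀ i ∉ Set.range ι, Q i ∈ P := by
    intro i hi
    rw [hP]
    filter_upwards [hQg] with s hs
    rw [hs, hembi _ i hi]
  let J : Ideal (Forms N) := Ideal.span (Q '' (Set.range ι)ᶜ)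
  have hJP : J ≤ P := by
    rw [Ideal.span_le]
    rintro _ ⟨i, hi, rfl⟩
    exact hQP i hi
  have hJX : J ≤ homIdeal X := by
    rw [Ideal.span_le]
    rintro _ ⟨i, hi, rfl⟩
    exact hQ i hi
  have hXv : homIdeal X ≤ pointIdeal v := vanishingIdeal_le_pointIdeal _ hv
  let f : Fin (projDim X + 1) → Forms N := fun k => Q (ι k) - C (eval v (Q (ι k)))
  -- Expand `H ∈ P` near `v` in powers of the `f k`, modulo the chosen equations. Along `g (ε • h)`
  -- the functions `f k` equal `ε * h k`, so every leading form vanishes identically. Thus `H` lies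
  -- locally in every power of the point ideal modulo `homIdeal X`.
  have hPX : P ≤ homIdeal X := by
    intro H hH
    refine mem_of_forall_mul_mem_pow_sup (homIdeal X) hXv H fun ℓ => ?_
    choose A hA hA' using fun i => exists_sub_C_eval_eq (Q i) v
    have hdetA : eval v (Matrix.det (Matrix.of A)) = eval v (jacDet Q) := by
      rw [jacDet, RingHom.map_det, RingHom.map_det]
      congr 1
      ext i m
      simp [hA']
    have h₀ : ∀ x ∈ pointIdeal v,
        Matrix.det (Matrix.of A) * x ∈ Ideal.span (Set.range f) ⊔ J := by
      intro x hx
      obtain ⟨B, hB, -⟩ := exists_sub_C_eval_eq x v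
      rw [show eval v x = 0 from hx, C_0, sub_zero] at hB
      rw [hB, Finset.mul_sum]
      refine Ideal.sum_mem _ fun m _ => ?_
      rw [mul_left_comm]
      refine Ideal.mul_mem_left _ _ (det_mul_mem _ _ (fun m => MvPolynomial.X m - C (v m)) ?_ m)
      intro i
      simp only [Matrix.of_apply, ← hA]
      by_cases hi : i ∈ Set.range ι
      · obtain ⟨k, rfl⟩ := hi
        exact Ideal.mem_sup_left (Ideal.subset_span ⟨k, rfl⟩)
      · rw [hQv v hv i hi, C_0, sub_zero]
        exact Ideal.mem_sup_right (Ideal.subset_span ⟨i, hi, rfl⟩)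
    have hcoeff : ∀ r < ℓ, ∀ s ∉ pointIdeal v, ∀ p : MvPolynomial (Fin (projDim X + 1)) (Forms N),
        p.IsHomogeneous r → s * H - eval f p ∈ J → ∀ m, p.coeff m ∈ pointIdeal v := by
      intro r _ s _ p hp hsp m
      have hzero : map (eval v) p = 0 := by
        refine MvPolynomial.funext fun h => ?_
        rw [map_zero]
        have hline : Filter.Tendsto (fun ε : ℂ => ε • h) (𝓝[≠] 0) (𝓝 0) := by
          have : Filter.Tendsto (fun ε : ℂ => ε • h) (𝓝 0) (𝓝 ((0 : ℂ) • h)) :=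
            Filter.Tendsto.smul_const Filter.tendsto_id h
          rw [zero_smul] at this
          exact this.mono_left nhdsWithin_le_nhds
        refine eval_map_eq_zero_of_isBigO p hp f (fun ε => eval (g (ε • h))) (eval v) h ?_ ?_ ?_
        · intro a
          have := (analyticAt_eval_comp a hg).continuousAt.tendsto
          rw [hg0] at this
          exact this.comp hline
        · intro k
          refine tendsto_const_nhds.congr' ?_
          filter_upwards [hline.eventually hQg, self_mem_nhdsWithin] with ε h1 h2
          have h2 : ε ≠ 0 := h2
          simp only [f, map_sub, eval_C, h1, hembk, Pi.smul_apply, smul_eq_mul,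
            add_sub_cancel_left]
          rw [inv_mul_cancel_left₀ h2]
        · refine Asymptotics.IsBigO.of_bound 0 ?_
          filter_upwards [hline.eventually ((hP _).1 hH),
            hline.eventually ((hP _).1 (hJP hsp))] with ε h1 h2
          rw [map_sub, map_mul, h1, mul_zero, zero_sub, neg_eq_zero] at h2
          rw [h2]
          simp
      have := congrArg (coeff m) hzero
      rwa [coeff_map, coeff_zero] at this
    obtain ⟨s, hs, hsH⟩ := exists_mul_mem_pow_sup (pointIdeal v) J f
      (fun k => by rw [mem_pointIdeal]; simp [f]) (Matrix.det (Matrix.of A))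
      (by rw [mem_pointIdeal, hdetA]; exact hdet) h₀ H ℓ hcoeff
    exact ⟨s, hs, (sup_le_sup_left hJX _) hsH⟩
  have hdetX : jacDet Q ∉ homIdeal X := fun h => hdet (hXv h)
  have hdetP : jacDet Q ∉ P := fun h => hdetX (hPX h)
  obtain ⟨z, hz, hvz⟩ := id hv
  -- If some `H ∈ homIdeal X` were outside `P`, a multiple of it would equal, modulo `P`, a nonzero
  -- polynomial in the `Q (ι k)`. That polynomial would lie in `homIdeal X`, but these coordinates
  -- are algebraically independent there by the dimension of `X`.
  have hXP : homIdeal X ≤ P := by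
    intro H hH
    by_contra hHP
    obtain ⟨c, H', hc, hcH⟩ := exists_aeval_sub_mul_mem P Q ι hQP hdetP H hHP
    refine hc (algebraicIndependent_of_jacDet (homIdeal X)
      (le_ringKrullDim_of_prime X hXp hz) Q ι hQ hdetX c ?_)
    have h1 := hPX hcH
    have h2 := add_mem h1 (Ideal.mul_mem_right H' _ hH)
    rwa [sub_add_cancel] at h2
  refine ⟨g, hg, hg0, ?_, ?_, ?_, fun H hH => hPX ((hP H).2 hH)⟩
  -- Finitely many generators of the ideal provide one neighbourhood on which all equations hold.
  · obtain ⟨S, hS⟩ := (inferInstance : IsNoetherianRing (Forms N)).noetherian (homIdeal X)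
    have h1 : ∀ᶠ s in 𝓝 0, ∀ F ∈ S, eval (g s) F = 0 := by
      rw [Filter.eventually_all_finset]
      intro F hF
      refine (hP F).1 (hXP ?_)
      rw [← hS]
      exact Submodule.subset_span hF
    have h2 : ∀ᶠ s in 𝓝 0, g s ≠ 0 := hg.continuousAt.eventually_ne (by rwa [hg0])
    filter_upwards [h1, h2] with s h3 h4
    refine mem_cone_of_forall_eval_eq_zero hX.1 h4 ?_
    have h5 : homIdeal X ≤ pointIdeal (g s) := by
      rw [← hS]
      exact Ideal.span_le.2 fun F hF => h3 F hF
    exact fun F hF => h5 hF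
  · filter_upwards [hQg] with s hs k
    rw [hs, hembk]
  · filter_upwards [eventually_nhdsWithin_of_eventually_nhds hleft, self_mem_nhdsWithin] with y h1 h2
    conv_lhs => rw [← h1]
    simp only [g]
    congr 1
    funext i
    by_cases hi : i ∈ Set.range ι
    · obtain ⟨k, rfl⟩ := hi
      rw [hembk, add_sub_cancel]
    · rw [hembi _ i hi, hQv y h2 i hi]

end Chart

/-! ### Existence and Zariski density of local parametrizations. -/

section SmoothLifts

variable {N : ℕ} {X : Set (PSpace N)} {z : PSpace N} {φ : (Fin (projDim X) → ℂ) → Vec N}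

theorem exists_frame_of_mem_smoothLocus {v : Vec N} (hv : v ≠ 0)
    (hz : Projectivization.mk ℂ v hv ∈ smoothLocus X) {j : Fin (N + 1)} (hj : v j ≠ 0) :
    ∃ (Q : Fin (N + 1) → Forms N) (ι : Fin (projDim X + 1) → Fin (N + 1))
      (a : Fin (projDim X + 1) → Vec N),
      Function.Injective ι ∧ (∀ i ∉ Set.range ι, Q i ∈ homIdeal X) ∧
      (∀ k, Q (ι k) = ∑ m, C (a k m) * MvPolynomial.X m) ∧ Q (ι 0) = MvPolynomial.X j ∧
      eval v (jacDet Q) ≠ 0 :=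
  exists_frame ((mk_mem_smoothLocus_iff hv).1 hz).1 ((mk_mem_smoothLocus_iff hv).1 hz).2 hj

theorem exists_apply_ne_zero {v : Vec N} (hv : v ≠ 0) : ∃ j, v j ≠ 0 := by
  by_contra! h
  exact hv (funext h)

theorem IsLocalLift.mk_eq (hφ : IsLocalLift X z φ) :
    Projectivization.mk ℂ (φ 0) hφ.base_ne_zero = z :=
  mk_eq_of_mem hφ.base_ne_zero hφ.base_mem

/-- The tangent space contains the radial direction `φ 0` and the image of the differential, which
are independent by the immersion condition. -/
theorem IsLocalLift.le_finrank_coneTangentSpace (hφ : IsLocalLift X z φ) :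
    projDim X + 1 ≤ Module.finrank ℂ (coneTangentSpace X (φ 0)) := by
  have hmem : ∀ w, fderiv ℂ φ 0 w ∈ coneTangentSpace X (φ 0) := by
    intro w
    rw [mem_coneTangentSpace_iff]
    intro F hF
    have h1 : HasFDerivAt (fun t => eval (φ t) F) _ 0 :=
      HasFDerivAt.comp (g := fun v => eval v F) 0 (hasStrictFDerivAt_eval F (φ 0)).hasFDerivAt
        hφ.analyticAt.differentiableAt.hasFDerivAt
    have h2 : (fun t => eval (φ t) F) =ᶠ[𝓝 0] fun _ => 0 := by
      filter_upwards [hφ.mem_cone] with t ht using mem_homIdeal.1 hF _ ht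
    have h3 := (h1.congr_of_eventuallyEq h2.symm).unique (hasFDerivAt_const (0 : ℂ) 0)
    exact congrArg (fun L : (Fin (projDim X) → ℂ) →L[ℂ] ℂ => L w) h3
  have hbase : φ 0 ∈ coneTangentSpace X (φ 0) := by
    rw [mem_coneTangentSpace_iff]
    exact fun F hF => polyDeriv_self_eq_zero hφ.mem_cone.self_of_nhds hF
  let T : (ℂ × (Fin (projDim X) → ℂ)) →ₗ[ℂ] coneTangentSpace X (φ 0) :=
    { toFun := fun p => p.1 • ⟨φ 0, hbase⟩ + ⟨fderiv ℂ φ 0 p.2, hmem _⟩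
      map_add' := by
        intro p q
        apply Subtype.ext
        simp [add_smul]
        abel
      map_smul' := by
        intro c p
        apply Subtype.ext
        simp [mul_smul] }
  have hT : Function.Injective T := by
    rw [← LinearMap.ker_eq_bot]
    refine LinearMap.ker_eq_bot'.2 fun p hp => ?_
    have h1 : p.1 • φ 0 + fderiv ℂ φ 0 p.2 = 0 := congrArg Subtype.val hp
    have h2 : p.2 = 0 := by
      apply hφ.immersion
      rw [eq_neg_of_add_eq_zero_right h1]
      exact neg_mem (Submodule.smul_mem _ _ (Submodule.mem_span_singleton_self _))
    rw [h2, map_zero, add_zero] at h1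
    exact Prod.ext ((smul_eq_zero.1 h1).resolve_right hφ.base_ne_zero) h2
  have := LinearMap.finrank_le_finrank_of_injective hT
  rwa [Module.finrank_prod, Module.finrank_self, Module.finrank_fin_fun, add_comm] at this

theorem IsLocalLift.eventually_mem_smoothLocus (hz : z ∈ smoothLocus X) (hφ : IsLocalLift X z φ) :
    ∀ᶠ τ in 𝓝 0, ∃ h : φ τ ≠ 0, Projectivization.mk ℂ (φ τ) h ∈ smoothLocus X ∧
      IsLocalLift X (Projectivization.mk ℂ (φ τ) h) fun t => φ (τ + t) := by
  rw [← hφ.mk_eq] at hz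
  obtain ⟨j, hj⟩ := exists_apply_ne_zero hφ.base_ne_zero
  obtain ⟨Q, ι, -, -, hQ, -, -, hdet⟩ := exists_frame_of_mem_smoothLocus hφ.base_ne_zero hz hj
  have h1 : ∀ᶠ τ in 𝓝 0, eval (φ τ) (jacDet Q) ≠ 0 :=
    (analyticAt_eval_comp (jacDet Q) hφ.analyticAt).continuousAt.eventually_ne hdet
  filter_upwards [h1, hφ.eventually_translate, hφ.mem_cone] with τ h2 ⟨h3, h4⟩ h5
  refine ⟨h3, (mk_mem_smoothLocus_iff h3).2 ⟨h5, ?_⟩, h4⟩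
  refine le_antisymm (finrank_coneTangentSpace_le Q ι hQ h2) ?_
  have := h4.le_finrank_coneTangentSpace
  rwa [add_zero] at this

/-- A local parametrization at a smooth point has Zariski dense image. -/
theorem IsLocalLift.mem_homIdeal_of_forall (hX : IsProjectiveVariety X) (hz : z ∈ smoothLocus X)
    (hφ : IsLocalLift X z φ) {W : Set (Fin (projDim X) → ℂ)} (hW : W ∈ 𝓝 0) {H : Forms N}
    (hH : ∀ t ∈ W, ∀ c : ℂ, eval (c • φ t) H = 0) : H ∈ homIdeal X := by
  rw [← hφ.mk_eq] at hz
  obtain ⟨j, hj⟩ := exists_apply_ne_zero hφ.base_ne_zero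
  obtain ⟨Q, ι, -, hι, hQ, -, -, hdet⟩ := exists_frame_of_mem_smoothLocus hφ.base_ne_zero hz hj
  obtain ⟨g, hg, hg0, hgX, -, -, hg4⟩ :=
    exists_chart hX ((mk_mem_smoothLocus_iff hφ.base_ne_zero).1 hz).1 hφ.base_ne_zero Q ι hι hQ hdet
  apply hg4
  have ht : Filter.Tendsto g (𝓝 0) (𝓝[cone X] (φ 0)) := by
    refine tendsto_nhdsWithin_iff.2 ⟨?_, hgX⟩
    rw [← hg0]
    exact hg.continuousAt
  filter_upwards [ht.eventually (hφ.onto W hW)] with s ⟨t, htW, c, hs⟩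
  rw [hs]
  exact hH t htW c

/-- Smooth points of a variety have local parametrizations. -/
theorem exists_isLocalLift (hX : IsProjectiveVariety X) (hz : z ∈ smoothLocus X) :
    ∃ φ, IsLocalLift X z φ := by
  set v := z.rep with hvdef
  have hv0 : v ≠ 0 := z.rep_nonzero
  have hmk : Projectivization.mk ℂ v hv0 = z := z.mk_rep
  have hz' := hz
  rw [← hmk] at hz'
  obtain ⟨j, hj⟩ := exists_apply_ne_zero hv0
  obtain ⟨Q, ι, -, hι, hQ, -, hQ0, hdet⟩ := exists_frame_of_mem_smoothLocus hv0 hz' hj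
  have hvX := ((mk_mem_smoothLocus_iff hv0).1 hz').1
  obtain ⟨g, hg, hg0, hgX, hgQ, hgon, -⟩ := exists_chart hX hvX hv0 Q ι hι hQ hdet
  -- The first coordinate of the chart is `x_j`, since `Q (ι 0) = X j`. Setting its parameter to
  -- zero cuts the cone by `x_j = v_j`, a hyperplane transverse to the line through `v`.
  let emb : (Fin (projDim X) → ℂ) →L[ℂ] (Fin (projDim X + 1) → ℂ) :=
    ContinuousLinearMap.pi (Fin.cons 0 fun k => ContinuousLinearMap.proj k)
  have hemb0 : ∀ t, emb t 0 = 0 := fun t => by simp [emb]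
  have hembs : ∀ t k, emb t (Fin.succ k) = t k := fun t k => by simp [emb]
  have hembt : Filter.Tendsto emb (𝓝 0) (𝓝 0) := by simpa using emb.continuous.tendsto 0
  let φ : (Fin (projDim X) → ℂ) → Vec N := fun t => g (emb t)
  have hφ : AnalyticAt ℂ φ 0 :=
    AnalyticAt.comp (g := g) (by rw [map_zero]; exact hg) (emb.analyticAt 0)
  have hφ0 : φ 0 = v := by simp only [φ, map_zero, hg0]
  have hφQ : ∀ᶠ t in 𝓝 0, ∀ k, eval (φ t) (Q (ι k)) = eval v (Q (ι k)) + emb t k :=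
    hembt.eventually hgQ
  have hderiv : ∀ k w, polyDeriv (Q (ι k)) v (fderiv ℂ φ 0 w) = emb w k := by
    intro k w
    have h1 : HasFDerivAt (fun t => eval (φ t) (Q (ι k)))
        ((polyDeriv (Q (ι k)) v).comp (fderiv ℂ φ 0)) 0 := by
      refine HasFDerivAt.comp (g := fun v => eval v (Q (ι k))) 0 ?_ hφ.differentiableAt.hasFDerivAt
      rw [hφ0]
      exact (hasStrictFDerivAt_eval _ v).hasFDerivAt
    have h2 : HasFDerivAt (fun t => eval v (Q (ι k)) + emb t k)
        ((ContinuousLinearMap.proj (R := ℂ) (φ := fun _ => ℂ) k).comp emb) 0 :=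
      (((ContinuousLinearMap.proj (R := ℂ) (φ := fun _ => ℂ) k).comp emb).hasFDerivAt).const_add _
    have h3 : (fun t => eval (φ t) (Q (ι k))) =ᶠ[𝓝 0] fun t => eval v (Q (ι k)) + emb t k := by
      filter_upwards [hφQ] with t ht using ht k
    have h4 := h1.unique (h2.congr_of_eventuallyEq h3)
    exact congrArg (fun L : (Fin (projDim X) → ℂ) →L[ℂ] ℂ => L w) h4
  have hQ0d : ∀ w, polyDeriv (Q (ι 0)) v w = w j := by
    intro w
    rw [hQ0, polyDeriv_apply, Finset.sum_eq_single j]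
    · simp
    · intro b _ hb
      simp [pderiv_X, hb.symm]
    · simp
  refine ⟨φ, hφ, by rwa [hφ0], by rw [hφ0]; exact rep_mem_submodule z, hembt.eventually hgX, ?_, ?_⟩
  · intro w hw
    rw [hφ0] at hw
    obtain ⟨c, hc⟩ := Submodule.mem_span_singleton.1 hw
    have h1 := hderiv 0 w
    rw [hQ0d, ← hc, hemb0] at h1
    have h2 : c = 0 := (mul_eq_zero.1 h1).resolve_right hj
    funext k
    have h3 := hderiv k.succ w
    rw [← hc, h2, zero_smul, map_zero, hembs] at h3
    exact h3.symm
  · intro W hW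
    rw [hφ0]
    -- Rescaling to `j`-th coordinate `v j` moves nearby cone vectors into the slice, where the
    -- chart has an inverse.
    let π : Vec N → Vec N := fun y => (v j * (y j)⁻¹) • y
    have hπc : ContinuousAt π v := by
      have h1 : ContinuousAt (fun y : Vec N => y j) v := (continuous_apply j).continuousAt
      exact (continuousAt_const.mul (h1.inv₀ hj)).smul continuousAt_id
    have hπv : π v = v := by simp [π, hj]
    have hπt : Filter.Tendsto π (𝓝[cone X] v) (𝓝[cone X] v) := by
      refine tendsto_nhdsWithin_iff.2 ⟨?_, ?_⟩
      · have h1 : Filter.Tendsto π (𝓝 v) (𝓝 v) := by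
          simpa only [ContinuousAt, hπv] using hπc
        exact h1.mono_left nhdsWithin_le_nhds
      · filter_upwards [self_mem_nhdsWithin] with y hy using smul_mem_cone hy _
    let θ : Vec N → Fin (projDim X) → ℂ := fun y k =>
      eval y (Q (ι k.succ)) - eval v (Q (ι k.succ))
    have hθ : Filter.Tendsto θ (𝓝[cone X] v) (𝓝 0) := by
      have h1 : ContinuousAt θ v := continuousAt_pi.2 fun k =>
        ((hasStrictFDerivAt_eval (Q (ι k.succ)) v).continuousAt).sub continuousAt_const
      have h2 : θ v = 0 := by
        funext k
        simp [θ]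
      rw [ContinuousAt, h2] at h1
      exact h1.mono_left nhdsWithin_le_nhds
    have hne : ∀ᶠ y in 𝓝[cone X] v, y j ≠ 0 :=
      eventually_nhdsWithin_of_eventually_nhds
        ((continuous_apply j).continuousAt.eventually_ne hj)
    filter_upwards [hπt.eventually hgon, (hθ.comp hπt).eventually hW, hne] with y h1 h2 h3
    refine ⟨θ (π y), h2, y j * (v j)⁻¹, ?_⟩
    have h4 : π y = φ (θ (π y)) := by
      conv_lhs => rw [h1]
      simp only [φ]
      congr 1
      funext k
      refine Fin.cases ?_ (fun k => ?_) k
      · rw [hemb0, hQ0, eval_X, eval_X]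
        simp only [π, Pi.smul_apply, smul_eq_mul]
        field_simp
        ring
      · rw [hembs]
    rw [← h4]
    simp only [π, smul_smul]
    have h5 : y j * (v j)⁻¹ * (v j * (y j)⁻¹) = 1 := by field_simp
    rw [h5, one_smul]

end SmoothLifts

/-! ### Pairwise isotropy of jet spaces and the ideal of the secant variety. -/

section Isotropy

variable {N : ℕ}

/-- The bilinear form on two arguments of the polarization of a form, the others being fixed. -/
noncomputable def pairForm {d : ℕ} (F : Forms N) {a b : Fin d} (hab : a ≠ b) (w : Fin d → Vec N) :
    Vec N →L[ℂ] Vec N →L[ℂ] ℂ :=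
  (LinearMap.mk₂ ℂ (fun x y => polarForm d F (Function.update (Function.update w a x) b y))
    (fun x x' y => by
      rw [Function.update_comm hab, Function.update_comm hab, Function.update_comm hab,
        MultilinearMap.map_update_add])
    (fun c x y => by
      rw [Function.update_comm hab, Function.update_comm hab, MultilinearMap.map_update_smul])
    (fun x y y' => by rw [MultilinearMap.map_update_add])
    (fun c x y => by rw [MultilinearMap.map_update_smul])).toContinuousBilinearMap

theorem pairForm_apply {d : ℕ} (F : Forms N) {a b : Fin d} (hab : a ≠ b) (w : Fin d → Vec N)
    (x y : Vec N) : pairForm F hab w x y =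
      polarForm d F (Function.update (Function.update w a x) b y) := rfl

theorem pairForm_symm {d : ℕ} (F : Forms N) {a b : Fin d} (hab : a ≠ b) (w : Fin d → Vec N)
    (x y : Vec N) : pairForm F hab w x y = pairForm F hab w y x := by
  rw [pairForm_apply, pairForm_apply, ← polarForm_comp_perm d F _ (Equiv.swap a b)]
  congr 1
  funext c
  by_cases hca : c = a
  · subst hca
    simp [Function.update_of_ne hab]
  · by_cases hcb : c = b
    · subst hcb
      simp [Function.update_of_ne hab]
    · simp [Equiv.swap_apply_of_ne_of_ne hca hcb, hca, hcb]

/-- The polarization of the form vanishes when two of its arguments lie in the subspace. -/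
def IsPairIsotropic (d : ℕ) (F : Forms N) (W : Submodule ℂ (Vec N)) : Prop :=
  ∀ a b : Fin d, a ≠ b → ∀ w : Fin d → Vec N, w a ∈ W → w b ∈ W → polarForm d F w = 0

/-- The polarization is symmetric and permutations act transitively on ordered pairs of distinct
indices. -/
theorem isPairIsotropic_of_pair {d : ℕ} {F : Forms N} {W : Submodule ℂ (Vec N)} {a b : Fin d}
    (hab : a ≠ b) (h : ∀ w : Fin d → Vec N, w a ∈ W → w b ∈ W → polarForm d F w = 0) :
    IsPairIsotropic d F W := by
  intro a' b' hab' w ha hb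
  let σ : Equiv.Perm (Fin d) := Equiv.swap (Equiv.swap a a' b) b' * Equiv.swap a a'
  have hσa : σ a = a' := by
    have h1 : a' ≠ Equiv.swap a a' b := by
      intro h2
      apply hab
      apply (Equiv.swap a a').injective
      rw [← h2, Equiv.swap_apply_left]
    simp only [σ, Equiv.Perm.mul_apply, Equiv.swap_apply_left]
    exact Equiv.swap_apply_of_ne_of_ne h1 hab'
  have hσb : σ b = b' := by simp [σ]
  rw [← polarForm_comp_perm d F w σ]
  exact h _ (by simpa [hσa] using ha) (by simpa [hσb] using hb)

/-- A distribution of the `q + 1` arguments over `q` points in which exactly `a` and `b` share a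
point, the prescribed one. -/
theorem exists_pair_index {q : ℕ} (i₀ : Fin q) {a b : Fin (q + 1)} (hab : a ≠ b) :
    ∃ f : Fin (q + 1) → Fin q, f a = i₀ ∧ f b = i₀ ∧ ∀ c d, c ≠ b → d ≠ b → f c = f d → c = d := by
  classical
  obtain ⟨i, hi⟩ := Fin.exists_succAbove_eq hab
  let p : Fin (q + 1) → Fin q := fun c => if h : ∃ i, b.succAbove i = c then h.choose else i
  have hp : ∀ c, c ≠ b → b.succAbove (p c) = c := by
    intro c hc
    have h : ∃ i, b.succAbove i = c := Fin.exists_succAbove_eq hc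
    simp only [p, dif_pos h]
    exact h.choose_spec
  have hpa : p a = i := Fin.succAbove_right_injective ((hp a hab).trans hi.symm)
  have hpb : p b = i := by
    have h : ¬ ∃ i, b.succAbove i = b := fun ⟨i, hi⟩ => Fin.succAbove_ne b i hi
    simp only [p, dif_neg h]
  refine ⟨fun c => Equiv.swap i i₀ (p c), by simp [hpa], by simp [hpb], fun c d hc hd h => ?_⟩
  rw [← hp c hc, ← hp d hd, (Equiv.swap i i₀).injective h]

variable {X : Set (PSpace N)}

theorem eval_zero_eq_zero {d : ℕ} {F : Forms N} (hF : F.IsHomogeneous (d + 1)) :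
    eval (0 : Vec N) F = 0 := by
  rw [← polarForm_diag (d + 1) hF]
  exact MultilinearMap.map_zero _

theorem exists_maximalTuple (hne : (smoothLocus X).Nonempty) (q k : ℕ) :
    (maximalTuples X q k).Nonempty := by
  obtain ⟨z₀, hz₀⟩ := hne
  let T : Set ℕ := {n | ∃ y : Fin q → PSpace N, (∀ i, y i ∈ smoothLocus X) ∧
    Module.finrank ℂ (oscJoin X k y) = n}
  have hT : T.Nonempty := ⟨_, fun _ => z₀, fun _ => hz₀, rfl⟩
  have hbdd : BddAbove T := ⟨N + 1, by
    rintro _ ⟨y, -, rfl⟩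
    simpa using Submodule.finrank_le (oscJoin X k y)⟩
  obtain ⟨z, hz, hzm⟩ := Nat.sSup_mem hT hbdd
  exact ⟨z, hz, fun y hy => by rw [hzm]; exact le_csSup hbdd ⟨y, hy, rfl⟩⟩

theorem eval_eq_zero_of_mem_oscJoin {q k d : ℕ} {F : Forms N} (hF : F.IsHomogeneous (d + 1))
    (hFσ : F ∈ homIdeal (secOsc X q k)) {z : Fin q → PSpace N} (hz : z ∈ maximalTuples X q k)
    {v : Vec N} (hv : v ∈ oscJoin X k z) : eval v F = 0 := by
  rcases eq_or_ne v 0 with rfl | hv0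
  · exact eval_zero_eq_zero hF
  have hmem : v ∈ (Projectivization.mk ℂ v hv0).submodule := by
    rw [Projectivization.submodule_mk]
    exact Submodule.mem_span_singleton_self v
  refine mem_homIdeal.1 hFσ v ⟨Projectivization.mk ℂ v hv0, ?_, hmem⟩
  intro G hG w hw
  refine mem_homIdeal.1 hG w ⟨_, ⟨z, hz, ?_⟩, hw⟩
  rw [Projectivization.submodule_mk, Submodule.span_singleton_le_iff_mem]
  exact hv

/-- A linear form vanishing on the image vanishes on all of `X` by Zariski density, hence is zero by
nondegeneracy. -/
theorem IsLocalLift.span_image_eq_top (hX : IsProjectiveVariety X) (hnd : IsNondegenerate X)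
    {z : PSpace N} (hz : z ∈ smoothLocus X) {φ : (Fin (projDim X) → ℂ) → Vec N}
    (hφ : IsLocalLift X z φ) {W : Set (Fin (projDim X) → ℂ)} (hW : W ∈ 𝓝 0) :
    Submodule.span ℂ (φ '' W) = ⊤ := by
  rw [eq_top_iff]
  refine le_of_forall_clm fun L hL => ?_
  let H : Forms N := ∑ m, C (L (Pi.single m 1)) * MvPolynomial.X m
  have hH : ∀ v : Vec N, eval v H = L v := by
    intro v
    have : L v = L (∑ i, v i • Pi.single i 1) := by rw [← pi_eq_sum_univ' v]
    rw [this, map_sum]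
    simp [mul_comm]
  have hHX : H ∈ homIdeal X := by
    refine hφ.mem_homIdeal_of_forall hX hz hW fun t ht c => ?_
    rw [hH, map_smul, hL _ (Submodule.subset_span ⟨t, ht, rfl⟩), smul_zero]
  have hle : Submodule.span ℂ (cone X) ≤ LinearMap.ker (L : Vec N →ₗ[ℂ] ℂ) := by
    rw [Submodule.span_le]
    intro v hv
    have := mem_homIdeal.1 hHX v hv
    rwa [hH] at this
  rw [hnd] at hle
  exact fun w hw => hle hw

theorem apply_mem_jetSpan {n : ℕ} (φ : (Fin n → ℂ) → Vec N) (k : ℕ) : φ 0 ∈ jetSpan φ k :=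
  Submodule.subset_span ⟨0, Nat.zero_le _, Fin.elim0, by simp⟩

/-- Forms vanishing on the secant variety of osculating spaces are isotropic for the jet spaces at
the points of some local parametrization. -/
theorem exists_isPairIsotropic_jetSpan (hX : IsProjectiveVariety X) (hnd : IsNondegenerate X)
    (hne : (smoothLocus X).Nonempty) {q k : ℕ} (hq : 1 ≤ q) {F : Forms N}
    (hF : F.IsHomogeneous (q + 1)) (hFσ : F ∈ homIdeal (secOsc X q k)) :
    ∃ z ∈ smoothLocus X, ∃ φ, IsLocalLift X z φ ∧
      ∀ᶠ τ in 𝓝 0, IsPairIsotropic (q + 1) F (jetSpan (fun t => φ (τ + t)) k) := by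
  obtain ⟨z, hz, hmax⟩ := exists_maximalTuple hne q k
  choose φ hφ using fun i => exists_isLocalLift hX (hz i)
  have hnear : ∀ᶠ τ in 𝓝 (0 : Fin q → Fin (projDim X) → ℂ), ∀ i, ∃ h : φ i (τ i) ≠ 0,
      Projectivization.mk ℂ (φ i (τ i)) h ∈ smoothLocus X ∧
      IsLocalLift X (Projectivization.mk ℂ (φ i (τ i)) h) fun t => φ i (τ i + t) := by
    rw [Filter.eventually_all]
    intro i
    exact ((continuous_apply i).tendsto (0 : Fin q → Fin (projDim X) → ℂ)).eventually
      ((hφ i).eventually_mem_smoothLocus (hz i))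
  -- By lower semicontinuity of the dimension, all tuples of parameters near the maximal tuple are
  -- again maximal, so `F` vanishes on the spans of their osculating spaces.
  have hzero : ∀ᶠ τ in 𝓝 (0 : Fin q → Fin (projDim X) → ℂ), ∀ w : Fin (q + 1) → Vec N,
      (∀ c, w c ∈ (⨆ i, jetSpan (fun t => φ i (τ i + t)) k : Submodule ℂ (Vec N))) →
        polarForm (q + 1) F w = 0 := by
    filter_upwards [hnear, eventually_finrank_iSup_jetSpan_le (fun i => (hφ i).analyticAt) k]
      with τ h1 h2
    choose h3 h4 h5 using h1
    have h6 : oscJoin X k (fun i => Projectivization.mk ℂ (φ i (τ i)) (h3 i)) =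
        ⨆ i, jetSpan (fun t => φ i (τ i + t)) k := iSup_congr fun i => (h5 i).oscSpace_eq k
    have h7 : oscJoin X k z = ⨆ i, jetSpan (φ i) k := iSup_congr fun i => (hφ i).oscSpace_eq k
    have h8 : (fun i => Projectivization.mk ℂ (φ i (τ i)) (h3 i)) ∈ maximalTuples X q k := by
      refine ⟨h4, fun y hy => (hmax y hy).trans ?_⟩
      rw [h6, h7]
      exact h2
    intro w hw
    refine polarForm_eq_zero (oscJoin X k fun i => Projectivization.mk ℂ (φ i (τ i)) (h3 i)) _ F
      (fun v hv => eval_eq_zero_of_mem_oscJoin hF hFσ h8 hv) w ?_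
    rw [h6]
    exact hw
  obtain ⟨r, hr, hball⟩ := Metric.eventually_nhds_iff_ball.1 hzero
  let i₀ : Fin q := ⟨0, hq⟩
  refine ⟨z i₀, hz i₀, φ i₀, hφ i₀, ?_⟩
  filter_upwards [Metric.ball_mem_nhds (0 : Fin (projDim X) → ℂ) hr] with τ hτ a b hab w hwa hwb
  obtain ⟨f, hfa, hfb, hf⟩ := exists_pair_index i₀ hab
  -- The arguments other than `a` and `b` are unrestricted, but points of small parametrized pieces
  -- already span, so they may be assumed to be such points.
  let S : Fin (q + 1) → Set (Vec N) := fun c =>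
    if c = a ∨ c = b then jetSpan (fun t => φ i₀ (τ + t)) k else φ (f c) '' Metric.ball 0 r
  refine MultilinearMap.eq_zero_of_mem_span (polarForm (q + 1) F) S ?_ w ?_
  · intro w hw
    have hex : ∀ c, ∃ t ∈ Metric.ball (0 : Fin (projDim X) → ℂ) r,
        (c = a ∨ c = b → t = τ) ∧ w c ∈ jetSpan (fun s => φ (f c) (t + s)) k := by
      intro c
      have := hw c
      by_cases hc : c = a ∨ c = b
      · simp only [S, if_pos hc] at this
        refine ⟨τ, hτ, fun _ => rfl, ?_⟩
        have hfc : f c = i₀ := by rcases hc with rfl | rfl <;> assumption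
        rw [hfc]
        exact this
      · simp only [S, if_neg hc] at this
        obtain ⟨t, ht, htw⟩ := this
        refine ⟨t, ht, fun h => absurd h hc, ?_⟩
        rw [← htw]
        have := apply_mem_jetSpan (fun s => φ (f c) (t + s)) k
        rwa [add_zero] at this
    choose t ht htτ htw using hex
    classical
    -- The parameters are transported to the `q` points through `f`. This is well defined since `f`
    -- is injective away from `b`, and `a`, `b` have the same parameter `τ`.
    let T : Fin q → Fin (projDim X) → ℂ := fun i =>
      if h : ∃ c, c ≠ b ∧ f c = i then t h.choose else 0
    have hT : ∀ c, T (f c) = t c := by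
      have key : ∀ c, c ≠ b → T (f c) = t c := by
        intro c hc
        have h : ∃ c', c' ≠ b ∧ f c' = f c := ⟨c, hc, rfl⟩
        simp only [T, dif_pos h]
        rw [hf _ _ h.choose_spec.1 hc h.choose_spec.2]
      intro c
      by_cases hc : c = b
      · rw [hc, hfb, ← hfa, key a hab, htτ a (Or.inl rfl), htτ b (Or.inr rfl)]
      · exact key c hc
    refine hball T ?_ w fun c => ?_
    · rw [mem_ball_zero_iff, pi_norm_lt_iff hr]
      intro i
      simp only [T]
      split_ifs with h
      · exact mem_ball_zero_iff.1 (ht _)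
      · simpa using hr
    · refine Submodule.mem_iSup_of_mem (f c) ?_
      rw [hT]
      exact htw c
  · intro c
    by_cases hc : c = a ∨ c = b
    · simp only [S, if_pos hc, Submodule.span_eq]
      rcases hc with rfl | rfl <;> assumption
    · simp only [S, if_neg hc]
      rw [(hφ (f c)).span_image_eq_top hX hnd (hz _) (Metric.ball_mem_nhds _ hr)]
      trivial

/-- Forms isotropic for all jet spaces vanish on the secant variety of osculating spaces. -/
theorem mem_homIdeal_secOsc_of_isPairIsotropic (hX : IsProjectiveVariety X) {q k : ℕ} {F : Forms N}
    (hF : F.IsHomogeneous (q + 1)) (h : ∀ z ∈ smoothLocus X, ∀ φ, IsLocalLift X z φ →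
      IsPairIsotropic (q + 1) F (jetSpan φ k)) : F ∈ homIdeal (secOsc X q k) := by
  have key : ∀ z ∈ maximalTuples X q k, ∀ v ∈ oscJoin X k z, eval v F = 0 := by
    intro z hz v hv
    rw [← polarForm_diag (q + 1) hF]
    refine MultilinearMap.eq_zero_of_mem_span (polarForm (q + 1) F)
      (fun _ => ⋃ i, (oscSpace X k (z i) : Set (Vec N))) ?_ _ fun _ => ?_
    · intro w hw
      choose f hf using fun c => Set.mem_iUnion.1 (hw c)
      -- The pigeonhole principle: `q + 1` arguments and only `q` osculating spaces.
      obtain ⟨a, b, hab, hfab⟩ := Fintype.exists_ne_map_eq_of_card_lt f (by simp)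
      obtain ⟨φ, hφ⟩ := exists_isLocalLift hX (hz.1 (f a))
      have hosc := hφ.oscSpace_eq k
      refine h _ (hz.1 (f a)) φ hφ a b hab w ?_ ?_
      · rw [← hosc]
        exact hf a
      · rw [← hosc, hfab]
        exact hf b
    · rw [Submodule.span_iUnion]
      simpa [oscJoin] using hv
  refine mem_homIdeal.2 fun v hv => ?_
  obtain ⟨p, hp, hvp⟩ := hv
  refine hp F (mem_homIdeal.2 ?_) v hvp
  rintro w ⟨y, ⟨z, hz, hy⟩, hw⟩
  exact key z hz w (hy hw)

end Isotropy

/-! ### Passing between cone vectors and the affine charts of the product. -/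

section NormalCoordinates

variable {N d : ℕ} {X A U : Set (PSpace N)} {E : Type*} [NormedAddCommGroup E] [NormedSpace ℂ E]

theorem eventually_mem_cone_of_isOpen (hA : IsZariskiClosed A) (hU : U = X \ A) {u : Vec N}
    (hu : u ∈ cone U) (hu0 : u ≠ 0) : ∀ᶠ v in 𝓝[cone X] u, v ∈ cone U := by
  obtain ⟨F, hF, hFu⟩ : ∃ F ∈ homIdeal A, eval u F ≠ 0 := by
    by_contra! h
    have h1 := (mem_cone_iff_mk hu0).1 (mem_cone_of_forall_eval_eq_zero hA hu0 h)
    have h2 := (mem_cone_iff_mk hu0).1 hu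
    rw [hU] at h2
    exact h2.2 h1
  have h1 : ∀ᶠ v in 𝓝 u, eval v F ≠ 0 :=
    (hasStrictFDerivAt_eval F u).continuousAt.eventually_ne hFu
  filter_upwards [self_mem_nhdsWithin, eventually_nhdsWithin_of_eventually_nhds h1] with v h2 h3
  obtain ⟨z, hz, hv⟩ := h2
  refine ⟨z, ?_, hv⟩
  rw [hU]
  exact ⟨hz, fun hzA => h3 (mem_homIdeal.1 hF v ⟨z, hzA, hv⟩)⟩

theorem eval_normalCoord_polarization (j : Fin d → Fin (N + 1)) (F : Forms N) (u : Fin d → Vec N) :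
    eval (normalCoord j u) (polarization d F) = (∏ c, (u c (j c))⁻¹) * polarForm d F u := by
  rw [eval_polarization, ← smul_eq_mul, ← MultilinearMap.map_smul_univ]
  rfl

theorem normalCoord_congr (j : Fin d → Fin (N + 1)) {u u' : Fin d → Vec N}
    (h : ∀ c, ∃ e : ℂ, e ≠ 0 ∧ u c = e • u' c) : normalCoord j u = normalCoord j u' := by
  funext ⟨c, m⟩
  obtain ⟨e, he, hc⟩ := h c
  simp only [normalCoord, hc, Pi.smul_apply, smul_eq_mul, mul_inv]
  field_simp

theorem analyticAt_normalCoord (j : Fin d → Fin (N + 1)) {v : E → Fin d → Vec N} {p₀ : E}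
    (hv : ∀ c, AnalyticAt ℂ (fun p => v p c) p₀) (hv0 : ∀ c, v p₀ c (j c) ≠ 0) :
    AnalyticAt ℂ (fun p => normalCoord j (v p)) p₀ := by
  have hcoord : ∀ c m, AnalyticAt ℂ (fun p => v p c m) p₀ := fun c m =>
    ((ContinuousLinearMap.proj (R := ℂ) (φ := fun _ : Fin (N + 1) => ℂ) m).analyticAt _).comp (hv c)
  exact AnalyticAt.pi fun x => ((hcoord x.1 (j x.1)).inv (hv0 x.1)).mul (hcoord x.1 x.2)

theorem eventually_normalCoord_mem_boxChart {T : Type*} [TopologicalSpace T]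
    (hA : IsZariskiClosed A) (hU : U = X \ A)
    (j : Fin d → Fin (N + 1)) {v : T → Fin d → Vec N} {p₀ : T}
    (hv : ∀ c, ContinuousAt (fun p => v p c) p₀) (hX : ∀ c, ∀ᶠ p in 𝓝 p₀, v p c ∈ cone X)
    (hvU : ∀ c, v p₀ c ∈ cone U) (hv0 : ∀ c, v p₀ c (j c) ≠ 0) :
    ∀ᶠ p in 𝓝 p₀, normalCoord j (v p) ∈ boxChart U j := by
  have h1 : ∀ c, ∀ᶠ p in 𝓝 p₀, v p c ∈ cone U ∧ v p c (j c) ≠ 0 := by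
    intro c
    have h2 : Filter.Tendsto (fun p => v p c) (𝓝 p₀) (𝓝[cone X] (v p₀ c)) :=
      tendsto_nhdsWithin_iff.2 ⟨hv c, hX c⟩
    have h3 : v p₀ c ≠ 0 := fun h => hv0 c (by rw [h]; rfl)
    have h4 : ContinuousAt (fun p => v p c (j c)) p₀ :=
      ContinuousAt.comp (g := fun w : Vec N => w (j c)) (continuous_apply (j c)).continuousAt (hv c)
    exact (h2.eventually (eventually_mem_cone_of_isOpen hA hU (hvU c) h3)).and
      (h4.eventually_ne (hv0 c))
  filter_upwards [Filter.eventually_all.2 h1] with p hp using normalCoord_mem_boxChart hp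

theorem analyticAt_eval_mvPolynomial {σ : Type*} [Fintype σ] (g : MvPolynomial σ ℂ) {x : E → σ → ℂ}
    {p₀ : E} (hx : AnalyticAt ℂ x p₀) : AnalyticAt ℂ (fun p => eval (x p) g) p₀ :=
  AnalyticAt.comp (g := fun v => eval v g) (AnalyticOnNhd.eval_mvPolynomial g _ (Set.mem_univ _)) hx

/-- Each element of `P` contributes one order of vanishing, since its pullback is differentiable and
zero at the base point. -/
theorem isBigO_eval_of_mem_pow {σ : Type*} [Fintype σ] {x : E → σ → ℂ} (hx : AnalyticAt ℂ x 0)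
    (P : Ideal (MvPolynomial σ ℂ)) (hP : ∀ g ∈ P, eval (x 0) g = 0) (ℓ : ℕ) :
    ∀ g ∈ P ^ ℓ, (fun p => eval (x p) g) =O[𝓝 0] fun p => ‖p‖ ^ ℓ := by
  have hone : ∀ g, (fun p => eval (x p) g) =O[𝓝 0] fun _ => (1 : ℝ) := fun g =>
    (analyticAt_eval_mvPolynomial g hx).continuousAt.isBigO_one ℝ
  let I : ℕ → Ideal (MvPolynomial σ ℂ) := fun r =>
    { carrier := {g | (fun p => eval (x p) g) =O[𝓝 0] fun p => ‖p‖ ^ r}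
      add_mem' := by
        intro a b ha hb
        have := Asymptotics.IsBigO.add ha hb
        simpa only [Set.mem_ofPred_eq, map_add] using this
      zero_mem' := by
        simp only [Set.mem_ofPred_eq, map_zero]
        exact Asymptotics.isBigO_zero _ _
      smul_mem' := by
        intro c a ha
        have := (hone c).mul ha
        simpa only [Set.mem_ofPred_eq, smul_eq_mul, map_mul, one_mul] using this }
  have hI : ∀ r g, g ∈ I r ↔ (fun p => eval (x p) g) =O[𝓝 0] fun p => ‖p‖ ^ r := fun _ _ => Iff.rfl
  have hPI : ∀ g ∈ P, (fun p => eval (x p) g) =O[𝓝 0] fun p => ‖p‖ := by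
    intro g hg
    have := (analyticAt_eval_mvPolynomial g hx).differentiableAt.isBigO_sub
    rw [hP g hg] at this
    simpa using this.norm_right
  induction ℓ with
  | zero =>
    intro g _
    simpa using hone g
  | succ ℓ ih =>
    have hle : P ^ (ℓ + 1) ≤ I (ℓ + 1) := by
      rw [pow_succ]
      refine Ideal.mul_le.2 fun a ha b hb => ?_
      rw [hI]
      simp only [map_mul, pow_succ]
      exact (ih a ha).mul (hPI b hb)
    exact fun g hg => hle hg

theorem IsLocalLift.exists_eval_ne_zero {z : PSpace N} {φ : (Fin (projDim X) → ℂ) → Vec N}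
    (hX : IsProjectiveVariety X) (hz : z ∈ smoothLocus X) (hφ : IsLocalLift X z φ)
    {W : Set (Fin (projDim X) → ℂ)} (hW : W ∈ 𝓝 0) {H : Forms N} (hH : H ∉ homIdeal X) :
    ∃ w ∈ {v | ∃ t ∈ W, ∃ e : ℂ, v = e • φ t}, eval w H ≠ 0 := by
  by_contra! h
  exact hH (hφ.mem_homIdeal_of_forall hX hz hW fun t ht c => h _ ⟨t, ht, c, rfl⟩)

theorem IsLocalLift.exists_isOpen {z : PSpace N} {φ : (Fin (projDim X) → ℂ) → Vec N}
    (hz : z ∈ smoothLocus X) (hφ : IsLocalLift X z φ) :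
    ∃ W : Set (Fin (projDim X) → ℂ), IsOpen W ∧ 0 ∈ W ∧ ∀ τ ∈ W, ∃ y ∈ smoothLocus X,
      IsLocalLift X y fun t => φ (τ + t) := by
  obtain ⟨W, hW, hWo, h0⟩ := eventually_nhds_iff.1 (hφ.eventually_mem_smoothLocus hz)
  exact ⟨W, hWo, h0, fun τ hτ => by
    obtain ⟨h, h1, h2⟩ := hW τ hτ
    exact ⟨_, h1, h2⟩⟩

end NormalCoordinates

/-! ### From vanishing along the diagonal to isotropy. -/

section FromDiagonal

variable {N : ℕ} {X A U : Set (PSpace N)}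

theorem exists_mem_cone_of_apply_ne_zero (hX : (homIdeal X).IsPrime) (hA : IsZariskiClosed A)
    (hU : U = X \ A) (hne : U.Nonempty) {v : Vec N} (hv : v ∈ cone X) {j : Fin (N + 1)}
    (hj : v j ≠ 0) : ∃ u ∈ cone U, u j ≠ 0 := by
  obtain ⟨G, hG, hGU⟩ := exists_form_of_isOpen hX hA hU hne
  have h1 : G * MvPolynomial.X j ∉ homIdeal X := by
    intro h
    rcases hX.mem_or_mem h with h | h
    · exact hG h
    · exact hj (by simpa using mem_homIdeal.1 h v hv)
  rw [mem_homIdeal] at h1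
  push Not at h1
  obtain ⟨w, hw, hwG⟩ := h1
  rw [map_mul, eval_X] at hwG
  exact ⟨w, (hGU w hw (left_ne_zero_of_mul hwG)).1, right_ne_zero_of_mul hwG⟩

theorem jetSpan_eq_span {n : ℕ} {φ : (Fin n → ℂ) → Vec N} (hφ : AnalyticAt ℂ φ 0) (k : ℕ) :
    jetSpan φ k = Submodule.span ℂ {w | ∃ l : List (Fin n), l.length ≤ k ∧
      w = iterDir (l.map (Pi.basisFun ℂ (Fin n))) φ 0} := by
  refine le_antisymm ((jetSpan_le_iff hφ).2 fun l hl => Submodule.subset_span ⟨l, hl, rfl⟩) ?_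
  rw [Submodule.span_le]
  rintro _ ⟨l, hl, rfl⟩
  exact (jetSpan_le_iff hφ).1 le_rfl l hl

/-- Vanishing to order `2 * k + 2` along the diagonal at one tuple near which it is tested makes
the jets of order at most `k` pair to zero. -/
theorem pairForm_iterDir_eq_zero {d k : ℕ} {F : Forms N} (hA : IsZariskiClosed A) (hU : U = X \ A)
    (j : Fin d → Fin (N + 1)) {a b : Fin d} (hab : a ≠ b)
    {s : MvPolynomial (Fin d × Fin (N + 1)) ℂ}
    (hs : s * polarization d F ∈ MvPolynomial.vanishingIdeal ℂ (pairDiagonal U j a b) ^ (2 * k + 2) ⊔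
      MvPolynomial.vanishingIdeal ℂ (boxChart U j)) {y : PSpace N}
    {ψ : (Fin (projDim X) → ℂ) → Vec N} (hψ : IsLocalLift X y ψ) {u : Fin d → Vec N}
    (hua : u a = ψ 0) (hub : u b = ψ 0) (hu : ∀ c, u c ∈ cone U ∧ u c (j c) ≠ 0)
    (hsu : eval (normalCoord j u) s ≠ 0) {l l' : List (Fin (projDim X) → ℂ)}
    (hl : l.length ≤ k) (hl' : l'.length ≤ k) :
    pairForm F hab u (iterDir l ψ 0) (iterDir l' ψ 0) = 0 := by
  refine apply_iterDir_eq_zero_of_isBigO (pairForm F hab u) hψ.analyticAt hψ.analyticAt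
    (r := 2 * k + 2) ?_ l l' (by lia)
  have hUX : cone U ⊆ cone X := cone_mono (by rw [hU]; exact Set.sdiff_subset)
  -- The arguments `a` and `b` move independently along `ψ`, so the diagonal is met at the origin of
  -- the parameter space.
  let v : (Fin (projDim X) → ℂ) × (Fin (projDim X) → ℂ) → Fin d → Vec N := fun p =>
    Function.update (Function.update u a (ψ p.1)) b (ψ p.2)
  have hva : ∀ p, v p a = ψ p.1 := fun p => by simp [v, Function.update_of_ne hab]
  have hvb : ∀ p, v p b = ψ p.2 := fun p => by simp [v]
  have hvc : ∀ p c, c ≠ a → c ≠ b → v p c = u c := fun p c h1 h2 => by simp [v, h1, h2]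
  have hv0 : v 0 = u := by
    funext c
    by_cases h1 : c = a
    · rw [h1, hva, hua]; rfl
    by_cases h2 : c = b
    · rw [h2, hvb, hub]; rfl
    exact hvc _ _ h1 h2
  have hfst : AnalyticAt ℂ (fun p : (Fin (projDim X) → ℂ) × (Fin (projDim X) → ℂ) => ψ p.1) 0 :=
    AnalyticAt.comp (g := ψ) (f := Prod.fst) hψ.analyticAt analyticAt_fst
  have hsnd : AnalyticAt ℂ (fun p : (Fin (projDim X) → ℂ) × (Fin (projDim X) → ℂ) => ψ p.2) 0 :=
    AnalyticAt.comp (g := ψ) (f := Prod.snd) hψ.analyticAt analyticAt_snd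
  have hvan : ∀ c, AnalyticAt ℂ (fun p => v p c) 0 := by
    intro c
    by_cases h1 : c = a
    · subst h1; simpa only [hva] using hfst
    by_cases h2 : c = b
    · subst h2; simpa only [hvb] using hsnd
    · simp only [hvc _ c h1 h2]; exact analyticAt_const
  have hvX : ∀ c, ∀ᶠ p in 𝓝 0, v p c ∈ cone X := by
    intro c
    by_cases h1 : c = a
    · subst h1
      simp only [hva]
      exact (continuous_fst.tendsto (0 : (Fin (projDim X) → ℂ) × (Fin (projDim X) → ℂ))).eventually
        hψ.mem_cone
    by_cases h2 : c = b
    · subst h2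
      simp only [hvb]
      exact (continuous_snd.tendsto (0 : (Fin (projDim X) → ℂ) × (Fin (projDim X) → ℂ))).eventually
        hψ.mem_cone
    · simp only [hvc _ c h1 h2]
      exact Filter.Eventually.of_forall fun _ => hUX (hu c).1
  have hx : AnalyticAt ℂ (fun p => normalCoord j (v p)) 0 :=
    analyticAt_normalCoord j hvan (by rw [hv0]; exact fun c => (hu c).2)
  have hchart := eventually_normalCoord_mem_boxChart hA hU j (fun c => (hvan c).continuousAt) hvX
    (by rw [hv0]; exact fun c => (hu c).1) (by rw [hv0]; exact fun c => (hu c).2)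
  obtain ⟨g, hg, g', hg', hgg⟩ := Submodule.mem_sup.1 hs
  have h1 : (fun p => eval (normalCoord j (v p)) (s * polarization d F)) =O[𝓝 0]
      fun p => ‖p‖ ^ (2 * k + 2) := by
    refine Asymptotics.IsBigO.congr' (isBigO_eval_of_mem_pow hx _ (fun f hf => ?_) _ g hg) ?_
      Filter.EventuallyEq.rfl
    · rw [hv0]
      exact hf _ (normalCoord_mem_pairDiagonal hu (by rw [hua, hub]))
    · filter_upwards [hchart] with p hp
      have : eval (normalCoord j (v p)) g' = 0 := hg' _ hp
      rw [← hgg, map_add, this, add_zero]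
  -- The factor that removes `s` and undoes the normalization of the coordinates; it is continuous
  -- because `s` does not vanish at the base tuple.
  have h2 : (fun p => (eval (normalCoord j (v p)) s)⁻¹ * ∏ c, v p c (j c)) =O[𝓝 0]
      fun _ => (1 : ℝ) := by
    have h3 : ContinuousAt (fun p => eval (normalCoord j (v p)) s) 0 :=
      (analyticAt_eval_mvPolynomial s hx).continuousAt
    have h4 : ContinuousAt (fun p => ∏ c, v p c (j c)) 0 := by
      refine tendsto_finsetProd _ fun c _ => ?_
      exact ContinuousAt.comp (g := fun w : Vec N => w (j c)) (continuous_apply (j c)).continuousAt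
        (hvan c).continuousAt
    exact ((h3.inv₀ (by rwa [hv0])).mul h4).isBigO_one ℝ
  have h3 := h2.mul h1
  simp only [one_mul] at h3
  refine h3.congr' ?_ Filter.EventuallyEq.rfl
  have h4 : ∀ᶠ p in 𝓝 0, eval (normalCoord j (v p)) s ≠ 0 :=
    (analyticAt_eval_mvPolynomial s hx).continuousAt.eventually_ne (by rwa [hv0])
  have h5 : ∀ᶠ p in 𝓝 0, ∀ c, v p c (j c) ≠ 0 := by
    rw [Filter.eventually_all]
    intro c
    refine ContinuousAt.eventually_ne (ContinuousAt.comp (g := fun w : Vec N => w (j c))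
      (continuous_apply (j c)).continuousAt (hvan c).continuousAt) ?_
    rw [hv0]
    exact (hu c).2
  filter_upwards [h4, h5] with p h6 h7
  have h8 : ∏ c, v p c (j c) ≠ 0 := Finset.prod_ne_zero_iff.2 fun c _ => h7 c
  rw [map_mul, eval_normalCoord_polarization, pairForm_apply, Finset.prod_inv_distrib]
  change _ = polarForm d F (v p)
  field_simp

/-- The denominator `s` may vanish at the tuple under consideration. So the pairing of jets is
treated as a continuous function of all parameters: it is zero at tuples generic for `s`, and these
occur arbitrarily near the given one by Zariski density of analytic neighbourhoods. -/
theorem isPairIsotropic_of_vanishesAlongDiagonal (hX : IsProjectiveVariety X)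
    (hnd : IsNondegenerate X) (hA : IsZariskiClosed A) (hU : U = X \ A) (hne : U.Nonempty)
    {q k : ℕ} (hq : 1 ≤ q) {F : Forms N} (hF : VanishesAlongDiagonal U (q + 1) (2 * k + 2) F)
    {z : PSpace N} (hz : z ∈ smoothLocus X) {φ : (Fin (projDim X) → ℂ) → Vec N}
    (hφ : IsLocalLift X z φ) : IsPairIsotropic (q + 1) F (jetSpan φ k) := by
  obtain ⟨j₀, hj₀⟩ := exists_apply_ne_zero hφ.base_ne_zero
  -- With the same coordinate for every factor, the tuple with all entries `v₀` lies in the chart,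
  -- so the diagonal there is nonempty.
  let j : Fin (q + 1) → Fin (N + 1) := fun _ => j₀
  obtain ⟨v₀, hv₀, hv₀j⟩ :=
    exists_mem_cone_of_apply_ne_zero hX.2 hA hU hne hφ.mem_cone.self_of_nhds hj₀
  have h0last : (0 : Fin (q + 1)) ≠ Fin.last q := by
    rw [Ne, Fin.ext_iff]
    simp only [Fin.val_zero, Fin.val_last]
    lia
  obtain ⟨a, b, hab, s, hs, hsP⟩ := exists_mul_polarization_mem hX.2 hA hU hne hF j h0last
    ⟨_, normalCoord_mem_pairDiagonal (v := fun _ => v₀) (fun _ => ⟨hv₀, hv₀j⟩) rfl⟩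
  obtain ⟨W, hWo, hW0, hW⟩ := hφ.exists_isOpen hz
  refine isPairIsotropic_of_pair hab fun w hwa hwb => ?_
  let J : Set (Vec N) := {w | ∃ l : List (Fin (projDim X)), l.length ≤ k ∧
      w = iterDir (l.map (Pi.basisFun ℂ (Fin (projDim X)))) φ 0}
  refine MultilinearMap.eq_zero_of_mem_span (polarForm (q + 1) F)
    (fun c => if c = a ∨ c = b then J else φ '' W) ?_ w ?_
  swap
  · intro c
    by_cases hc : c = a ∨ c = b
    · simp only [if_pos hc, J]
      rw [← jetSpan_eq_span hφ.analyticAt]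
      rcases hc with rfl | rfl <;> assumption
    · simp only [if_neg hc]
      rw [hφ.span_image_eq_top hX hnd hz (hWo.mem_nhds hW0)]
      trivial
  clear hwa hwb w
  intro w hw
  obtain ⟨l, hl, hwa⟩ : w a ∈ J := by simpa using hw a
  obtain ⟨l', hl', hwb⟩ : w b ∈ J := by simpa using hw b
  have hwc : ∀ c, ∃ t ∈ W, (c = a ∨ c = b → t = 0) ∧ (¬ (c = a ∨ c = b) → w c = φ t) := by
    intro c
    by_cases hc : c = a ∨ c = b
    · exact ⟨0, hW0, fun _ => rfl, fun h => absurd hc h⟩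
    · have := hw c
      simp only [if_neg hc] at this
      obtain ⟨t, ht, htw⟩ := this
      exact ⟨t, ht, fun h => absurd h hc, fun _ => htw.symm⟩
  choose T₀ hT₀W hT₀ hT₀w using hwc
  set D := iterDir (l.map (Pi.basisFun ℂ (Fin (projDim X)))) φ with hD
  set D' := iterDir (l'.map (Pi.basisFun ℂ (Fin (projDim X)))) φ with hD'
  let Ψ : (Fin (q + 1) → Fin (projDim X) → ℂ) → Fin (q + 1) → Vec N := fun T =>
    Function.update (Function.update (fun c => φ (T c)) a (D (T a))) b (D' (T a))
  have hΨa : ∀ T, Ψ T a = D (T a) := fun T => by simp [Ψ, Function.update_of_ne hab]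
  have hΨb : ∀ T, Ψ T b = D' (T a) := fun T => by simp [Ψ]
  have hΨc : ∀ T c, c ≠ a → c ≠ b → Ψ T c = φ (T c) := fun T c h1 h2 => by simp [Ψ, h1, h2]
  have hΨ₀ : Ψ T₀ = w := by
    funext c
    by_cases h1 : c = a
    · rw [h1, hΨa, hT₀ a (Or.inl rfl), hwa]
    by_cases h2 : c = b
    · rw [h2, hΨb, hT₀ a (Or.inl rfl), hwb]
    · rw [hΨc _ _ h1 h2, hT₀w c (by tauto)]
  have hφan : ∀ t ∈ W, AnalyticAt ℂ φ t := by
    intro t ht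
    obtain ⟨y, -, hy⟩ := hW t ht
    have h1 : AnalyticAt ℂ (fun x : Fin (projDim X) → ℂ => x - t) t :=
      analyticAt_id.sub analyticAt_const
    have h2 := AnalyticAt.comp (g := fun s => φ (t + s)) (f := fun x => x - t) (x := t)
      (by simpa using hy.analyticAt) h1
    simpa [Function.comp_def] using h2
  have hΨcont : ContinuousAt Ψ T₀ := by
    have happ : ∀ c (g : (Fin (projDim X) → ℂ) → Vec N), ContinuousAt g (T₀ c) →
        ContinuousAt (fun T : Fin (q + 1) → Fin (projDim X) → ℂ => g (T c)) T₀ := fun c g hg =>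
      ContinuousAt.comp (g := g) hg (continuous_apply c).continuousAt
    refine continuousAt_pi.2 fun c => ?_
    by_cases h1 : c = a
    · subst h1
      simp only [hΨa]
      exact happ _ D (analyticAt_iterDir (hφan _ (hT₀W _)) _).continuousAt
    by_cases h2 : c = b
    · subst h2
      simp only [hΨb]
      exact happ _ D' (analyticAt_iterDir (hφan _ (hT₀W _)) _).continuousAt
    · simp only [hΨc _ _ h1 h2]
      exact happ c φ (hφan _ (hT₀W c)).continuousAt
  have hpol : ContinuousAt (fun T => polarForm (q + 1) F (Ψ T)) T₀ := by
    have h1 : ∀ T, polarForm (q + 1) F (Ψ T) =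
        eval (fun x : Fin (q + 1) × Fin (N + 1) => Ψ T x.1 x.2) (polarization (q + 1) F) :=
      fun T => (eval_polarization (q + 1) F fun x => Ψ T x.1 x.2).symm
    simp only [h1]
    refine ContinuousAt.comp (g := fun x => eval x (polarization (q + 1) F))
      (MvPolynomial.continuous_eval _).continuousAt ?_
    refine continuousAt_pi.2 fun x => ?_
    exact (continuousAt_pi.1 ((continuousAt_pi.1 hΨcont) x.1)) x.2
  -- A nonzero value at `T₀` would persist on a ball, which contains generic parameters.
  by_contra hcon
  obtain ⟨r, hr, hball⟩ := Metric.eventually_nhds_iff_ball.1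
    (hpol.eventually_ne (by rwa [hΨ₀]))
  let S : Fin (q + 1) → Set (Vec N) := fun c =>
    {v | ∃ t ∈ W ∩ Metric.ball (T₀ c) r, ∃ e : ℂ, v = e • φ t}
  have hSX : ∀ c, S c ⊆ cone X := by
    rintro c _ ⟨t, ht, e, rfl⟩
    obtain ⟨y, -, hy⟩ := hW t ht.1
    refine smul_mem_cone ?_ e
    simpa using hy.mem_cone.self_of_nhds
  have hSd : ∀ c, ∀ H : Forms N, H ∉ homIdeal X → ∃ w ∈ S c, eval w H ≠ 0 := by
    intro c H hH
    obtain ⟨y, hy, hyl⟩ := hW (T₀ c) (hT₀W c)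
    have hnhds : {t | T₀ c + t ∈ W ∩ Metric.ball (T₀ c) r} ∈ 𝓝 0 := by
      have h1 : Filter.Tendsto (fun t => T₀ c + t) (𝓝 0) (𝓝 (T₀ c)) := by
        simpa using (continuous_const_add (T₀ c)).tendsto 0
      exact h1 (Filter.inter_mem (hWo.mem_nhds (hT₀W c)) (Metric.ball_mem_nhds _ hr))
    obtain ⟨w, ⟨t, ht, e, rfl⟩, hw⟩ := hyl.exists_eval_ne_zero hX hy hnhds hH
    exact ⟨_, ⟨_, ht, e, rfl⟩, hw⟩
  obtain ⟨u, huS, hub, hu, hsu, -⟩ :=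
    exists_generic_on_pairDiagonal hX.2 hA hU hne j a b S hSX hSd s s hs hs
  have huS' : ∀ c, ∃ t ∈ Metric.ball (T₀ c) r, c ≠ b → t ∈ W ∧ ∃ e : ℂ, e ≠ 0 ∧ u c = e • φ t := by
    intro c
    by_cases hc : c = b
    · exact ⟨T₀ c, Metric.mem_ball_self hr, fun h => absurd hc h⟩
    · obtain ⟨t, ht, e, he⟩ := huS c hc
      refine ⟨t, ht.2, fun _ => ⟨ht.1, e, ?_, he⟩⟩
      rintro rfl
      exact (hu c).2 (by rw [he, zero_smul]; rfl)
  choose T hTball hT using huS'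
  obtain ⟨hTW, e, he, hua⟩ := hT a hab
  obtain ⟨y, hy, hyl⟩ := hW (T a) hTW
  -- Genericity yields vectors known only up to scalars; the entries `a` and `b` are rescaled to lie
  -- exactly on the parametrization, leaving the chart point unchanged.
  let u' : Fin (q + 1) → Vec N := Function.update (Function.update u a (φ (T a))) b (φ (T a))
  have hu'a : u' a = φ (T a) := by simp [u', Function.update_of_ne hab]
  have hu'b : u' b = φ (T a) := by simp [u']
  have hu'c : ∀ c, c ≠ a → c ≠ b → u' c = u c := fun c h1 h2 => by simp [u', h1, h2]
  have huu' : ∀ c, ∃ e : ℂ, e ≠ 0 ∧ u' c = e • u c := by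
    intro c
    by_cases h1 : c = a
    · subst h1
      exact ⟨e⁻¹, inv_ne_zero he, by rw [hu'a, hua, inv_smul_smul₀ he]⟩
    by_cases h2 : c = b
    · subst h2
      exact ⟨e⁻¹, inv_ne_zero he, by rw [hu'b, hub, hua, inv_smul_smul₀ he]⟩
    · exact ⟨1, one_ne_zero, by rw [hu'c c h1 h2, one_smul]⟩
  have hzero := pairForm_iterDir_eq_zero hA hU j hab hsP hyl (u := u')
    (by rw [hu'a, add_zero]) (by rw [hu'b, add_zero]) (fun c => by
      obtain ⟨e, he, hc⟩ := huu' c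
      rw [hc]
      exact ⟨smul_mem_cone (hu c).1 e, mul_ne_zero he (hu c).2⟩)
    (by rwa [normalCoord_congr j huu'])
    (l := l.map (Pi.basisFun ℂ (Fin (projDim X)))) (l' := l'.map (Pi.basisFun ℂ (Fin (projDim X))))
    (by simpa using hl) (by simpa using hl')
  rw [iterDir_comp_add_left, iterDir_comp_add_left] at hzero
  beta_reduce at hzero
  rw [add_zero, ← hD, ← hD', pairForm_apply] at hzero
  have hscale : ∀ c, ∃ e : ℂ, e ≠ 0 ∧
      Function.update (Function.update u' a (D (T a))) b (D' (T a)) c = e • Ψ T c := by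
    intro c
    by_cases h1 : c = a
    · subst h1
      exact ⟨1, one_ne_zero, by rw [hΨa]; simp [Function.update_of_ne hab]⟩
    by_cases h2 : c = b
    · subst h2
      exact ⟨1, one_ne_zero, by rw [hΨb]; simp⟩
    · obtain ⟨-, e, he, hc⟩ := hT c h2
      exact ⟨e, he, by rw [hΨc _ _ h1 h2, ← hc, ← hu'c c h1 h2]; simp [h1, h2]⟩
  choose ε hε0 hε using hscale
  rw [funext hε, MultilinearMap.map_smul_univ, smul_eq_mul] at hzero
  have hT' : T ∈ Metric.ball T₀ r := by
    rw [Metric.mem_ball, dist_pi_lt_iff hr]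
    exact fun c => hTball c
  exact hball T hT' ((mul_eq_zero.1 hzero).resolve_left
    (Finset.prod_ne_zero_iff.2 fun c _ => hε0 c))

end FromDiagonal

/-! ### Generators of the ideal of the diagonal. -/

section DiagonalEquations

variable {N d : ℕ} {X A U : Set (PSpace N)}

theorem mem_vanishingIdeal_iff_eval {σ : Type*} {Y : Set (σ → ℂ)} {g : MvPolynomial σ ℂ} :
    g ∈ MvPolynomial.vanishingIdeal ℂ Y ↔ ∀ x ∈ Y, eval x g = 0 := by
  rw [mem_vanishingIdeal_iff]
  rfl

/-- Equations of the diagonal `x_a = x_b` in a chart of `U^d`. -/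
noncomputable def diagDiff (j : Fin d → Fin (N + 1)) (a b : Fin d) (m : Fin (N + 1)) :
    MvPolynomial (Fin d × Fin (N + 1)) ℂ :=
  MvPolynomial.X (b, m) - MvPolynomial.X (b, j a) * MvPolynomial.X (a, m)

theorem eval_diagDiff (j : Fin d → Fin (N + 1)) (a b : Fin d) (m : Fin (N + 1))
    (x : Fin d × Fin (N + 1) → ℂ) :
    eval x (diagDiff j a b m) = x (b, m) - x (b, j a) * x (a, m) := by
  simp [diagDiff]

theorem eval_diagDiff_eq_zero {j : Fin d → Fin (N + 1)} {a b : Fin d}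
    {x : Fin d × Fin (N + 1) → ℂ} (hx : x ∈ pairDiagonal U j a b) (m : Fin (N + 1)) :
    eval x (diagDiff j a b m) = 0 := by
  obtain ⟨v, hv, hab, rfl⟩ := exists_eq_normalCoord hx
  rw [eval_diagDiff]
  simp only [normalCoord, hab]
  have := (hv a).2
  field_simp
  ring

/-- Modulo the equations, `x_b` can be replaced by `x_a` divided by its `j b`-th coordinate `κ`. The
inverse of `κ` is the polynomial `u`, so clearing denominators loses nothing. -/
theorem mem_span_diagDiff_sup {j : Fin d → Fin (N + 1)} {a b : Fin d} (hab : a ≠ b)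
    {f : MvPolynomial (Fin d × Fin (N + 1)) ℂ}
    (hf : f ∈ MvPolynomial.vanishingIdeal ℂ (pairDiagonal U j a b)) :
    f ∈ Ideal.span (Set.range (diagDiff j a b)) ⊔ MvPolynomial.vanishingIdeal ℂ (boxChart U j) := by
  classical
  obtain ⟨κ, hκ⟩ : ∃ κ : MvPolynomial (Fin d × Fin (N + 1)) ℂ, κ = MvPolynomial.X (a, j b) :=
    ⟨_, rfl⟩
  obtain ⟨u, hu⟩ : ∃ u : MvPolynomial (Fin d × Fin (N + 1)) ℂ, u = MvPolynomial.X (b, j a) :=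
    ⟨_, rfl⟩
  obtain ⟨K, hK⟩ : ∃ K, K = Ideal.span (Set.range (diagDiff j a b)) ⊔
    MvPolynomial.vanishingIdeal ℂ (boxChart U j) := ⟨_, rfl⟩
  have hδ : ∀ m, diagDiff j a b m ∈ K := fun m => by
    rw [hK]
    exact Ideal.mem_sup_left (Ideal.subset_span ⟨m, rfl⟩)
  have hI₀ : ∀ g, (∀ x ∈ boxChart U j, eval x g = 0) → g ∈ K := fun g hg => by
    rw [hK]
    exact Ideal.mem_sup_right (mem_vanishingIdeal_iff_eval.2 hg)
  rw [← hK]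
  have huκ : u * κ - 1 ∈ K := by
    have h1 : (MvPolynomial.X (b, j b) - 1 : MvPolynomial (Fin d × Fin (N + 1)) ℂ) ∈ K :=
      hI₀ _ fun x hx => by simp [(hx b).1]
    have h2 : u * κ - 1 = (MvPolynomial.X (b, j b) - 1) - diagDiff j a b (j b) := by
      simp only [diagDiff, hu, hκ]
      ring
    rw [h2]
    exact sub_mem h1 (hδ _)
  -- The projection of a chart point with `κ ≠ 0` onto the diagonal.
  let x' : (Fin d × Fin (N + 1) → ℂ) → Fin d × Fin (N + 1) → ℂ := fun x i =>
    if i.1 = b then (x (a, j b))⁻¹ * x (a, i.2) else x i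
  have key : ∀ f : MvPolynomial (Fin d × Fin (N + 1)) ℂ, ∃ (e : ℕ) (g : MvPolynomial _ ℂ),
      (∀ x, x (a, j b) ≠ 0 → eval x g = x (a, j b) ^ e * eval (x' x) f) ∧ κ ^ e * f - g ∈ K := by
    intro f
    induction f using MvPolynomial.induction_on with
    | C c => exact ⟨0, C c, fun x _ => by simp, by simp⟩
    | add p p' hp hp' =>
      obtain ⟨e, g, hg, hgK⟩ := hp
      obtain ⟨e', g', hg', hgK'⟩ := hp'
      refine ⟨e + e', g * κ ^ e' + g' * κ ^ e, fun x hx => ?_, ?_⟩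
      · simp only [map_add, map_mul, map_pow, hg x hx, hg' x hx, hκ, eval_X]
        ring
      · have h1 : κ ^ (e + e') * (p + p') - (g * κ ^ e' + g' * κ ^ e) =
            κ ^ e' * (κ ^ e * p - g) + κ ^ e * (κ ^ e' * p' - g') := by ring
        rw [h1]
        exact add_mem (Ideal.mul_mem_left _ _ hgK) (Ideal.mul_mem_left _ _ hgK')
    | mul_X p i hp =>
      obtain ⟨e, g, hg, hgK⟩ := hp
      by_cases hi : i.1 = b
      · refine ⟨e + 1, g * MvPolynomial.X (a, i.2), fun x hx => ?_, ?_⟩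
        · have h1 : x' x i = (x (a, j b))⁻¹ * x (a, i.2) := if_pos hi
          rw [map_mul, map_mul, hg x hx, eval_X, eval_X, h1]
          generalize eval (x' x) p = y
          field_simp
          ring
        · have h1 : i = (b, i.2) := by rw [← hi]
          have h2 : κ * MvPolynomial.X i - MvPolynomial.X (a, i.2) =
              κ * diagDiff j a b i.2 + (u * κ - 1) * MvPolynomial.X (a, i.2) := by
            rw [h1]
            simp only [diagDiff, hu]
            ring
          have h3 : κ * MvPolynomial.X i - MvPolynomial.X (a, i.2) ∈ K := by
            rw [h2]
            exact add_mem (Ideal.mul_mem_left _ _ (hδ _)) (Ideal.mul_mem_right _ _ huκ)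
          have h4 : κ ^ (e + 1) * (p * MvPolynomial.X i) - g * MvPolynomial.X (a, i.2) =
              κ ^ e * p * (κ * MvPolynomial.X i - MvPolynomial.X (a, i.2)) +
                (κ ^ e * p - g) * MvPolynomial.X (a, i.2) := by ring
          rw [h4]
          exact add_mem (Ideal.mul_mem_left _ _ h3) (Ideal.mul_mem_right _ _ hgK)
      · refine ⟨e, g * MvPolynomial.X i, fun x hx => ?_, ?_⟩
        · have h1 : x' x i = x i := if_neg hi
          rw [map_mul, map_mul, hg x hx, eval_X, eval_X, h1, mul_assoc]
        · rw [← mul_assoc, ← sub_mul]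
          exact Ideal.mul_mem_right _ _ hgK
  obtain ⟨e, g, hg, hgK⟩ := key f
  -- The additional factor `κ` covers chart points with `κ = 0`, where the projection is
  -- unavailable.
  have hκg : κ * g ∈ K := by
    refine hI₀ _ fun x hx => ?_
    rw [map_mul, hκ, eval_X]
    by_cases h0 : x (a, j b) = 0
    · rw [h0, zero_mul]
    have h1 : x' x ∈ pairDiagonal U j a b := by
      have ha : (fun m => x' x (a, m)) = fun m => x (a, m) := by
        funext m
        simp [x', hab]
      have hb : (fun m => x' x (b, m)) = (x (a, j b))⁻¹ • fun m => x (a, m) := by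
        funext m
        simp [x']
      refine ⟨fun c => ?_, ?_⟩
      · by_cases hc : c = b
        · subst hc
          refine ⟨?_, ?_⟩
          · simp [x', h0]
          · rw [hb]
            exact smul_mem_cone (hx a).2 _
        · have := hx c
          simpa [x', hc] using this
      · rw [ha, hb]
        exact (Submodule.span_singleton_smul_eq (IsUnit.mk0 _ (inv_ne_zero h0)) _).symm
    rw [hg x h0, mem_vanishingIdeal_iff_eval.1 hf _ h1]
    simp
  have h1 : κ ^ (e + 1) * f ∈ K := by
    have h2 : κ ^ (e + 1) * f = κ * (κ ^ e * f - g) + κ * g := by ring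
    rw [h2]
    exact add_mem (Ideal.mul_mem_left _ κ hgK) hκg
  have h2 : (u * κ) ^ (e + 1) - 1 ∈ K := by
    have := sub_dvd_pow_sub_pow (u * κ) 1 (e + 1)
    rw [one_pow] at this
    exact Ideal.mem_of_dvd _ this huκ
  have h3 : f = u ^ (e + 1) * (κ ^ (e + 1) * f) - f * ((u * κ) ^ (e + 1) - 1) := by
    rw [mul_pow]
    ring
  rw [h3]
  exact sub_mem (Ideal.mul_mem_left _ _ h1) (Ideal.mul_mem_left _ _ h2)

/-- At a smooth point of the diagonal, `projDim X` combinations of the equations of the diagonal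
generate its ideal. -/
theorem exists_diagonal_frame (hUS : U ⊆ smoothLocus X) {j : Fin d → Fin (N + 1)} {a b : Fin d}
    {x₀ : Fin d × Fin (N + 1) → ℂ} (hx₀ : x₀ ∈ pairDiagonal U j a b) :
    ∃ (M : Matrix (Fin (N + 1)) (Fin (N + 1)) (MvPolynomial (Fin d × Fin (N + 1)) ℂ))
      (ι : Fin (projDim X + 1) → Fin (N + 1)),
      (∀ i, (∀ k : Fin (projDim X), i ≠ ι k.succ) → ∑ m, M i m * diagDiff j a b m ∈
        MvPolynomial.vanishingIdeal ℂ (boxChart U j)) ∧ eval x₀ M.det ≠ 0 := by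
  have hb0 : (fun m => x₀ (b, m)) ≠ 0 := fun h => by
    have := congrFun h (j b)
    rw [Pi.zero_apply, (hx₀.1 b).1] at this
    exact one_ne_zero this
  set v : Vec N := fun m => x₀ (b, m) with hv
  have hδ : ∀ m, x₀ (b, m) = x₀ (b, j a) * x₀ (a, m) := fun m => by
    have := eval_diagDiff_eq_zero hx₀ m
    rw [eval_diagDiff] at this
    exact sub_eq_zero.1 this
  have hj : v (j a) ≠ 0 := by
    intro h
    have h1 := hδ (j b)
    rw [show x₀ (b, j a) = 0 from h, zero_mul, (hx₀.1 b).1] at h1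
    exact one_ne_zero h1
  have hvs : Projectivization.mk ℂ v hb0 ∈ smoothLocus X :=
    hUS ((mem_cone_iff_mk hb0).1 (hx₀.1 b).2)
  obtain ⟨Q, ι, α, hι, hQ, hQl, hQ0, hdet⟩ := exists_frame_of_mem_smoothLocus hb0 hvs hj
  let xb : Fin (N + 1) → MvPolynomial (Fin d × Fin (N + 1)) ℂ := fun m => MvPolynomial.X (b, m)
  let ua : Fin (N + 1) → MvPolynomial (Fin d × Fin (N + 1)) ℂ := fun m =>
    MvPolynomial.X (b, j a) * MvPolynomial.X (a, m)
  choose M hM hM' using fun i => exists_difference_quotients (Q i) xb ua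
  have hxb : ∀ (x : Fin d × Fin (N + 1) → ℂ) (F : Forms N),
      eval x (aeval xb F) = eval (fun m => x (b, m)) F := by
    intro x F
    rw [← coe_aeval_eq_eval, ← coe_aeval_eq_eval]
    change aeval x (aeval xb F) = aeval _ F
    rw [← AlgHom.comp_apply, comp_aeval]
    simp [xb]
  have hua : ∀ (x : Fin d × Fin (N + 1) → ℂ) (F : Forms N),
      eval x (aeval ua F) = eval (x (b, j a) • fun m => x (a, m)) F := by
    intro x F
    rw [← coe_aeval_eq_eval, ← coe_aeval_eq_eval]
    change aeval x (aeval ua F) = aeval _ F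
    rw [← AlgHom.comp_apply, comp_aeval]
    congr 1
    simp [ua]
    rfl
  refine ⟨Matrix.of M, ι, fun i hi => ?_, ?_⟩
  · have h1 : ∑ m, Matrix.of M i m * diagDiff j a b m = aeval xb (Q i) - aeval ua (Q i) :=
      (hM i).symm
    rw [h1, mem_vanishingIdeal_iff_eval]
    intro x hx
    rw [map_sub, hxb, hua]
    by_cases hr : i ∈ Set.range ι
    · obtain ⟨k, rfl⟩ := hr
      -- The row of `ι 0` comes from the coordinate `x_{j a}`. Its two values agree on the chart
      -- because `x (a, j a) = 1`, and this leaves only `projDim X` essential rows.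
      have hk : k = 0 := by
        by_contra hk
        exact hi (k.pred hk) (by rw [Fin.succ_pred])
      rw [hk, hQ0]
      simp [(hx a).1]
    · have hUX : cone U ⊆ cone X := cone_mono fun z hz => (hUS hz).1
      rw [mem_homIdeal.1 (hQ i hr) _ (hUX (hx b).2),
        mem_homIdeal.1 (hQ i hr) _ (smul_mem_cone (hUX (hx a).2) _), sub_zero]
  · have h1 : ∀ i m, eval x₀ (M i m) = eval v (pderiv m (Q i)) := by
      intro i m
      have h2 : ∀ g ∈ Ideal.span (Set.range fun m => xb m - ua m), eval x₀ g = 0 := by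
        intro g hg
        have : Ideal.span (Set.range fun m => xb m - ua m) ≤ RingHom.ker (eval x₀) := by
          rw [Ideal.span_le]
          rintro _ ⟨m, rfl⟩
          exact eval_diagDiff_eq_zero hx₀ m
        exact this hg
      have h3 := h2 _ (hM' i m)
      rw [map_sub, hua, sub_eq_zero] at h3
      rw [h3]
      congr 2
      funext m
      exact (hδ m).symm
    rw [RingHom.map_det]
    rw [jacDet, RingHom.map_det] at hdet
    convert! hdet using 2
    ext i m
    simp [h1]

end DiagonalEquations

/-! ### From isotropy to vanishing along the diagonal. -/

section ToDiagonal

variable {N d : ℕ} {X A U : Set (PSpace N)}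

/-- If the jets of order at most `k` pair to zero, the leading form along the diagonal of the
polarization vanishes in degrees less than `2 * k + 2`. -/
theorem eval_coeff_eq_zero_of_isPairIsotropic {k : ℕ} {F : Forms N} (hA : IsZariskiClosed A)
    (hU : U = X \ A) (j : Fin d → Fin (N + 1)) {a b : Fin d} (hab : a ≠ b) {y : PSpace N}
    {ψ : (Fin (projDim X) → ℂ) → Vec N} (hψ : IsLocalLift X y ψ)
    (hiso : ∀ᶠ τ in 𝓝 0, IsPairIsotropic d F (jetSpan (fun t => ψ (τ + t)) k))
    {u : Fin d → Vec N} (hua : u a = ψ 0) (hub : u b = ψ 0)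
    (hu : ∀ c, u c ∈ cone U ∧ u c (j c) ≠ 0)
    {M : Matrix (Fin (N + 1)) (Fin (N + 1)) (MvPolynomial (Fin d × Fin (N + 1)) ℂ)}
    {ι : Fin (projDim X + 1) → Fin (N + 1)}
    (hM : ∀ i, (∀ k : Fin (projDim X), i ≠ ι k.succ) → ∑ m, M i m * diagDiff j a b m ∈
      MvPolynomial.vanishingIdeal ℂ (boxChart U j))
    (hdet : eval (normalCoord j u) M.det ≠ 0) {s : MvPolynomial (Fin d × Fin (N + 1)) ℂ}
    {p : MvPolynomial (Fin (projDim X)) (MvPolynomial (Fin d × Fin (N + 1)) ℂ)} {r : ℕ}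
    (hr : r < 2 * k + 2) (hp : p.IsHomogeneous r)
    (hs : s * polarization d F - eval (fun k => ∑ m, M (ι k.succ) m * diagDiff j a b m) p ∈
      MvPolynomial.vanishingIdeal ℂ (boxChart U j)) (n : Fin (projDim X) →₀ ℕ) :
    eval (normalCoord j u) (p.coeff n) = 0 := by
  set x₀ := normalCoord j u with hx₀
  have hja : ψ 0 (j a) ≠ 0 := by rw [← hua]; exact (hu a).2
  have hjb : ψ 0 (j b) ≠ 0 := by rw [← hub]; exact (hu b).2
  have hUX : cone U ⊆ cone X := cone_mono (by rw [hU]; exact Set.sdiff_subset)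
  let v₀ : Vec N := (ψ 0 (j a))⁻¹ • ψ 0
  -- The derivative of the equations `diagDiff` when the `b`-th vector moves off `ψ 0`. It kills
  -- only the radial direction.
  let L : Vec N →ₗ[ℂ] Vec N :=
    (ψ 0 (j b))⁻¹ • (LinearMap.id - (LinearMap.proj (j a)).smulRight v₀)
  have hL : ∀ w m, L w m = (ψ 0 (j b))⁻¹ * (w m - w (j a) * v₀ m) := fun w m => by
    simp [L]
  let M₀ : Matrix (Fin (N + 1)) (Fin (N + 1)) ℂ := M.map (eval x₀)
  have hM₀ : M₀.det ≠ 0 := by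
    rw [RingHom.map_det] at hdet
    exact hdet
  let D : (Fin (projDim X) → ℂ) → Vec N := fun h => L (fderiv ℂ ψ 0 h)
  let v : (Fin (projDim X) → ℂ) → ℂ → Fin d → Vec N := fun h ε => Function.update u b (ψ (ε • h))
  have hva : ∀ h ε, v h ε a = ψ 0 := fun h ε => by
    simp only [v]
    rw [Function.update_of_ne hab, hua]
  have hvb : ∀ h ε, v h ε b = ψ (ε • h) := fun h ε => by simp only [v]; rw [Function.update_self]
  have hvc : ∀ h ε c, c ≠ b → v h ε c = u c := fun h ε c hc => by
    simp only [v]; rw [Function.update_of_ne hc]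
  have hv0 : ∀ h, v h 0 = u := fun h => by
    simp only [v]
    rw [zero_smul, ← hub, Function.update_eq_self]
  have hline : ∀ h : Fin (projDim X) → ℂ, AnalyticAt ℂ (fun ε : ℂ => ψ (ε • h)) 0 := fun h =>
    AnalyticAt.comp (g := ψ) (by rw [zero_smul]; exact hψ.analyticAt)
      (analyticAt_id.smul analyticAt_const)
  have hvan : ∀ h c, AnalyticAt ℂ (fun ε => v h ε c) 0 := by
    intro h c
    by_cases hc : c = b
    · subst hc; simpa only [hvb] using hline h
    · simp only [hvc h _ c hc]; exact analyticAt_const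
  have hvX : ∀ h c, ∀ᶠ ε in 𝓝 0, v h ε c ∈ cone X := by
    intro h c
    by_cases hc : c = b
    · subst hc
      simp only [hvb]
      have h1 : Filter.Tendsto (fun ε : ℂ => ε • h) (𝓝 0) (𝓝 0) := by
        have : Continuous fun ε : ℂ => ε • h := continuous_id.smul continuous_const
        simpa using this.tendsto 0
      exact h1.eventually hψ.mem_cone
    · simp only [hvc h _ c hc]
      exact Filter.Eventually.of_forall fun _ => hUX (hu c).1
  let x : (Fin (projDim X) → ℂ) → ℂ → Fin d × Fin (N + 1) → ℂ := fun h ε => normalCoord j (v h ε)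
  have hx0 : ∀ h, x h 0 = x₀ := fun h => by simp only [x, hv0, hx₀]
  have hx : ∀ h, AnalyticAt ℂ (x h) 0 := fun h =>
    analyticAt_normalCoord j (hvan h) (by rw [hv0]; exact fun c => (hu c).2)
  have hchart : ∀ h, ∀ᶠ ε in 𝓝 0, x h ε ∈ boxChart U j := fun h =>
    eventually_normalCoord_mem_boxChart hA hU j (fun c => (hvan h c).continuousAt) (hvX h)
      (by rw [hv0]; exact fun c => (hu c).1) (by rw [hv0]; exact fun c => (hu c).2)
  have he : ∀ h g, Filter.Tendsto (fun ε => eval (x h ε) g) (𝓝[≠] 0) (𝓝 (eval x₀ g)) := by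
    intro h g
    have := (analyticAt_eval_mvPolynomial g (hx h)).continuousAt.tendsto
    rw [hx0] at this
    exact this.mono_left nhdsWithin_le_nhds
  have hδ : ∀ h m, Filter.Tendsto (fun ε => ε⁻¹ * eval (x h ε) (diagDiff j a b m)) (𝓝[≠] 0)
      (𝓝 (D h m)) := by
    intro h m
    have h1 : HasDerivAt (fun ε : ℂ => ψ (ε • h)) (fderiv ℂ ψ 0 h) 0 := by
      have h2 : HasDerivAt (fun ε : ℂ => ε • h) h 0 := by
        simpa using (hasDerivAt_id (0 : ℂ)).smul_const h
      have h3 : HasFDerivAt ψ (fderiv ℂ ψ 0) ((0 : ℂ) • h) := by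
        rw [zero_smul]
        exact hψ.analyticAt.differentiableAt.hasFDerivAt
      exact h3.comp_hasDerivAt 0 h2
    have h2 := hasDerivAt_iff_tendsto_slope_zero.1 h1
    simp only [zero_add, zero_smul] at h2
    have h3 := fun m => (tendsto_pi_nhds.1 h2) m
    have h4 : Filter.Tendsto (fun ε : ℂ => (ψ (ε • h) (j b))⁻¹) (𝓝[≠] 0) (𝓝 (ψ 0 (j b))⁻¹) := by
      have h5 := (tendsto_pi_nhds.1 (hline h).continuousAt.tendsto) (j b)
      simp only [zero_smul] at h5
      exact (h5.mono_left nhdsWithin_le_nhds).inv₀ hjb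
    have h5 := h4.mul ((h3 m).sub ((h3 (j a)).mul_const (v₀ m)))
    rw [← hL] at h5
    refine h5.congr fun ε => ?_
    have h6 : ψ 0 (j a) * v₀ m = ψ 0 m := by
      simp only [v₀, Pi.smul_apply, smul_eq_mul]
      rw [mul_inv_cancel_left₀ hja]
    rw [eval_diagDiff]
    simp only [x, normalCoord, hva, hvb, Pi.smul_apply, Pi.sub_apply, smul_eq_mul]
    have h7 : (ψ 0 (j a))⁻¹ * ψ 0 m = v₀ m := rfl
    rw [h7]
    linear_combination ((ψ (ε • h) (j b))⁻¹ * ε⁻¹) * h6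
  have hlim : ∀ h i, Filter.Tendsto
      (fun ε => ε⁻¹ * eval (x h ε) (∑ m, M i m * diagDiff j a b m)) (𝓝[≠] 0)
      (𝓝 (M₀.mulVec (D h) i)) := by
    intro h i
    have h1 := tendsto_finsetSum Finset.univ fun m _ => (he h (M i m)).mul (hδ h m)
    refine h1.congr fun ε => ?_
    rw [map_sum, Finset.mul_sum]
    exact Finset.sum_congr rfl fun m _ => by rw [map_mul]; ring
  have hrow : ∀ h i, (∀ k : Fin (projDim X), i ≠ ι k.succ) → M₀.mulVec (D h) i = 0 := by
    intro h i hi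
    refine tendsto_nhds_unique (hlim h i) (Filter.Tendsto.congr' ?_ tendsto_const_nhds)
    filter_upwards [(hchart h).filter_mono nhdsWithin_le_nhds] with ε hε
    rw [mem_vanishingIdeal_iff_eval.1 (hM i hi) _ hε, mul_zero]
  let T : (Fin (projDim X) → ℂ) →ₗ[ℂ] (Fin (projDim X) → ℂ) :=
    (LinearMap.funLeft ℂ ℂ fun k : Fin (projDim X) => ι k.succ) ∘ₗ M₀.mulVecLin ∘ₗ L ∘ₗ
      (fderiv ℂ ψ 0 : (Fin (projDim X) → ℂ) →ₗ[ℂ] Vec N)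
  have hT : ∀ h k, T h k = M₀.mulVec (D h) (ι k.succ) := fun _ _ => rfl
  -- The rows not in the image of `k ↦ ι k.succ` vanish anyway and `M₀` is invertible, so `T h = 0`
  -- makes the derivative of `ψ` along `h` radial.
  have hTinj : Function.Injective T := by
    rw [injective_iff_map_eq_zero]
    intro h hh
    have h1 : M₀.mulVec (D h) = 0 := by
      funext i
      by_cases hi : ∀ k : Fin (projDim X), i ≠ ι k.succ
      · exact hrow h i hi
      · push Not at hi
        obtain ⟨k, rfl⟩ := hi
        rw [← hT, hh]
        rfl
    have h2 := Matrix.eq_zero_of_mulVec_eq_zero hM₀ h1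
    refine hψ.immersion h (Submodule.mem_span_singleton.2
      ⟨fderiv ℂ ψ 0 h (j a) * (ψ 0 (j a))⁻¹, ?_⟩)
    funext m
    have h3 : D h m = 0 := by rw [h2]; rfl
    simp only [D, hL] at h3
    have h4 := sub_eq_zero.1 ((mul_eq_zero.1 h3).resolve_left (inv_ne_zero hjb))
    rw [h4]
    simp only [v₀, Pi.smul_apply, smul_eq_mul]
    ring
  -- As `T` is bijective, every vector `w` is the limiting direction of the generators along some
  -- line in the parametrization. Contact of order `2k + 2 > r` along that line makes the leading
  -- form vanish at `w`.
  have hmap : map (eval x₀) p = 0 := by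
    refine MvPolynomial.funext fun w => ?_
    obtain ⟨h, rfl⟩ := LinearMap.injective_iff_surjective.1 hTinj w
    rw [map_zero]
    refine eval_map_eq_zero_of_isBigO p hp _ (fun ε => eval (x h ε)) (eval x₀) _ (he h)
      (fun k => hlim h (ι k.succ)) ?_
    have h1 := isBigO_pairing_of_jetSpan (pairForm F hab u) (pairForm_symm F hab u)
      hψ.analyticAt (k := k) (by
        filter_upwards [hiso] with τ hτ x hx y hy
        rw [pairForm_apply]
        exact hτ a b hab _ (by simpa [Function.update_of_ne hab] using hx) (by simpa using hy)) h
    have h2 : (fun ε : ℂ => ‖ε‖ ^ (2 * k + 2)) =O[𝓝 0] fun ε => ‖ε‖ ^ (r + 1) := by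
      have h3 : ∀ᶠ ε : ℂ in 𝓝 0, ‖ε‖ < 1 := by
        have : Filter.Tendsto (fun ε : ℂ => ‖ε‖) (𝓝 0) (𝓝 0) := by
          simpa using (continuous_norm (E := ℂ)).tendsto 0
        exact this.eventually_lt_const one_pos
      refine Asymptotics.IsBigO.of_bound 1 ?_
      filter_upwards [h3] with ε hε
      rw [one_mul, norm_pow, norm_pow, norm_norm]
      exact pow_le_pow_of_le_one (norm_nonneg _) hε.le hr
    have h3 : (fun ε => eval (x h ε) s * ∏ c, (v h ε c (j c))⁻¹) =O[𝓝 0] fun _ => (1 : ℝ) := by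
      have h4 : ContinuousAt (fun ε => eval (x h ε) s) 0 :=
        (analyticAt_eval_mvPolynomial s (hx h)).continuousAt
      have h5 : ContinuousAt (fun ε => ∏ c, (v h ε c (j c))⁻¹) 0 := by
        refine tendsto_finsetProd _ fun c _ => ?_
        refine ContinuousAt.inv₀ (ContinuousAt.comp (g := fun w : Vec N => w (j c))
          (continuous_apply (j c)).continuousAt (hvan h c).continuousAt) ?_
        rw [hv0]
        exact (hu c).2
      exact (h4.mul h5).isBigO_one ℝ
    have h4 := h3.mul (h1.trans h2)
    simp only [one_mul, zero_add] at h4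
    refine (h4.congr' ?_ Filter.EventuallyEq.rfl).mono nhdsWithin_le_nhds
    filter_upwards [hchart h] with ε hε
    have h5 := mem_vanishingIdeal_iff_eval.1 hs _ hε
    rw [map_sub, sub_eq_zero] at h5
    rw [← h5, map_mul, eval_normalCoord_polarization, pairForm_symm, pairForm_apply, ← hua,
      Function.update_eq_self, mul_assoc]
  rw [← coeff_map, hmap, coeff_zero]

/-- A form isotropic for the jet spaces at the points of a local parametrization vanishes to order
`2 * k + 2` along the diagonal. -/
theorem vanishesAlongDiagonal_of_isPairIsotropic (hX : IsProjectiveVariety X)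
    (hA : IsZariskiClosed A) (hU : U = X \ A) (hne : U.Nonempty) (hUS : U ⊆ smoothLocus X)
    {k : ℕ} {F : Forms N} {z : PSpace N} (hz : z ∈ smoothLocus X)
    {φ : (Fin (projDim X) → ℂ) → Vec N} (hφ : IsLocalLift X z φ)
    (hiso : ∀ᶠ τ in 𝓝 0, IsPairIsotropic d F (jetSpan (fun t => φ (τ + t)) k)) :
    VanishesAlongDiagonal U d (2 * k + 2) F := by
  refine vanishesAlongDiagonal_of_exists hX.2 hA hU hne d _ F fun j a b hab htop => ?_
  have hprime := isPrime_vanishingIdeal_pairDiagonal hX.2 hA hU hne j a b htop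
  obtain ⟨x₀, hx₀⟩ : (pairDiagonal U j a b).Nonempty := by
    by_contra h
    refine htop ((Ideal.eq_top_iff_one _).2 (mem_vanishingIdeal_iff_eval.2 fun x hx => ?_))
    exact absurd ⟨x, hx⟩ h
  obtain ⟨M, ι, hM, hdet⟩ := exists_diagonal_frame hUS hx₀
  have hs₀ : M.det ∉ MvPolynomial.vanishingIdeal ℂ (pairDiagonal U j a b) := fun h =>
    hdet (mem_vanishingIdeal_iff_eval.1 h _ hx₀)
  have hf : ∀ k : Fin (projDim X), ∑ m, M (ι k.succ) m * diagDiff j a b m ∈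
      MvPolynomial.vanishingIdeal ℂ (pairDiagonal U j a b) := fun k =>
    Ideal.sum_mem _ fun m _ => Ideal.mul_mem_left _ _
      (mem_vanishingIdeal_iff_eval.2 fun x hx => eval_diagDiff_eq_zero hx m)
  have h₀ : ∀ g ∈ MvPolynomial.vanishingIdeal ℂ (pairDiagonal U j a b), M.det * g ∈
      Ideal.span (Set.range fun k : Fin (projDim X) => ∑ m, M (ι k.succ) m * diagDiff j a b m) ⊔
        MvPolynomial.vanishingIdeal ℂ (boxChart U j) := by
    intro g hg
    set J := Ideal.span (Set.range fun k : Fin (projDim X) =>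
      ∑ m, M (ι k.succ) m * diagDiff j a b m) ⊔ MvPolynomial.vanishingIdeal ℂ (boxChart U j) with hJ
    have h1 : Ideal.span (Set.range (diagDiff j a b)) ⊔
        MvPolynomial.vanishingIdeal ℂ (boxChart U j) ≤
        Submodule.comap (LinearMap.mulLeft _ M.det) J := by
      refine sup_le (Ideal.span_le.2 ?_) fun g hg => ?_
      · rintro _ ⟨m, rfl⟩
        refine det_mul_mem M J _ (fun i => ?_) m
        by_cases hi : ∀ k : Fin (projDim X), i ≠ ι k.succ
        · exact Ideal.mem_sup_right (hM i hi)
        · push Not at hi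
          obtain ⟨k, rfl⟩ := hi
          exact Ideal.mem_sup_left (Ideal.subset_span ⟨k, rfl⟩)
      · exact Ideal.mul_mem_left _ _ (Ideal.mem_sup_right hg)
    exact h1 (mem_span_diagDiff_sup hab hg)
  refine exists_mul_mem_pow_sup _ _ _ hf M.det hs₀ h₀ _ _ fun r hr s _ p hp hsp n => ?_
  by_contra hcoeff
  obtain ⟨W, hWo, hW0, hW⟩ := hφ.exists_isOpen hz
  obtain ⟨W', hW', hWo', hW0'⟩ := eventually_nhds_iff.1 hiso
  have hnhds : W ∩ W' ∈ 𝓝 0 := Filter.inter_mem (hWo.mem_nhds hW0) (hWo'.mem_nhds hW0')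
  -- If a coefficient were nonzero on the diagonal, it and `M.det` would both be nonzero at a
  -- diagonal tuple of points of the parametrization near `z`, where isotropy forces the coefficient
  -- to vanish.
  obtain ⟨u, huS, hub, hu, huc, hudet⟩ := exists_generic_on_pairDiagonal hX.2 hA hU hne j a b
    (fun _ => {v | ∃ t ∈ W ∩ W', ∃ e : ℂ, v = e • φ t}) (by
      rintro c _ ⟨t, ht, e, rfl⟩
      obtain ⟨y, -, hy⟩ := hW t ht.1
      refine smul_mem_cone ?_ e
      simpa using hy.mem_cone.self_of_nhds)
    (fun c H hH => hφ.exists_eval_ne_zero hX hz hnhds hH) _ _ hcoeff hs₀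
  obtain ⟨t, ht, e, hua⟩ := huS a hab
  have he : e ≠ 0 := by
    rintro rfl
    exact (hu a).2 (by rw [hua, zero_smul]; rfl)
  obtain ⟨y, hy, hyl⟩ := hW t ht.1
  let u' : Fin d → Vec N := Function.update (Function.update u a (φ t)) b (φ t)
  have hu'a : u' a = φ t := by simp [u', Function.update_of_ne hab]
  have hu'b : u' b = φ t := by simp [u']
  have huu' : ∀ c, ∃ e : ℂ, e ≠ 0 ∧ u' c = e • u c := by
    intro c
    by_cases h1 : c = a
    · subst h1
      exact ⟨e⁻¹, inv_ne_zero he, by rw [hu'a, hua, inv_smul_smul₀ he]⟩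
    by_cases h2 : c = b
    · subst h2
      exact ⟨e⁻¹, inv_ne_zero he, by rw [hu'b, hub, hua, inv_smul_smul₀ he]⟩
    · exact ⟨1, one_ne_zero, by simp [u', h1, h2]⟩
  rw [← normalCoord_congr j huu'] at huc hudet
  have htend : Filter.Tendsto (fun τ => t + τ) (𝓝 0) (𝓝 t) := by
    simpa using (continuous_const_add t).tendsto 0
  refine huc (eval_coeff_eq_zero_of_isPairIsotropic hA hU j hab hyl ?_ (u := u')
    (by rw [hu'a, add_zero]) (by rw [hu'b, add_zero]) (fun c => ?_) hM hudet hr hp hsp n)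
  · filter_upwards [htend.eventually (hWo'.mem_nhds ht.2)] with τ hτ
    simpa only [add_assoc] using hW' _ hτ
  · obtain ⟨e, he, hc⟩ := huu' c
    rw [hc]
    exact ⟨smul_mem_cone (hu c).1 e, mul_ne_zero he (hu c).2⟩

end ToDiagonal

end OscSec

theorem theorem2 (N : ℕ) (X : Set (OscSec.PSpace N))
    (hX : OscSec.IsProjectiveVariety X) (hnd : OscSec.IsNondegenerate X)
    (q k : ℕ) (hq : 1 ≤ q)
    (U : Set (OscSec.PSpace N)) (hU : OscSec.IsOscMaximalOpen X k U) :
    (OscSec.homIdealPart (OscSec.secOsc X q k) (q + 1) : Set (OscSec.Forms N)) =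
      {F : OscSec.Forms N | F.IsHomogeneous (q + 1) ∧
        OscSec.VanishesAlongDiagonal U (q + 1) (2 * k + 2) F} := by
  obtain ⟨A, hA, hUA⟩ := hU.isOpen
  ext F
  refine and_congr (MvPolynomial.mem_homogeneousSubmodule _ _) Iff.rfl |>.trans ?_
  refine and_congr_right fun hF => ⟨fun hFσ => ?_, fun hv => ?_⟩
  · obtain ⟨z, hz, φ, hφ, hiso⟩ := OscSec.exists_isPairIsotropic_jetSpan hX hnd
      (hU.nonempty.mono hU.subset_smooth) hq hF hFσ
    exact OscSec.vanishesAlongDiagonal_of_isPairIsotropic hX hA hUA hU.nonempty hU.subset_smooth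
      hz hφ hiso
  · exact OscSec.mem_homIdeal_secOsc_of_isPairIsotropic hX hF fun z hz φ hφ =>
      OscSec.isPairIsotropic_of_vanishesAlongDiagonal hX hnd hA hUA hU.nonempty hq hv hz hφ
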